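/- **Setting.** Let $\mathbf k$ be a differential field of characteristic $0$ with one derivation $\delta$, let $\mathbf k\{Y\}=\mathbf k\{y_1,\dots,y_n\}$ be the ring of ordinary differential polynomials, and fix a ranking (a total order on the derivatives $y_i^{(j)}$ with $u\le\delta u$, and $u\le v\Rightarrow\delta u\le\delta v$). For $f\notin\mathbf k$ let $\operatorname{ld}f=y_i^{(j)}$ be the highest derivative in $f$ (the leader), $\operatorname{lv}f=y_i$, $\operatorname{rk}f=(\operatorname{ld}f)^{d}$ with $d=\deg_{\operatorname{ld}f}f$ (ranks are compared lexicographically, elements of $\mathbf k$ have the lowest rank), $\mathbf i_f$ the coefficient of $(\operatorname{ld}f)^d$ in $f$ and $\mathbf s_f=\partial f/\partial\operatorname{ld}f$; $H_A$ is the set of all $\mathbf i_f,\mathbf s_f$ with $f\in A$, and $H_f=H_{\{f\}}$. A polynomial $f$ is partially reduced w.r.t. $g$ if no proper derivative of $\operatorname{ld}g$ occurs in $f$, and reduced if moreover $\deg_{\operatorname{ld} g}f<\deg_{\operatorname{ld}g}g$; a set $A\subset\mathbf k\{Y\}\setminus\mathbf k$ is autoreduced if each element is reduced w.r.t. every other one.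 A system $(A,H)$ of finite sets is regular if $A$ is autoreduced, $H$ is partially reduced w.r.t. $A$, and $H_A\subseteq H$. $[F]$ and $\{F\}$ are the differential and the radical differential ideal generated by $F$; $I:S^\infty=\{a\mid sa\in I\text{ for some }s\in S^\infty\}$, where $S^\infty$ is the multiplicative set generated by $S\cup\{1\}$. Let $m_y(F)$ be the maximal order of $y$ in $F$ ($0$ if $y$ does not occur), $M(F)=\sum_{i}m_{y_i}(F)$. A differential remainder of $f$ w.r.t. a finite set $\mathbb D\subset\mathbf k\{Y\}\setminus\mathbf k$ is a $g$, reduced w.r.t. $\mathbb D$, with $hf-g\in[\mathbb D]:H_{\mathbb D}^\infty$ for some $h\in H_{\mathbb D}^\infty$. For $b=(b_y)_{y\in Y}$, $\mathrm{Truncate}(f,b)$ is the sum of the terms of $f$ in which each $y$ has order at most $b_y$. **Algorithm** (input: finite sets $F_0\ne\varnothing$, $F_0\cap\mathbf k=\varnothing$, and $H_0$). Put $T:=\varnothing$, $U:=\{(F_0,\varnothing,H_0)\}$. While $U\neq\varnothing$: take and remove any $(F,\mathbb C,H)\in U$, and let $f$ be any element of $F$ of least rank. Put $D:=\{C\in\mathbb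 C\mid\operatorname{lv}C=\operatorname{lv}f\}$, $G:=(F\cup D)\setminus\{f\}$, $\bar{\mathbb C}:=(\mathbb C\setminus D)\cup\{f\}$, $\bar G:=G\cup\bar{\mathbb C}\cup H$; $b_y:=m_y(\bar G)$ for $y\in\operatorname{lv}\bar{\mathbb C}$ and $b_z:=m_z(\bar G)+\sum_{y\in\operatorname{lv}\bar{\mathbb C}}\bigl(m_y(\bar G)-m_y(\operatorname{ld}\bar{\mathbb C})\bigr)$ for $z\notin\operatorname{lv}\bar{\mathbb C}$. 1. Put $\mathbb D:=\varnothing$; for $C\in\bar{\mathbb C}$ in order of increasing rank, take any differential remainder $E$ of $C$ w.r.t. $\mathbb D$ with $\operatorname{rk}E\le\operatorname{rk}C$ and put $\mathbb D:=\mathbb D\cup\{\mathrm{Truncate}(E,b)\}$; as soon as $\operatorname{rk}\mathrm{Truncate}(E,b)\neq\operatorname{rk}C$, abandon the loop and skip step 2. 2. Put $\bar F:=\mathrm{Truncate}(R,b)\setminus\{0\}$ and $\bar H:=\mathrm{Truncate}(R'\cup H_{\mathbb D},b)$, where $R$ and $R'$ consist of one arbitrary differential remainder w.r.t. $\mathbb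 D$ of each element of $G$ and of $H\cup H_f$, respectively. If $\bar F\cap\mathbf k=\varnothing$ and $0\notin\bar H$, then add $(\mathbb D,\bar H)$ to $T$ if $\bar F=\varnothing$, and add $(\bar F,\mathbb D,\bar H)$ to $U$ otherwise. 3. If $\mathbf s_f\notin\mathbf k$, add $(F\cup\{\mathbf s_f\},\mathbb C,H)$ to $U$ and, if moreover $\mathbf i_f\notin\mathbf k$, also $(F\cup\{\mathbf i_f\},\mathbb C,H)$. Return $T$ when $U=\varnothing$. **Proposition.** For every such input and for all choices made, the algorithm can always carry out its next step and terminates. At every moment $M(F\cup\mathbb C\cup H)\le(n-1)!\,M(F_0\cup H_0)$ for all $(F,\mathbb C,H)\in U$. The output $T$ is a finite set of regular systems with $$\{F_0\}:H_0^\infty=\bigcap_{(\mathbb A,H)\in T}[\mathbb A]:H^\infty\qquad\text{and}\qquad M(\mathbb A\cup H)\le(n-1)!\,M(F_0\cup H_0)\quad\text{for all }(\mathbb A,H)\in T.$$ -/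

import Mathlib

/-! Ordinary differential polynomials over a differential field, rankings, differential remainders,
regular systems, and the reduction-independent Rosenfeld-Gröbner algorithm as a transition system. -/

open scoped Classical

noncomputable section

namespace DiffAlg

/-- The derivative `δ ^ ord y_var` of one of the differential indeterminates `y_1, …, y_n`. -/
@[ext]
structure Der (n : ℕ) where
  var : Fin n
  ord : ℕ

/-- Application of `δ ^ j` to a derivative. -/
def Der.shift {n : ℕ} (u : Der n) (j : ℕ) : Der n := ⟨u.var, u.ord + j⟩

/-- The given total order on the derivatives is a (differential) ranking. -/
structure IsRanking (n : ℕ) [LinearOrder (Der n)] : Prop where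
  le_shift : ∀ (u : Der n) (j : ℕ), u ≤ u.shift j
  shift_le_shift : ∀ (u v : Der n) (j : ℕ), u ≤ v → u.shift j ≤ v.shift j

/-- The ring of ordinary differential polynomials `k{y_1, …, y_n}`. -/
abbrev DPoly (k : Type*) [Field k] (n : ℕ) := MvPolynomial (Der n) k

section ideals

variable {k : Type*} [Field k] [Differential k] {n : ℕ}

/-- The derivation of `k{y_1, …, y_n}`: it extends the derivation of `k` (first summand: the
derivation applied to the coefficients) and maps `y_i^{(j)}` to `y_i^{(j+1)}` (second summand). -/
def delta (f : DPoly k n) : DPoly k n :=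
  ∑ m ∈ f.support, MvPolynomial.monomial m (Differential.deriv (f.coeff m)) +
    MvPolynomial.mkDerivation k (fun u : Der n => (MvPolynomial.X (u.shift 1) : DPoly k n)) f

/-- Differential ideals. -/
def IsDiffIdeal (I : Ideal (DPoly k n)) : Prop := ∀ f ∈ I, delta f ∈ I

/-- The differential ideal `[F]` generated by `F`. -/
def diffIdeal (F : Set (DPoly k n)) : Ideal (DPoly k n) :=
  sInf {I | IsDiffIdeal I ∧ F ⊆ I}

/-- The radical differential ideal `{F}` generated by `F`. -/
def radDiffIdeal (F : Set (DPoly k n)) : Ideal (DPoly k n) :=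
  sInf {I | IsDiffIdeal I ∧ I.IsRadical ∧ F ⊆ I}

/-- The saturation `I : S^∞`, where `S^∞` is the multiplicative set generated by `S` and `1`. -/
def sat (I : Ideal (DPoly k n)) (S : Set (DPoly k n)) : Ideal (DPoly k n) where
  carrier := {a | ∃ s ∈ Submonoid.closure S, s * a ∈ I}
  zero_mem' := ⟨1, one_mem _, by simp⟩
  add_mem' := by
    rintro a b ⟨s, hs, ha⟩ ⟨t, ht, hb⟩
    refine ⟨s * t, mul_mem hs ht, ?_⟩
    have h : s * t * (a + b) = t * (s * a) + s * (t * b) := by ring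
    rw [h]
    exact I.add_mem (I.mul_mem_left _ ha) (I.mul_mem_left _ hb)
  smul_mem' := by
    rintro c a ⟨s, hs, ha⟩
    refine ⟨s, hs, ?_⟩
    have h : s * (c • a) = c * (s * a) := by rw [smul_eq_mul]; ring
    rw [h]
    exact I.mul_mem_left _ ha

end ideals

section ranks

variable {k : Type*} [Field k] {n : ℕ}

/-- `f ∈ k`. -/
def IsConst (f : DPoly k n) : Prop := ∃ c : k, f = MvPolynomial.C c

/-- `m_y(F)`: the maximal order of `y` in `F`, and `0` if `y` does not occur in `F`. -/
def maxOrd (y : Fin n) (F : Finset (DPoly k n)) : ℕ :=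
  F.sup fun f => (f.vars.filter fun u => u.var = y).sup Der.ord

/-- `M(F) = ∑_y m_y(F)`. -/
def totalOrd (F : Finset (DPoly k n)) : ℕ := ∑ y : Fin n, maxOrd y F

/-- The sum of those terms of `f` in which every `y_i` has order at most `b i`. -/
def truncate (b : Fin n → ℕ) (f : DPoly k n) : DPoly k n :=
  ∑ m ∈ f.support.filter (fun m => ∀ u ∈ m.support, u.ord ≤ b u.var),
    MvPolynomial.monomial m (f.coeff m)

variable [LinearOrder (Der n)]

/-- The leader of `f`; it is `⊥` exactly for constants. -/
def ld (f : DPoly k n) : WithBot (Der n) := f.vars.max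

/-- The leading variable of `f`; it is `⊥` exactly for constants. -/
def lv (f : DPoly k n) : WithBot (Fin n) := (ld f).map Der.var

/-- The rank `u ^ d` of `f`, ordered lexicographically; it is `⊥` exactly for constants. -/
def rk (f : DPoly k n) : WithBot (Der n ×ₗ ℕ) :=
  (ld f).map fun u => toLex (u, f.degreeOf u)

/-- The coefficient of `u ^ d` in `f`, regarded as a polynomial in `u`. -/
def coeffOf (u : Der n) (d : ℕ) (f : DPoly k n) : DPoly k n :=
  ∑ m ∈ f.support.filter (fun m => m u = d), MvPolynomial.monomial (m.erase u) (f.coeff m)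

/-- The initial of `f` (used for non-constant `f` only). -/
def initial (f : DPoly k n) : DPoly k n :=
  if h : f.vars.Nonempty then coeffOf (f.vars.max' h) (f.degreeOf (f.vars.max' h)) f else 0

/-- The separant of `f` (used for non-constant `f` only). -/
def separant (f : DPoly k n) : DPoly k n :=
  if h : f.vars.Nonempty then MvPolynomial.pderiv (f.vars.max' h) f else 0

/-- `H_A`, the set of initials and separants of the elements of `A`. -/
def initSep (A : Finset (DPoly k n)) : Finset (DPoly k n) := A.image initial ∪ A.image separant

/-- `f` is partially reduced w.r.t. `g`. -/
def PartReduced (f g : DPoly k n) : Prop :=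
  ∀ u : Der n, ld g = u → ∀ j : ℕ, 0 < j → u.shift j ∉ f.vars

/-- `f` is reduced w.r.t. `g`. -/
def Reduced (f g : DPoly k n) : Prop :=
  PartReduced f g ∧ ∀ u : Der n, ld g = u → f.degreeOf u < g.degreeOf u

def Autoreduced (A : Finset (DPoly k n)) : Prop :=
  (∀ f ∈ A, ¬ IsConst f) ∧ ∀ f ∈ A, ∀ g ∈ A, f ≠ g → Reduced f g

/-- The system `A = 0, H ≠ 0` is regular. -/
def RegularSystem (A H : Finset (DPoly k n)) : Prop :=
  Autoreduced A ∧ (∀ h ∈ H, ∀ a ∈ A, PartReduced h a) ∧ initSep A ⊆ H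

/-- The leaders of the elements of `A`. -/
def ldSet (A : Finset (DPoly k n)) : Finset (Der n) :=
  A.biUnion fun f => f.vars.filter fun u => ld f = u

/-- The leading variables of the elements of `A`. -/
def lvSet (A : Finset (DPoly k n)) : Finset (Fin n) := (ldSet A).image Der.var

/-- `m_y(ld A)`. -/
def ldOrd (y : Fin n) (A : Finset (DPoly k n)) : ℕ :=
  ((ldSet A).filter fun u => u.var = y).sup Der.ord

/-- The truncation bound of the algorithm, for the sets `Cbar ⊆ Gbar`; for leading variables `y`
of `Cbar` one has `m_y(ld Cbar) ≤ m_y(Gbar)`, so the subtraction is the usual one. -/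
def orderBound (Cbar Gbar : Finset (DPoly k n)) (z : Fin n) : ℕ :=
  if z ∈ lvSet Cbar then maxOrd z Gbar
  else maxOrd z Gbar + ∑ y ∈ lvSet Cbar, (maxOrd y Gbar - ldOrd y Cbar)

end ranks

section algorithm

variable {k : Type*} [Field k] [Differential k] {n : ℕ} [LinearOrder (Der n)]

/-- `g` is a differential remainder of `f` w.r.t. `D`: it is reduced w.r.t. `D`, and
`h f - g ∈ [D] : H_D^∞` for some `h ∈ H_D^∞`. -/
def IsDiffRem (D : Finset (DPoly k n)) (f g : DPoly k n) : Prop :=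
  (∀ a ∈ D, Reduced g a) ∧
    ∃ h ∈ Submonoid.closure (initSep D : Set (DPoly k n)),
      h * f - g ∈ sat (diffIdeal (D : Set (DPoly k n))) (initSep D)

/-- The **for**-loop `D := D ∪ {Truncate (Rem (C, D), b)}`, started at the current set `D`, over the
list of the elements `C` still to be treated. The remainder `E` of `C` is any differential remainder
of rank at most `rk C`. The result `some D` means that all ranks have been preserved, so that the
final set `D` has the same rank as `Cbar`. As soon as a rank drops, `D` and `Cbar` cannot end up
with the same rank and everything computed is discarded; this is the result `none`. -/
inductive ForLoop (b : Fin n → ℕ) :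
    Finset (DPoly k n) → List (DPoly k n) → Option (Finset (DPoly k n)) → Prop
  | done (D : Finset (DPoly k n)) : ForLoop b D [] (some D)
  | next (D : Finset (DPoly k n)) (C E : DPoly k n) (L : List (DPoly k n))
      (r : Option (Finset (DPoly k n))) (hrem : IsDiffRem D C E) (hle : rk E ≤ rk C)
      (hrk : rk (truncate b E) = rk C) (hloop : ForLoop b (insert (truncate b E) D) L r) :
      ForLoop b D (C :: L) r
  | fail (D : Finset (DPoly k n)) (C E : DPoly k n) (L : List (DPoly k n))
      (hrem : IsDiffRem D C E) (hle : rk E ≤ rk C) (hrk : rk (truncate b E) ≠ rk C) :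
      ForLoop b D (C :: L) none

/-- A triple `(F, C, H)`. -/
structure Triple (k : Type*) [Field k] (n : ℕ) where
  F : Finset (DPoly k n)
  C : Finset (DPoly k n)
  H : Finset (DPoly k n)

/-- A state of the **while**-loop: the set `U` of triples to be treated and the set `T` of pairs
`(A, H)` found so far. -/
structure State (k : Type*) [Field k] (n : ℕ) where
  U : Finset (Triple k n)
  T : Finset (Finset (DPoly k n) × Finset (DPoly k n))

/-- The initial state. -/
def start (F₀ H₀ : Finset (DPoly k n)) : State k n := ⟨{⟨F₀, ∅, H₀⟩}, ∅⟩

/-- The additions to `U` and `T` after the **for**-loop, depending on its result. Here `remG` and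
`remH` give the arbitrary differential remainders chosen for the elements of `G` and of `H ∪ H_f`. -/
inductive Collect (b : Fin n → ℕ) (G H : Finset (DPoly k n)) (f : DPoly k n) :
    Option (Finset (DPoly k n)) → Finset (Triple k n) →
      Finset (Finset (DPoly k n) × Finset (DPoly k n)) → Prop
  | discard : Collect b G H f none ∅ ∅
  | reduce (D : Finset (DPoly k n)) (remG remH : DPoly k n → DPoly k n)
      (hG : ∀ g ∈ G, IsDiffRem D g (remG g))
      (hH : ∀ h ∈ H ∪ initSep {f}, IsDiffRem D h (remH h))
      (Fbar Hbar : Finset (DPoly k n))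
      (hF : Fbar = ((G.image remG).image (truncate b)).erase 0)
      (hHbar : Hbar = ((H ∪ initSep {f}).image remH ∪ initSep D).image (truncate b)) :
      Collect b G H f (some D)
        (if (∀ g ∈ Fbar, ¬ IsConst g) ∧ 0 ∉ Hbar ∧ Fbar ≠ ∅ then {⟨Fbar, D, Hbar⟩} else ∅)
        (if (∀ g ∈ Fbar, ¬ IsConst g) ∧ 0 ∉ Hbar ∧ Fbar = ∅ then {(D, Hbar)} else ∅)

/-- The triples added to `U` for the separant and the initial of `f`. -/
def split (t : Triple k n) (f : DPoly k n) : Finset (Triple k n) :=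
  if IsConst (separant f) then ∅
  else insert ⟨insert (separant f) t.F, t.C, t.H⟩
    (if IsConst (initial f) then ∅ else {⟨insert (initial f) t.F, t.C, t.H⟩})

/-- The elements of `C` with the same leading variable as `f`. -/
def conflict (C : Finset (DPoly k n)) (f : DPoly k n) : Finset (DPoly k n) :=
  C.filter fun c => lv c = lv f

/-- The body of the **while**-loop for the triple `t = (F, C, H)` and the element `f` of `F`; the
last two arguments are the additions to `U` and to `T`. -/
def Body (t : Triple k n) (f : DPoly k n) (U' : Finset (Triple k n))
    (T' : Finset (Finset (DPoly k n) × Finset (DPoly k n))) : Prop :=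
  let D := conflict t.C f
  let G := (t.F ∪ D) \ {f}
  let Cbar := (t.C \ D) ∪ {f}
  let Gbar := G ∪ Cbar ∪ t.H
  let b := orderBound Cbar Gbar
  ∃ (L : List (DPoly k n)) (r : Option (Finset (DPoly k n))) (U₁ : Finset (Triple k n)),
    L.Pairwise (fun p q => rk p < rk q) ∧ L.toFinset = Cbar ∧
    ForLoop b ∅ L r ∧ Collect b G t.H f r U₁ T' ∧ U' = U₁ ∪ split t f

/-- One iteration of the **while**-loop, with all admissible choices. -/
def Step (s s' : State k n) : Prop :=
  ∃ t ∈ s.U, ∃ f ∈ t.F, (∀ g ∈ t.F, rk f ≤ rk g) ∧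
    ∃ U' T', Body t f U' T' ∧ s' = ⟨s.U.erase t ∪ U', s.T ∪ T'⟩

/-- The state `s` can occur in a run of the algorithm with input `F₀, H₀`. -/
def Reachable (F₀ H₀ : Finset (DPoly k n)) (s : State k n) : Prop :=
  Relation.ReflTransGen Step (start F₀ H₀) s

end algorithm

end DiffAlg

end

open DiffAlg

/-! Call a finite set A regular modulo a differential ideal I (`RegularMod`) if A lies in I and the
initials and separants of A are non-zero-divisors modulo I, and let `regIdeal D` be [D]:H_D^∞. The
for-loop turns the triangular set A into an autoreduced D with the same ranks such that A is regular
modulo `regIdeal D`, while D is regular modulo every differential ideal modulo which A is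
(`LoopInv`). So congruences modulo `regIdeal D` may be used in all ideals that matter. The step
behind this is `LoopInv.congr`: if h C ≡ E and u is the leader of C, then taking derivatives and
coefficients with respect to u gives h s_C ≡ ∂E/∂u and h i_C ≡ the corresponding coefficient of E.
If the rank drops, this coefficient is 0 and the ideal is the whole ring (`LoopInv.eq_top`).
Otherwise replacing all polynomials by remainders preserves the saturated radical ideal
(`sat_rad_eq_of_remainders`). The zeros of i_f and s_f are recovered by `tripleIdeal_eq_split`, and
for the output the radical ideal may be replaced by the differential one by Lazard's lemma
(`regIdeal_isRadical`).

Truncation is harmless (`IsDiffRem.truncate`): modulo `regIdeal D` the polynomial f is a fraction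
p/s of polynomials of small orders. Differentiating the equations of A expresses each derivative of
a leading variable beyond its leader, at the cost of one order in the other variables per
differentiation (`X_shift_mem_fracAlg`). If g is a remainder with h f ≡ g, then s g - h p is
partially reduced, so by the Rosenfeld lemma a multiple of it lies in the algebraic ideal (D).
Truncation is a ring homomorphism that fixes everything here except g, so the truncated g satisfies
the same relation.

Termination: each step replaces one triple by finitely many smaller ones in a well-founded order.
Reduction lowers the order and degree of a leader attached to some variable; splitting keeps C and
lowers the least rank in F. The multiset extension of this order decreases.

The order bound: in a triple, the orders of the leading variables of C never exceed those of the
leaders, so in one reduction only the leading variable y of f can drop in order below its present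
maximum, and every non-leading variable grows by at most this drop. Counting each leading variable
max 1 (n - |V|) times, V being the set of leading variables, makes the drop pay for the growth.
Enlarging V costs a factor max 1 (n - 1 - |V|), and the product of these factors is at most (n -
1)!. -/

noncomputable section

namespace DiffAlg

open MvPolynomial

/-! ### Variables, truncation and partial derivatives of polynomials -/

section polynomials

variable {k : Type*} [Field k] {n : ℕ}

/-- An induction principle for polynomials in a set of variables. -/
lemma supported_induction {S : Set (Der n)} {p : DPoly k n → Prop} (hC : ∀ c : k, p (C c))
    (hX : ∀ u ∈ S, p (X u))
    (hadd : ∀ f ∈ supported k S, ∀ g ∈ supported k S, p f → p g → p (f + g))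
    (hmul : ∀ f ∈ supported k S, ∀ g ∈ supported k S, p f → p g → p (f * g))
    {f : DPoly k n} (hf : f ∈ supported k S) : p f := by
  refine Algebra.adjoin_induction (p := fun x _ => p x) ?_ (fun c => hC c)
    (fun x y hx hy => hadd x hx y hy) (fun x y hx hy => hmul x hx y hy) hf
  rintro _ ⟨u, hu, rfl⟩
  exact hX u hu

lemma C_mem_subalgebra (T : Subalgebra k (DPoly k n)) (c : k) : (C c : DPoly k n) ∈ T :=
  T.algebraMap_mem c

lemma supported_le_subalgebra {T : Subalgebra k (DPoly k n)} {S : Set (Der n)}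
    (h : ∀ w ∈ S, (X w : DPoly k n) ∈ T) : supported k S ≤ T := by
  refine Algebra.adjoin_le ?_
  rintro _ ⟨u, hu, rfl⟩
  exact h u hu

lemma pderiv_mem_supported {S : Set (Der n)} (u : Der n) {f : DPoly k n}
    (hf : f ∈ supported k S) : pderiv u f ∈ supported k S := by
  refine supported_induction (p := fun f => pderiv u f ∈ supported k S) ?_ ?_ ?_ ?_ hf
  · intro c; simp
  · intro w _
    rw [pderiv_X]
    by_cases h : w = u
    · subst h; simp
    · simp [h]
  · intro f _ g _ hf hg; rw [map_add]; exact add_mem hf hg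
  · intro f hf g hg hf' hg'
    rw [pderiv_mul]; exact add_mem (mul_mem hf' hg) (mul_mem hf hg')

lemma pderiv_eq_zero_of_mem_supported {u : Der n} {f : DPoly k n}
    (hf : f ∈ supported k ({u}ᶜ : Set (Der n))) : pderiv u f = 0 :=
  pderiv_eq_zero_of_notMem_vars fun h => by simpa using mem_supported.1 hf h

lemma isConst_iff_vars {f : DPoly k n} : IsConst f ↔ f.vars = ∅ := by
  constructor
  · rintro ⟨c, rfl⟩; simp
  · intro h; exact ⟨_, vars_eq_empty_iff_eq_C.1 h⟩

/-- Truncation as an algebra homomorphism. -/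
def truncHom (b : Fin n → ℕ) : DPoly k n →ₐ[k] DPoly k n :=
  aeval fun u : Der n => if u.ord ≤ b u.var then X u else 0

lemma truncate_eq_truncHom (b : Fin n → ℕ) (f : DPoly k n) : truncate b f = truncHom b f := by
  conv_rhs => rw [f.as_sum, map_sum]
  rw [truncate, Finset.sum_filter]
  refine Finset.sum_congr rfl fun m _ => ?_
  rw [truncHom, aeval_monomial, Finsupp.prod]
  split_ifs with h
  · rw [monomial_eq, Finsupp.prod]
    congr 1
    refine Finset.prod_congr rfl fun u hu => ?_
    rw [if_pos (h u hu)]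
  · push Not at h
    obtain ⟨u, hu, hlt⟩ := h
    rw [Finset.prod_eq_zero hu, mul_zero]
    rw [if_neg (not_le.2 hlt), zero_pow (Finsupp.mem_support_iff.1 hu)]

/-- The derivatives of order at most `b`. -/
def boundedDers (b : Fin n → ℕ) : Set (Der n) := {u | u.ord ≤ b u.var}

lemma truncHom_of_mem {b : Fin n → ℕ} {f : DPoly k n} (hf : f ∈ supported k (boundedDers b)) :
    truncHom b f = f := by
  refine Algebra.adjoin_induction (p := fun x _ => truncHom b x = x) ?_ (fun c => AlgHom.commutes _ c)
    (fun x y _ _ h1 h2 => by rw [map_add, h1, h2]) (fun x y _ _ h1 h2 => by rw [map_mul, h1, h2]) hf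
  rintro _ ⟨u, hu, rfl⟩
  have hu : u.ord ≤ b u.var := hu
  simp [truncHom, hu]

lemma coeff_truncate (b : Fin n → ℕ) (f : DPoly k n) (m : Der n →₀ ℕ) :
    (truncate b f).coeff m = if ∀ u ∈ m.support, u.ord ≤ b u.var then f.coeff m else 0 := by
  simp only [truncate, coeff_sum, coeff_monomial, Finset.sum_ite_eq', Finset.mem_filter,
    mem_support_iff]
  split_ifs with h1 h2 h2
  · rfl
  · exact absurd h1.2 h2
  · by_contra h; exact h1 ⟨fun h0 => h h0.symm, h2⟩
  · rfl

lemma support_truncate_subset (b : Fin n → ℕ) (f : DPoly k n) :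
    (truncate b f).support ⊆ f.support := by
  intro m hm
  rw [mem_support_iff, coeff_truncate] at hm
  rw [mem_support_iff]
  split_ifs at hm
  · exact hm
  · exact absurd rfl hm

lemma vars_subset_of_support_subset {f g : DPoly k n} (h : f.support ⊆ g.support) :
    f.vars ⊆ g.vars := by
  intro u hu
  rw [mem_vars_iff_mem_support] at hu ⊢
  obtain ⟨m, hm, hu⟩ := hu
  exact ⟨m, h hm, hu⟩

lemma degreeOf_le_of_support_subset {f g : DPoly k n} (h : f.support ⊆ g.support) (u : Der n) :
    f.degreeOf u ≤ g.degreeOf u := by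
  rw [degreeOf_eq_sup, degreeOf_eq_sup]
  exact Finset.sup_mono h

lemma truncate_mem_bounded (b : Fin n → ℕ) (f : DPoly k n) :
    truncate b f ∈ supported k (boundedDers b) := by
  rw [mem_supported]
  intro u hu
  obtain ⟨m, hm, hu⟩ := (mem_vars_iff_mem_support u).1 hu
  rw [mem_support_iff, coeff_truncate] at hm
  split_ifs at hm with h
  · exact h u hu
  · exact absurd rfl hm

lemma degreeOf_pos_iff {f : DPoly k n} {u : Der n} : 0 < f.degreeOf u ↔ u ∈ f.vars := by
  rw [degreeOf_def, Multiset.count_pos, vars_def, Multiset.mem_toFinset]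

lemma degreeOf_eq_zero_iff' {f : DPoly k n} {u : Der n} : f.degreeOf u = 0 ↔ u ∉ f.vars := by
  rw [← degreeOf_pos_iff]; omega

lemma pderiv_ne_zero [CharZero k] {f : DPoly k n} {u : Der n} (h : u ∈ f.vars) :
    pderiv u f ≠ 0 := by
  intro h0
  obtain ⟨m, hm, hu⟩ := (mem_vars_iff_mem_support u).1 h
  have h1 := coeff_pderiv (i := u) f (m - Finsupp.single u 1)
  have hmu : m u ≠ 0 := Finsupp.mem_support_iff.1 hu
  have h2 : m - Finsupp.single u 1 + Finsupp.single u 1 = m := by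
    ext w
    by_cases hw : w = u
    · subst hw; simp; omega
    · simp [Ne.symm hw]
  rw [h0, h2, coeff_zero] at h1
  have h3 := mul_ne_zero (mem_support_iff.1 hm)
    (Nat.cast_add_one_ne_zero (R := k) ((m - Finsupp.single u 1 : Der n →₀ ℕ) u))
  exact h3 (by simpa using h1.symm)

end polynomials

/-! ### The derivation of the differential polynomial ring -/

section derivation

variable {n : ℕ}

@[simp] lemma Der.shift_var (u : Der n) (j : ℕ) : (u.shift j).var = u.var := rfl

@[simp] lemma Der.shift_ord (u : Der n) (j : ℕ) : (u.shift j).ord = u.ord + j := rfl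

lemma Der.shift_shift (u : Der n) (i j : ℕ) : (u.shift i).shift j = u.shift (i + j) := by
  ext <;> simp [add_assoc]

variable {k : Type*} [Field k] [Differential k]

/-- The derivation of the coefficients of a differential polynomial. -/
def coeffDeriv (f : DPoly k n) : DPoly k n :=
  ∑ m ∈ f.support, monomial m (Differential.deriv (f.coeff m))

lemma coeff_coeffDeriv (f : DPoly k n) (m : Der n →₀ ℕ) :
    (coeffDeriv f).coeff m = Differential.deriv (f.coeff m) := by
  simp only [coeffDeriv, coeff_sum, coeff_monomial, Finset.sum_ite_eq', mem_support_iff]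
  split_ifs with h
  · rfl
  · rw [not_not.1 h, map_zero]

lemma coeffDeriv_add (f g : DPoly k n) : coeffDeriv (f + g) = coeffDeriv f + coeffDeriv g := by
  ext m; simp [coeff_coeffDeriv]

lemma coeffDeriv_mul (f g : DPoly k n) :
    coeffDeriv (f * g) = f * coeffDeriv g + g * coeffDeriv f := by
  ext m
  rw [mul_comm g, coeff_add]
  simp only [coeff_coeffDeriv, coeff_mul, map_sum, Derivation.leibniz, Finset.sum_add_distrib,
    smul_eq_mul]
  congr 1
  exact Finset.sum_congr rfl fun _ _ => mul_comm _ _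

lemma delta_eq (f : DPoly k n) : delta f = coeffDeriv f +
    mkDerivation k (fun u : Der n => (X (u.shift 1) : DPoly k n)) f := rfl

lemma delta_add (f g : DPoly k n) : delta (f + g) = delta f + delta g := by
  simp only [delta_eq, coeffDeriv_add, map_add]; ring

lemma delta_mul (f g : DPoly k n) : delta (f * g) = f * delta g + g * delta f := by
  simp only [delta_eq, coeffDeriv_mul, Derivation.leibniz, smul_eq_mul]; ring

@[simp] lemma delta_C (c : k) : delta (C c : DPoly k n) = C (Differential.deriv c) := by
  have : coeffDeriv (C c : DPoly k n) = C (Differential.deriv c) := by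
    ext m
    rw [coeff_coeffDeriv, coeff_C, coeff_C]
    split_ifs <;> simp
  rw [delta_eq, this, ← algebraMap_eq, Derivation.map_algebraMap, add_zero]

@[simp] lemma delta_X (u : Der n) : delta (X u : DPoly k n) = X (u.shift 1) := by
  have : coeffDeriv (X u : DPoly k n) = 0 := by
    ext m
    rw [coeff_coeffDeriv, coeff_X]
    split_ifs <;> simp
  rw [delta_eq, this, mkDerivation_X, zero_add]

/-- `delta` as an additive map. -/
def deltaHom : DPoly k n →+ DPoly k n := AddMonoidHom.mk' delta delta_add

@[simp] lemma delta_zero : delta (0 : DPoly k n) = 0 := (deltaHom (k := k) (n := n)).map_zero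
lemma delta_sub (f g : DPoly k n) : delta (f - g) = delta f - delta g :=
  (deltaHom (k := k) (n := n)).map_sub f g

/-- The derivative of `f` is linear in the derivative of a variable `u` of `f`. -/
lemma delta_sub_mem {T : Subalgebra k (DPoly k n)} {S : Set (Der n)} (u : Der n)
    (hX : ∀ w ∈ S, (X w : DPoly k n) ∈ T)
    (hX' : ∀ w ∈ S, w ≠ u → (X (w.shift 1) : DPoly k n) ∈ T)
    {f : DPoly k n} (hf : f ∈ supported k S) :
    delta f - pderiv u f * X (u.shift 1) ∈ T := by
  refine supported_induction
    (p := fun f => delta f - pderiv u f * X (u.shift 1) ∈ T) ?_ ?_ ?_ ?_ hf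
  · intro c; simpa using C_mem_subalgebra T _
  · intro w hw
    by_cases h : w = u
    · subst h; simp
    · simpa [pderiv_X_of_ne h] using hX' w hw h
  · intro f _ g _ hf hg
    have := add_mem hf hg
    rwa [show delta f - pderiv u f * X (u.shift 1) + (delta g - pderiv u g * X (u.shift 1)) =
      delta (f + g) - pderiv u (f + g) * X (u.shift 1) by rw [delta_add, map_add]; ring] at this
  · intro f hf g hg hf' hg'
    have hST := supported_le_subalgebra hX
    have := add_mem (mul_mem (hST hf) hg') (mul_mem (hST hg) hf')
    rwa [show f * (delta g - pderiv u g * X (u.shift 1)) +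
      g * (delta f - pderiv u f * X (u.shift 1)) =
      delta (f * g) - pderiv u (f * g) * X (u.shift 1) by rw [delta_mul, pderiv_mul]; ring] at this

lemma delta_mem {T : Subalgebra k (DPoly k n)} {S : Set (Der n)}
    (hX : ∀ w ∈ S, (X w : DPoly k n) ∈ T)
    (hX' : ∀ w ∈ S, (X (w.shift 1) : DPoly k n) ∈ T)
    {f : DPoly k n} (hf : f ∈ supported k S) : delta f ∈ T := by
  have hST := supported_le_subalgebra hX
  refine supported_induction (p := fun f => delta f ∈ T) ?_ ?_ ?_ ?_ hf
  · intro c; simpa using C_mem_subalgebra T _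
  · intro w hw; simpa using hX' w hw
  · intro f _ g _ hf hg; rw [delta_add]; exact add_mem hf hg
  · intro f hf g hg hf' hg'
    rw [delta_mul]; exact add_mem (mul_mem (hST hf) hg') (mul_mem (hST hg) hf')

end derivation

/-! ### Rankings are well-orders -/

section ranking

variable {n : ℕ}

lemma Der.shift_injective (j : ℕ) : Function.Injective fun u : Der n => u.shift j := by
  intro u v h
  have h1 := congrArg Der.var h
  have h2 := congrArg Der.ord h
  exact Der.ext h1 (by simpa using h2)

variable [LinearOrder (Der n)]

lemma IsRanking.lt_shift (hR : IsRanking n) (u : Der n) {j : ℕ} (hj : 0 < j) : u < u.shift j := by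
  refine lt_of_le_of_ne (hR.le_shift u j) fun h => ?_
  have := congrArg Der.ord h
  simp at this; omega

lemma IsRanking.shift_lt_shift (hR : IsRanking n) {u v : Der n} (h : u < v) (j : ℕ) :
    u.shift j < v.shift j :=
  lt_of_le_of_ne (hR.shift_le_shift u v j h.le) fun he => h.ne (Der.shift_injective j he)

lemma IsRanking.le_of_ord_le (hR : IsRanking n) {u v : Der n} (h : u.var = v.var)
    (h' : u.ord ≤ v.ord) : u ≤ v := by
  have : v = u.shift (v.ord - u.ord) := by ext <;> simp [h]; omega
  rw [this]; exact hR.le_shift _ _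

/-- For a fixed indeterminate the ranking is the order by `ord`; a nonempty set therefore has a
least element for each indeterminate it involves, and the least of these finitely many is minimal.
-/
lemma IsRanking.wellFoundedLT (hR : IsRanking n) : WellFoundedLT (Der n) := by
  refine ⟨WellFounded.wellFounded_iff_has_min.2 fun S hS => ?_⟩
  have hmin : ∀ y : Fin n, (∃ w ∈ S, w.var = y) →
      ∃ w ∈ S, w.var = y ∧ ∀ v ∈ S, v.var = y → w ≤ v := by
    rintro y ⟨w, hw, hy⟩
    have hne : {w | w ∈ S ∧ w.var = y}.Nonempty := ⟨w, hw, hy⟩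
    let w₀ := Function.argminOn Der.ord {w | w ∈ S ∧ w.var = y} hne
    have h0 : w₀ ∈ {w | w ∈ S ∧ w.var = y} := Function.argminOn_mem _ _ hne
    refine ⟨w₀, h0.1, h0.2, fun v hv hvy => hR.le_of_ord_le (h0.2.trans hvy.symm) ?_⟩
    exact Function.argminOn_le Der.ord {w | w ∈ S ∧ w.var = y} ⟨hv, hvy⟩
  obtain ⟨w, hw⟩ := hS
  have : Nonempty (Der n) := ⟨w⟩
  choose! g hg using hmin
  let Y : Finset (Fin n) := Finset.univ.filter fun y => ∃ w ∈ S, w.var = y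
  have hY : Y.Nonempty := 
    ⟨w.var, Finset.mem_filter.2 ⟨Finset.mem_univ _, w, hw, rfl⟩⟩
  obtain ⟨y, hy, hle⟩ := Finset.exists_min_image Y g hY
  have hyS : ∃ w ∈ S, w.var = y := by simpa [Y] using hy
  refine ⟨g y, (hg y hyS).1, fun v hv => not_lt.2 ?_⟩
  have hvS : ∃ w ∈ S, w.var = v.var := ⟨v, hv, rfl⟩
  exact (hle v.var (by simpa [Y] using hvS)).trans ((hg _ hvS).2.2 v hv rfl)

end ranking

/-! ### Leaders and ranks -/

section leaders

variable {k : Type*} [Field k] {n : ℕ} [LinearOrder (Der n)]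

lemma ld_eq_coe_iff {f : DPoly k n} {u : Der n} :
    ld f = u ↔ u ∈ f.vars ∧ ∀ w ∈ f.vars, w ≤ u := by
  constructor
  · intro h
    exact ⟨Finset.mem_of_max h, fun w hw => Finset.le_max_of_eq hw h⟩
  · rintro ⟨h, h'⟩
    refine le_antisymm (Finset.max_le fun w hw => WithBot.coe_le_coe.2 (h' w hw)) (Finset.le_max h)

lemma ld_eq_bot_iff {f : DPoly k n} : ld f = ⊥ ↔ IsConst f := by
  rw [isConst_iff_vars, ld, Finset.max_eq_bot]

lemma exists_ld {f : DPoly k n} (h : ¬ IsConst f) : ∃ u : Der n, ld f = u := by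
  rw [← ld_eq_bot_iff] at h
  exact ⟨_, (WithBot.coe_unbot _ h).symm⟩

lemma not_isConst_of_ld {f : DPoly k n} {u : Der n} (h : ld f = u) : ¬ IsConst f := by
  rw [← ld_eq_bot_iff, h]; exact WithBot.coe_ne_bot

lemma max'_eq_of_ld {f : DPoly k n} {u : Der n} (h : ld f = u) (hne : f.vars.Nonempty) :
    f.vars.max' hne = u := by
  rw [← WithBot.coe_inj, Finset.coe_max']; exact h

lemma vars_nonempty_of_ld {f : DPoly k n} {u : Der n} (h : ld f = u) : f.vars.Nonempty :=
  ⟨u, (ld_eq_coe_iff.1 h).1⟩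

lemma initial_eq {f : DPoly k n} {u : Der n} (h : ld f = u) :
    initial f = coeffOf u (f.degreeOf u) f := by
  rw [initial, dif_pos (vars_nonempty_of_ld h), max'_eq_of_ld h]

lemma separant_eq {f : DPoly k n} {u : Der n} (h : ld f = u) : separant f = pderiv u f := by
  rw [separant, dif_pos (vars_nonempty_of_ld h), max'_eq_of_ld h]

lemma rk_eq {f : DPoly k n} {u : Der n} (h : ld f = u) :
    rk f = ((toLex (u, f.degreeOf u) : Der n ×ₗ ℕ) : WithBot (Der n ×ₗ ℕ)) := by
  rw [rk, h]; rfl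

lemma lv_eq {f : DPoly k n} {u : Der n} (h : ld f = u) : lv f = u.var := by
  rw [lv, h]; rfl

lemma rk_eq_bot_iff {f : DPoly k n} : rk f = ⊥ ↔ IsConst f := by
  rw [rk, WithBot.map_eq_bot_iff, ld_eq_bot_iff]

lemma ld_eq_of_rk_eq {f g : DPoly k n} {u : Der n} (h : ld f = u) (hr : rk g = rk f) :
    ld g = u ∧ g.degreeOf u = f.degreeOf u := by
  have hg : ¬ IsConst g := by
    rw [← rk_eq_bot_iff, hr, rk_eq_bot_iff]; exact not_isConst_of_ld h
  obtain ⟨w, hw⟩ := exists_ld hg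
  rw [rk_eq h, rk_eq hw, WithBot.coe_inj, EmbeddingLike.apply_eq_iff_eq, Prod.mk.injEq] at hr
  obtain ⟨rfl, hr⟩ := hr
  exact ⟨hw, hr⟩

lemma mem_supported_Iic {f : DPoly k n} {u : Der n} (h : ld f = u) :
    f ∈ supported k (Set.Iic u) :=
  mem_supported.2 fun w hw => (ld_eq_coe_iff.1 h).2 w hw

lemma mem_supported_Iic_of_rk_le {f g : DPoly k n} {u : Der n} (h : ld f = u) (hr : rk g ≤ rk f) :
    g ∈ supported k (Set.Iic u) ∧ g.degreeOf u ≤ f.degreeOf u := by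
  by_cases hg : IsConst g
  · obtain ⟨c, rfl⟩ := hg
    exact ⟨Subalgebra.algebraMap_mem _ c, by simp⟩
  obtain ⟨w, hw⟩ := exists_ld hg
  rw [rk_eq h, rk_eq hw, WithBot.coe_le_coe, Prod.Lex.toLex_le_toLex] at hr
  rcases hr with hr | ⟨rfl, hr⟩
  · refine ⟨supported_mono (Set.Iic_subset_Iic.2 hr.le) (mem_supported_Iic hw), ?_⟩
    rw [degreeOf_eq_zero_iff'.2]
    · exact Nat.zero_le _
    · intro hu; exact absurd ((ld_eq_coe_iff.1 hw).2 u hu) (not_le.2 hr)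
  · exact ⟨mem_supported_Iic hw, hr⟩

lemma rk_le_of {f g : DPoly k n} {u : Der n} (h : ld f = u)
    (hg : g ∈ supported k (Set.Iic u)) (hd : g.degreeOf u ≤ f.degreeOf u) : rk g ≤ rk f := by
  by_cases hc : IsConst g
  · rw [rk_eq_bot_iff.2 hc]; exact bot_le
  obtain ⟨w, hw⟩ := exists_ld hc
  rw [rk_eq h, rk_eq hw, WithBot.coe_le_coe, Prod.Lex.toLex_le_toLex]
  rcases (show w ≤ u from mem_supported.1 hg (ld_eq_coe_iff.1 hw).1).lt_or_eq with h1 | rfl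
  · exact Or.inl h1
  · exact Or.inr ⟨rfl, hd⟩

lemma rk_lt_of {f g : DPoly k n} {u : Der n} (h : ld f = u)
    (hg : g ∈ supported k (Set.Iic u)) (hd : g.degreeOf u < f.degreeOf u) : rk g < rk f := by
  refine lt_of_le_of_ne (rk_le_of h hg hd.le) fun he => hd.ne (ld_eq_of_rk_eq h he).2

lemma rk_truncate_le (b : Fin n → ℕ) (f : DPoly k n) : rk (truncate b f) ≤ rk f := by
  have hs := support_truncate_subset b f
  by_cases hc : IsConst f
  · have : IsConst (truncate b f) := by
      rw [isConst_iff_vars] at hc ⊢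
      exact Finset.subset_empty.1 (hc ▸ vars_subset_of_support_subset hs)
    rw [rk_eq_bot_iff.2 this]; exact bot_le
  obtain ⟨u, hu⟩ := exists_ld hc
  refine rk_le_of hu (mem_supported.2 fun w hw => ?_) (degreeOf_le_of_support_subset hs u)
  exact (ld_eq_coe_iff.1 hu).2 w (vars_subset_of_support_subset hs hw)

end leaders

/-! ### Polynomials in one distinguished derivative -/

section theta

variable {k : Type*} [Field k] {n : ℕ}

/-- A differential polynomial regarded as a polynomial in `u`. -/
def theta (u : Der n) : DPoly k n →ₐ[k] Polynomial (DPoly k n) :=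
  aeval fun w : Der n => if w = u then Polynomial.X else Polynomial.C (X w)

lemma theta_monomial (u : Der n) (m : Der n →₀ ℕ) (a : k) :
    theta u (monomial m a) = Polynomial.C (monomial (m.erase u) a) * Polynomial.X ^ m u := by
  rw [theta, aeval_monomial]
  have h1 : (m.prod fun i j => (if i = u then Polynomial.X else Polynomial.C (X i)) ^ j :
      Polynomial (DPoly k n)) =
      Polynomial.C ((m.erase u).prod fun i j => X i ^ j) * Polynomial.X ^ m u := by
    conv_lhs => rw [← Finsupp.erase_add_single u m]
    rw [Finsupp.prod_add_index', Finsupp.prod_single_index]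
    · rw [if_pos rfl]
      congr 1
      rw [Finsupp.prod, Finsupp.prod, map_prod]
      refine Finset.prod_congr rfl fun w hw => ?_
      rw [if_neg (by rintro rfl; simp at hw), map_pow]
    · simp
    · simp
    · intros; rw [pow_add]
  rw [h1, monomial_eq, map_mul, ← mul_assoc]
  rfl

lemma coeff_theta (u : Der n) (t : ℕ) (f : DPoly k n) :
    (theta u f).coeff t = coeffOf u t f := by
  conv_lhs => rw [f.as_sum, map_sum, Polynomial.finsetSum_coeff]
  rw [coeffOf, Finset.sum_filter]
  refine Finset.sum_congr rfl fun m _ => ?_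
  rw [theta_monomial, Polynomial.coeff_C_mul, Polynomial.coeff_X_pow]
  by_cases h : m u = t
  · simp [h]
  · rw [if_neg (Ne.symm h), if_neg h, mul_zero]

lemma theta_of_mem {u : Der n} {f : DPoly k n} (hf : f ∈ supported k ({u}ᶜ : Set (Der n))) :
    theta u f = Polynomial.C f := by
  refine supported_induction (p := fun f => theta u f = Polynomial.C f) ?_ ?_ ?_ ?_ hf
  · intro c; rw [theta, aeval_C]; rfl
  · intro w hw; simp only [theta, aeval_X]; rw [if_neg (by simpa using hw)]
  · intro f _ g _ h1 h2; rw [map_add, h1, h2, map_add]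
  · intro f _ g _ h1 h2; rw [map_mul, h1, h2, map_mul]

@[simp] lemma theta_X_self (u : Der n) : theta u (X u : DPoly k n) = Polynomial.X := by
  simp [theta]

lemma eval_theta (u : Der n) (f : DPoly k n) : (theta u f).eval (X u) = f := by
  refine supported_induction (S := Set.univ) (p := fun f => (theta u f).eval (X u) = f)
    ?_ ?_ ?_ ?_ (by simp)
  · intro c; rw [theta, aeval_C]; exact Polynomial.eval_C
  · intro w _
    simp only [theta, aeval_X]
    split_ifs with h
    · simp [h]
    · simp
  · intro f _ g _ h1 h2; rw [map_add, Polynomial.eval_add, h1, h2]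
  · intro f _ g _ h1 h2; rw [map_mul, Polynomial.eval_mul, h1, h2]

lemma coeff_coeffOf (u : Der n) (t : ℕ) (f : DPoly k n) (m : Der n →₀ ℕ) :
    (coeffOf u t f).coeff m = if m u = 0 then f.coeff (m + Finsupp.single u t) else 0 := by
  simp only [coeffOf, coeff_sum, coeff_monomial]
  split_ifs with h
  · rw [Finset.sum_eq_single (m + Finsupp.single u t)]
    · rw [if_pos]
      ext w
      by_cases hw : w = u
      · subst hw; simp [h]
      · simp [Finsupp.erase_ne hw]
    · intro m' hm' hne
      rw [if_neg]
      rintro rfl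
      apply hne
      rw [← (Finset.mem_filter.1 hm').2, Finsupp.erase_add_single]
    · intro hm
      rw [Finset.mem_filter, not_and] at hm
      have : f.coeff (m + Finsupp.single u t) = 0 := by
        by_contra h0
        exact hm (mem_support_iff.2 h0) (by simp [h])
      split_ifs <;> simp [this]
  · refine Finset.sum_eq_zero fun m' _ => ?_
    rw [if_neg]
    rintro rfl
    simp at h

lemma coeffOf_mem_vars {u w : Der n} {t : ℕ} {f : DPoly k n} (h : w ∈ (coeffOf u t f).vars) :
    w ∈ f.vars ∧ w ≠ u := by
  obtain ⟨m, hm, hw⟩ := (mem_vars_iff_mem_support _).1 h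
  rw [mem_support_iff, coeff_coeffOf] at hm
  split_ifs at hm with h0
  · refine ⟨(mem_vars_iff_mem_support _).2 ⟨_, mem_support_iff.2 hm, ?_⟩, ?_⟩
    · rw [Finsupp.mem_support_iff] at hw ⊢
      simp only [Finsupp.coe_add, Pi.add_apply]; omega
    · rintro rfl; exact (Finsupp.mem_support_iff.1 hw) h0
  · exact absurd rfl hm

lemma coeffOf_mem_supported (u : Der n) (t : ℕ) (f : DPoly k n) :
    coeffOf u t f ∈ supported k ({u}ᶜ : Set (Der n)) :=
  mem_supported.2 fun _ hw => (coeffOf_mem_vars hw).2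

lemma degreeOf_coeffOf_le (u w : Der n) (t : ℕ) (f : DPoly k n) :
    (coeffOf u t f).degreeOf w ≤ f.degreeOf w := by
  rw [degreeOf_eq_sup]
  refine Finset.sup_le fun m hm => ?_
  rw [mem_support_iff, coeff_coeffOf] at hm
  split_ifs at hm with h0
  · refine le_trans ?_ (monomial_le_degreeOf w (mem_support_iff.2 hm))
    simp
  · exact absurd rfl hm

lemma coeffOf_eq_zero_of_lt {u : Der n} {t : ℕ} {f : DPoly k n} (h : f.degreeOf u < t) :
    coeffOf u t f = 0 := by
  ext m
  rw [coeff_coeffOf, coeff_zero]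
  split_ifs with h0
  · by_contra hne
    have := monomial_le_degreeOf u (mem_support_iff.2 hne)
    simp at this; omega
  · rfl

lemma coeffOf_degreeOf_ne_zero {u : Der n} {f : DPoly k n} (h : f ≠ 0) :
    coeffOf u (f.degreeOf u) f ≠ 0 := by
  obtain ⟨m, hm, hmu⟩ := Finset.exists_mem_eq_sup f.support (support_nonempty.2 h) (fun m => m u)
  rw [← degreeOf_eq_sup] at hmu
  intro h0
  have h1 := coeff_coeffOf u (f.degreeOf u) f (m.erase u)
  rw [h0, if_pos (by simp), hmu, Finsupp.erase_add_single, coeff_zero] at h1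
  exact mem_support_iff.1 hm h1.symm

lemma natDegree_theta (u : Der n) (f : DPoly k n) : (theta u f).natDegree = f.degreeOf u := by
  by_cases h : f = 0
  · simp [h]
  refine le_antisymm (Polynomial.natDegree_le_iff_coeff_eq_zero.2 fun t ht => ?_)
    (Polynomial.le_natDegree_of_ne_zero ?_)
  · rw [coeff_theta, coeffOf_eq_zero_of_lt ht]
  · rw [coeff_theta]; exact coeffOf_degreeOf_ne_zero h

lemma derivative_theta (u : Der n) (f : DPoly k n) :
    Polynomial.derivative (theta u f) = theta u (pderiv u f) := by
  refine supported_induction (S := Set.univ)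
    (p := fun f => Polynomial.derivative (theta u f) = theta u (pderiv u f)) ?_ ?_ ?_ ?_ (by simp)
  · intro c; rw [theta, aeval_C]; simp [Polynomial.algebraMap_apply]
  · intro w _
    by_cases h : w = u
    · subst h; simp
    · rw [theta_of_mem (X_mem_supported.2 (by simpa using h)), pderiv_X_of_ne h]; simp
  · intro f _ g _ h1 h2; simp only [map_add, h1, h2]
  · intro f _ g _ h1 h2; simp only [map_mul, pderiv_mul, Polynomial.derivative_mul, h1, h2, map_add]

lemma degreeOf_pderiv_lt {u : Der n} {f : DPoly k n} (h : u ∈ f.vars) :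
    (pderiv u f).degreeOf u < f.degreeOf u := by
  rw [degreeOf_lt_iff (degreeOf_pos_iff.2 h)]
  intro m hm
  rw [mem_support_iff, coeff_pderiv] at hm
  have := monomial_le_degreeOf u (mem_support_iff.2 (left_ne_zero_of_mul hm))
  simp at this; omega

lemma degreeOf_pderiv_le (u w : Der n) (f : DPoly k n) :
    (pderiv u f).degreeOf w ≤ f.degreeOf w := by
  rw [degreeOf_eq_sup]
  refine Finset.sup_le fun m hm => ?_
  rw [mem_support_iff, coeff_pderiv] at hm
  refine le_trans ?_ (monomial_le_degreeOf w (mem_support_iff.2 (left_ne_zero_of_mul hm)))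
  simp

/-- Splitting off the terms of highest degree in `u`. -/
lemma exists_eq_coeffOf_mul_add {u : Der n} {f : DPoly k n} (h : u ∈ f.vars) :
    ∃ r : DPoly k n, f = coeffOf u (f.degreeOf u) f * X u ^ f.degreeOf u + r ∧
      r.degreeOf u < f.degreeOf u ∧ r.support ⊆ f.support := by
  have hmul : ∀ m, (coeffOf u (f.degreeOf u) f * X u ^ f.degreeOf u).coeff m =
      if m u = f.degreeOf u then f.coeff m else 0 := by
    intro m
    rw [X_pow_eq_monomial, coeff_mul_monomial', mul_one]
    by_cases hle : Finsupp.single u (f.degreeOf u) ≤ m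
    · rw [if_pos hle, coeff_coeffOf, tsub_add_cancel_of_le hle]
      have := hle u
      simp at this
      refine if_congr ?_ rfl rfl
      simp; omega
    · rw [if_neg hle, if_neg]
      intro h'
      exact hle (Finsupp.single_le_iff.2 h'.ge)
  have hr : ∀ m, (f - coeffOf u (f.degreeOf u) f * X u ^ f.degreeOf u).coeff m =
      if m u = f.degreeOf u then 0 else f.coeff m := by
    intro m
    rw [coeff_sub, hmul]; split_ifs <;> simp
  refine ⟨f - coeffOf u (f.degreeOf u) f * X u ^ f.degreeOf u, by ring, ?_, ?_⟩
  · rw [degreeOf_lt_iff (degreeOf_pos_iff.2 h)]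
    intro m hm
    rw [mem_support_iff, hr] at hm
    split_ifs at hm with h1
    · exact absurd rfl hm
    · exact lt_of_le_of_ne (monomial_le_degreeOf u (mem_support_iff.2 hm)) h1
  · intro m hm
    rw [mem_support_iff, hr] at hm
    split_ifs at hm with h1
    · exact absurd rfl hm
    · exact mem_support_iff.2 hm

end theta

/-! ### Non-zero-divisors modulo an ideal -/

section nonzerodivisors

variable {R : Type*} [CommRing R]

/-- `s` is not a zero divisor modulo `I`. -/
def IsNzd (I : Ideal R) (s : R) : Prop := ∀ x, s * x ∈ I → x ∈ I

lemma IsNzd.one (I : Ideal R) : IsNzd I 1 := fun x hx => by simpa using hx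

lemma IsNzd.mul {I : Ideal R} {s t : R} (hs : IsNzd I s) (ht : IsNzd I t) : IsNzd I (s * t) :=
  fun x hx => ht x (hs _ (by rwa [← mul_assoc]))

lemma IsNzd.of_isUnit {I : Ideal R} {s : R} (hs : IsUnit s) : IsNzd I s :=
  fun _ hx => (Ideal.unit_mul_mem_iff_mem I hs).1 hx

lemma IsNzd.of_mem_closure {I : Ideal R} {S : Set R} (h : ∀ s ∈ S, IsNzd I s) {t : R}
    (ht : t ∈ Submonoid.closure S) : IsNzd I t := by
  induction ht using Submonoid.closure_induction with
  | mem x hx => exact h x hx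
  | one => exact IsNzd.one I
  | mul x y _ _ hx hy => exact hx.mul hy

/-- Modulo I, t x is h (s x). This and `IsNzd.of_left` carry initials and separants back and forth
between a polynomial and its remainder. -/
lemma IsNzd.of_right {I : Ideal R} {h s t : R} (hc : h * s - t ∈ I) (ht : IsNzd I t) :
    IsNzd I s := fun x hx => ht x <| by
  have h1 := I.sub_mem (I.mul_mem_left h hx) (I.mul_mem_right x hc)
  rwa [show h * (s * x) - (h * s - t) * x = t * x by ring] at h1

lemma IsNzd.of_left {I : Ideal R} {h s t : R} (hc : h * s - t ∈ I) (hh : IsNzd I h)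
    (hs : IsNzd I s) : IsNzd I t := fun x hx => hs x <| hh _ <| by
  have h1 := I.add_mem hx (I.mul_mem_right x hc)
  rwa [show t * x + (h * s - t) * x = h * (s * x) by ring] at h1

lemma mem_of_congr {I : Ideal R} {a b : R} (h : a - b ∈ I) (hb : b ∈ I) : a ∈ I := by
  have := I.add_mem h hb
  rwa [sub_add_cancel] at this

lemma mem_of_congr' {I : Ideal R} {a b : R} (h : a - b ∈ I) (ha : a ∈ I) : b ∈ I := by
  have := I.sub_mem ha h
  rwa [sub_sub_cancel] at this

end nonzerodivisors

/-! ### Saturations -/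

section saturation

variable {k : Type*} [Field k] {n : ℕ}

lemma le_sat (I : Ideal (DPoly k n)) (S : Set (DPoly k n)) : I ≤ sat I S :=
  fun a ha => ⟨1, one_mem _, by simpa using ha⟩

lemma sat_mono {I J : Ideal (DPoly k n)} {S T : Set (DPoly k n)} (h : I ≤ J) (hS : S ⊆ T) :
    sat I S ≤ sat J T := fun _ ⟨s, hs, ha⟩ => ⟨s, Submonoid.closure_mono hS hs, h ha⟩

lemma sat_le {I J : Ideal (DPoly k n)} {S : Set (DPoly k n)} (h : I ≤ J)
    (hS : ∀ s ∈ S, IsNzd J s) : sat I S ≤ J := fun a ⟨_, hs, ha⟩ =>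
  IsNzd.of_mem_closure hS hs a (h ha)

lemma isNzd_sat_of_mem_closure {I : Ideal (DPoly k n)} {S : Set (DPoly k n)} {s : DPoly k n}
    (hs : s ∈ Submonoid.closure S) : IsNzd (sat I S) s := fun x ⟨t, ht, hx⟩ =>
  ⟨t * s, mul_mem ht hs, by rwa [mul_assoc]⟩

lemma isNzd_sat {I : Ideal (DPoly k n)} {S : Set (DPoly k n)} {s : DPoly k n}
    (hs : s ∈ S) : IsNzd (sat I S) s := isNzd_sat_of_mem_closure (Submonoid.subset_closure hs)

lemma sat_isRadical {I : Ideal (DPoly k n)} (hI : I.IsRadical) (S : Set (DPoly k n)) :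
    (sat I S).IsRadical := by
  rintro a ⟨m, s, hs, ha⟩
  refine ⟨s, hs, hI ⟨m + 1, ?_⟩⟩
  have h1 := I.mul_mem_left (s ^ m * a) ha
  rwa [show s ^ m * a * (s * a ^ m) = (s * a) ^ (m + 1) by ring] at h1

lemma sat_sat {I : Ideal (DPoly k n)} {S T : Set (DPoly k n)} (h : S ⊆ T) :
    sat (sat I S) T = sat I T := by
  refine le_antisymm (fun a ⟨t, ht, s, hs, ha⟩ => ?_) (sat_mono (le_sat I S) le_rfl)
  exact ⟨s * t, mul_mem (Submonoid.closure_mono h hs) ht, by rwa [mul_assoc]⟩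

end saturation

/-! ### Differential and radical differential ideals -/

section ideals

variable {k : Type*} [Field k] [Differential k] {n : ℕ}

lemma subset_diffIdeal (F : Set (DPoly k n)) : F ⊆ diffIdeal F := fun _ hf =>
  Ideal.mem_sInf.2 fun _ hI => hI.2 hf

lemma diffIdeal_isDiff (F : Set (DPoly k n)) : IsDiffIdeal (diffIdeal F) := fun _ hf =>
  Ideal.mem_sInf.2 fun _ hI => hI.1 _ (Ideal.mem_sInf.1 hf hI)

lemma diffIdeal_le {F : Set (DPoly k n)} {I : Ideal (DPoly k n)} (hI : IsDiffIdeal I)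
    (h : F ⊆ I) : diffIdeal F ≤ I := sInf_le ⟨hI, h⟩

lemma subset_radDiffIdeal (F : Set (DPoly k n)) : F ⊆ radDiffIdeal F := fun _ hf =>
  Ideal.mem_sInf.2 fun _ hI => hI.2.2 hf

lemma radDiffIdeal_isDiff (F : Set (DPoly k n)) : IsDiffIdeal (radDiffIdeal F) := fun _ hf =>
  Ideal.mem_sInf.2 fun _ hI => hI.1 _ (Ideal.mem_sInf.1 hf hI)

lemma radDiffIdeal_isRadical (F : Set (DPoly k n)) : (radDiffIdeal F).IsRadical := by
  rintro x ⟨m, hm⟩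
  exact Ideal.mem_sInf.2 fun _ hI => hI.2.1 ⟨m, Ideal.mem_sInf.1 hm hI⟩

lemma radDiffIdeal_le {F : Set (DPoly k n)} {I : Ideal (DPoly k n)} (hI : IsDiffIdeal I)
    (hr : I.IsRadical) (h : F ⊆ I) : radDiffIdeal F ≤ I := sInf_le ⟨hI, hr, h⟩

lemma radDiffIdeal_mono {F G : Set (DPoly k n)} (h : F ⊆ G) : radDiffIdeal F ≤ radDiffIdeal G :=
  radDiffIdeal_le (radDiffIdeal_isDiff G) (radDiffIdeal_isRadical G)
    (h.trans (subset_radDiffIdeal G))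

lemma diffIdeal_mono {F G : Set (DPoly k n)} (h : F ⊆ G) : diffIdeal F ≤ diffIdeal G :=
  diffIdeal_le (diffIdeal_isDiff G) (h.trans (subset_diffIdeal G))

/-- From s a ∈ I one gets s² δa = s δ(s a) - δs (s a) ∈ I, so s² is the witness for δa. -/
lemma sat_isDiff {I : Ideal (DPoly k n)} (hI : IsDiffIdeal I) (S : Set (DPoly k n)) :
    IsDiffIdeal (sat I S) := by
  rintro a ⟨s, hs, ha⟩
  refine ⟨s * s, mul_mem hs hs, ?_⟩
  have h1 := I.sub_mem (I.mul_mem_left s (hI _ ha)) (I.mul_mem_left (delta s) ha)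
  rw [delta_mul] at h1
  rwa [show s * (s * delta a + a * delta s) - delta s * (s * a) = s * s * delta a by ring] at h1

lemma iterate_delta_mem {I : Ideal (DPoly k n)} (hI : IsDiffIdeal I) {f : DPoly k n} (hf : f ∈ I)
    (j : ℕ) : delta^[j] f ∈ I := by
  induction j with
  | zero => exact hf
  | succ j ih => rw [Function.iterate_succ_apply']; exact hI _ ih

lemma diffIdeal_eq_span (F : Set (DPoly k n)) :
    diffIdeal F = Ideal.span {x | ∃ f ∈ F, ∃ j, x = delta^[j] f} := by
  refine le_antisymm (diffIdeal_le (fun x hx => ?_) ?_) (Ideal.span_le.2 ?_)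
  · refine Submodule.span_induction (p := fun x _ => delta x ∈
      Ideal.span {x | ∃ f ∈ F, ∃ j, x = delta^[j] f}) ?_ ?_ ?_ ?_ hx
    · rintro _ ⟨f, hf, j, rfl⟩
      refine Ideal.subset_span ⟨f, hf, j + 1, ?_⟩
      rw [Function.iterate_succ_apply']
    · simp
    · intro x y _ _ hx hy; rw [delta_add]; exact Ideal.add_mem _ hx hy
    · intro a x hx hx'
      rw [smul_eq_mul, delta_mul]
      exact Ideal.add_mem _ (Ideal.mul_mem_left _ _ hx') (Ideal.mul_mem_right _ _ hx)
  · exact fun f hf => Ideal.subset_span ⟨f, hf, 0, rfl⟩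
  · rintro _ ⟨f, hf, j, rfl⟩
    exact iterate_delta_mem (diffIdeal_isDiff F) (subset_diffIdeal F hf) j

/-- In a radical differential ideal, `a b ∈ I` implies `a δ b ∈ I`. -/
lemma mul_delta_mem {I : Ideal (DPoly k n)} (hI : IsDiffIdeal I) (hr : I.IsRadical)
    {a b : DPoly k n} (h : a * b ∈ I) : delta a * b ∈ I := by
  refine hr ⟨2, ?_⟩
  have h1 := I.sub_mem (I.mul_mem_left (delta a * b) (hI _ h))
    (I.mul_mem_left (delta a * delta b) h)
  rw [delta_mul] at h1
  rwa [show delta a * b * (a * delta b + b * delta a) - delta a * delta b * (a * b) =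
    (delta a * b) ^ 2 by ring] at h1

/-- The quotient I : y is again a radical differential ideal, by `mul_delta_mem`, so it contains {F}
once it contains F. -/
lemma mul_mem_of_mem_radDiffIdeal {I : Ideal (DPoly k n)} (hI : IsDiffIdeal I) (hr : I.IsRadical)
    {F : Set (DPoly k n)} {y : DPoly k n} (hF : ∀ f ∈ F, f * y ∈ I) {z : DPoly k n}
    (hz : z ∈ radDiffIdeal F) : z * y ∈ I := by
  let J : Ideal (DPoly k n) := Submodule.comap (LinearMap.mulRight (DPoly k n) y) I
  have hJ : radDiffIdeal F ≤ J := by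
    refine radDiffIdeal_le (fun a ha => mul_delta_mem hI hr ha) ?_ hF
    rintro a ⟨m, hm⟩
    refine hr ⟨m + 1, ?_⟩
    have hm : a ^ m * y ∈ I := hm
    have h1 := I.mul_mem_left (a * y ^ m) hm
    rwa [show a * y ^ m * (a ^ m * y) = (a * y) ^ (m + 1) by ring] at h1
  exact hJ hz

/-- Splitting a saturated radical differential ideal according to the vanishing of elements. -/
lemma sat_rad_split {F H E : Set (DPoly k n)} {y : DPoly k n}
    (hy : y ∈ sat (radDiffIdeal F) (H ∪ E))
    (hE : ∀ e ∈ E, IsUnit e ∨ y ∈ sat (radDiffIdeal (insert e F)) H) :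
    y ∈ sat (radDiffIdeal F) H := by
  set I := sat (radDiffIdeal F) H with hIdef
  have hI : IsDiffIdeal I := sat_isDiff (radDiffIdeal_isDiff F) H
  have hr : I.IsRadical := sat_isRadical (radDiffIdeal_isRadical F) H
  obtain ⟨t, ht, hty⟩ := hy
  -- The factors of t are cancelled one at a time; y is quantified inside because it is replaced by
  -- b y when the factor a of a b is cancelled.
  have key : ∀ t ∈ Submonoid.closure (H ∪ E), ∀ y,
      (∀ e ∈ E, IsUnit e ∨ y ∈ sat (radDiffIdeal (insert e F)) H) → t * y ∈ I →
      y ∈ I := by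
    intro t ht
    induction ht using Submonoid.closure_induction with
    | mem x hx =>
      intro y hy hxy
      rcases hx with hx | hx
      · exact isNzd_sat hx y hxy
      · rcases hy x hx with hu | ⟨s, hs, hsy⟩
        · exact IsNzd.of_isUnit hu y hxy
        -- Since x and F are multiplied into I by y, so is all of {x, F}, in particular s y;
        -- cancelling s leaves y² ∈ I.
        · have h1 : s * y * y ∈ I := by
            refine mul_mem_of_mem_radDiffIdeal hI hr (fun f hf => ?_) hsy
            rcases hf with rfl | hf
            · exact hxy
            · exact I.mul_mem_right _ (le_sat _ _ (subset_radDiffIdeal F hf))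
          have h2 : y * y ∈ I := isNzd_sat_of_mem_closure hs _ (by rwa [← mul_assoc])
          exact hr ⟨2, by rwa [pow_two]⟩
    | one => intro y _ h; simpa using h
    | mul a b _ _ ha hb =>
      intro y hy hab
      refine hb y hy (ha _ (fun e he => ?_) (by rwa [← mul_assoc]))
      exact (hy e he).imp_right fun h => Ideal.mul_mem_left _ _ h
  exact key t ht y hE (le_sat _ _ hty)

end ideals

/-! ### Initials and separants -/

section initials

variable {k : Type*} [Field k] {n : ℕ} [LinearOrder (Der n)]

lemma mem_initSep {A : Finset (DPoly k n)} {x : DPoly k n} :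
    x ∈ initSep A ↔ ∃ d ∈ A, x = initial d ∨ x = separant d := by
  simp only [initSep, Finset.mem_union, Finset.mem_image]
  constructor
  · rintro (⟨d, hd, rfl⟩ | ⟨d, hd, rfl⟩)
    · exact ⟨d, hd, Or.inl rfl⟩
    · exact ⟨d, hd, Or.inr rfl⟩
  · rintro ⟨d, hd, rfl | rfl⟩
    · exact Or.inl ⟨d, hd, rfl⟩
    · exact Or.inr ⟨d, hd, rfl⟩

lemma initial_mem_initSep {A : Finset (DPoly k n)} {d : DPoly k n} (h : d ∈ A) :
    initial d ∈ initSep A := mem_initSep.2 ⟨d, h, Or.inl rfl⟩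

lemma separant_mem_initSep {A : Finset (DPoly k n)} {d : DPoly k n} (h : d ∈ A) :
    separant d ∈ initSep A := mem_initSep.2 ⟨d, h, Or.inr rfl⟩

lemma initSep_mono {A B : Finset (DPoly k n)} (h : A ⊆ B) : initSep A ⊆ initSep B := fun _ hx =>
  let ⟨d, hd, hx⟩ := mem_initSep.1 hx
  mem_initSep.2 ⟨d, h hd, hx⟩

lemma initial_mem_supported {S : Set (Der n)} {f : DPoly k n} (hf : f ∈ supported k S) :
    initial f ∈ supported k S := by
  by_cases hc : IsConst f
  · rw [initial, dif_neg (by rw [isConst_iff_vars.1 hc]; simp)]; exact zero_mem _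
  obtain ⟨u, hu⟩ := exists_ld hc
  rw [initial_eq hu]
  exact mem_supported.2 fun w hw => mem_supported.1 hf (coeffOf_mem_vars hw).1

lemma separant_mem_supported {S : Set (Der n)} {f : DPoly k n} (hf : f ∈ supported k S) :
    separant f ∈ supported k S := by
  by_cases hc : IsConst f
  · rw [separant, dif_neg (by rw [isConst_iff_vars.1 hc]; simp)]; exact zero_mem _
  obtain ⟨u, hu⟩ := exists_ld hc
  rw [separant_eq hu]
  exact pderiv_mem_supported u hf

lemma initSep_mem_supported {S : Set (Der n)} {A : Finset (DPoly k n)}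
    (hA : ∀ d ∈ A, d ∈ supported k S) {x : DPoly k n} (hx : x ∈ initSep A) :
    x ∈ supported k S := by
  obtain ⟨d, hd, rfl | rfl⟩ := mem_initSep.1 hx
  · exact initial_mem_supported (hA d hd)
  · exact separant_mem_supported (hA d hd)

lemma closure_initSep_mem_supported {S : Set (Der n)} {A : Finset (DPoly k n)}
    (hA : ∀ d ∈ A, d ∈ supported k S) {x : DPoly k n}
    (hx : x ∈ Submonoid.closure (initSep A : Set (DPoly k n))) : x ∈ supported k S :=
  (Submonoid.closure_le (S := (supported k S).toSubmonoid)).2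
    (fun _ hy => initSep_mem_supported hA hy) hx

lemma initial_mem_Iio {f : DPoly k n} {u : Der n} (h : ld f = u) :
    initial f ∈ supported k (Set.Iio u) := by
  rw [initial_eq h]
  refine mem_supported.2 fun w hw => ?_
  exact lt_of_le_of_ne ((ld_eq_coe_iff.1 h).2 w (coeffOf_mem_vars hw).1) (coeffOf_mem_vars hw).2

lemma initial_ne_zero {f : DPoly k n} (h : ¬ IsConst f) : initial f ≠ 0 := by
  obtain ⟨u, hu⟩ := exists_ld h
  rw [initial_eq hu]
  refine coeffOf_degreeOf_ne_zero ?_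
  rintro rfl
  exact h ⟨0, by simp⟩

lemma separant_ne_zero [CharZero k] {f : DPoly k n} (h : ¬ IsConst f) : separant f ≠ 0 := by
  obtain ⟨u, hu⟩ := exists_ld h
  rw [separant_eq hu]
  exact pderiv_ne_zero (ld_eq_coe_iff.1 hu).1

lemma rk_initial_lt {f : DPoly k n} (h : ¬ IsConst f) : rk (initial f) < rk f := by
  obtain ⟨u, hu⟩ := exists_ld h
  refine rk_lt_of hu (supported_mono (fun w hw => le_of_lt hw) (initial_mem_Iio hu)) ?_
  rw [degreeOf_eq_zero_iff'.2]
  · exact degreeOf_pos_iff.2 (ld_eq_coe_iff.1 hu).1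
  · intro hm
    exact lt_irrefl u (mem_supported.1 (initial_mem_Iio hu) hm)

lemma rk_separant_lt {f : DPoly k n} (h : ¬ IsConst f) : rk (separant f) < rk f := by
  obtain ⟨u, hu⟩ := exists_ld h
  rw [separant_eq hu]
  exact rk_lt_of hu (pderiv_mem_supported u (mem_supported_Iic hu))
    (degreeOf_pderiv_lt (ld_eq_coe_iff.1 hu).1)

end initials

/-! ### Reducedness and autoreduced sets -/

section autoreduced

variable {k : Type*} [Field k] {n : ℕ} [LinearOrder (Der n)]

lemma PartReduced.of_vars_subset {f f' g : DPoly k n} (h : PartReduced f g)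
    (hv : f'.vars ⊆ f.vars) : PartReduced f' g := fun u hu j hj hm => h u hu j hj (hv hm)

lemma Reduced.of_le {f f' g : DPoly k n} (h : Reduced f g) (hv : f'.vars ⊆ f.vars)
    (hd : ∀ u, f'.degreeOf u ≤ f.degreeOf u) : Reduced f' g :=
  ⟨h.1.of_vars_subset hv, fun u hu => (hd u).trans_lt (h.2 u hu)⟩

lemma Reduced.truncate {f g : DPoly k n} (h : Reduced f g) (b : Fin n → ℕ) :
    Reduced (truncate b f) g :=
  h.of_le (vars_subset_of_support_subset (support_truncate_subset b f))
    fun u => degreeOf_le_of_support_subset (support_truncate_subset b f) u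

lemma Reduced.initial {f g : DPoly k n} (h : Reduced f g) (hc : ¬ IsConst f) :
    Reduced (initial f) g := by
  obtain ⟨u, hu⟩ := exists_ld hc
  rw [initial_eq hu]
  exact h.of_le (fun w hw => (coeffOf_mem_vars hw).1) fun w => degreeOf_coeffOf_le _ _ _ _

lemma Reduced.separant {f g : DPoly k n} (h : Reduced f g) (hc : ¬ IsConst f) :
    Reduced (separant f) g := by
  obtain ⟨u, hu⟩ := exists_ld hc
  rw [separant_eq hu]
  refine h.of_le (fun w hw => ?_) fun w => degreeOf_pderiv_le _ _ _
  exact mem_supported.1 (pderiv_mem_supported u (mem_supported_vars f)) hw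

lemma PartReduced.ord_le {f g : DPoly k n} {u w : Der n} (h : PartReduced f g) (hf : w ∈ f.vars)
    (hg : ld g = u) (hv : w.var = u.var) : w.ord ≤ u.ord := by
  by_contra hlt
  refine h u hg (w.ord - u.ord) (by omega) ?_
  rwa [show u.shift (w.ord - u.ord) = w by ext <;> simp [hv]; omega]

/-- Mutual partial reducedness forces the leaders to coincide, and then each degree in the leader
would be smaller than the other. -/
lemma Autoreduced.eq_of_var_eq {A : Finset (DPoly k n)} (hA : Autoreduced A) {f g : DPoly k n}
    {u w : Der n} (hf : f ∈ A) (hg : g ∈ A) (hu : ld f = u) (hw : ld g = w)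
    (h : u.var = w.var) : f = g := by
  by_contra hne
  have h1 := (hA.2 f hf g hg hne).1.ord_le (ld_eq_coe_iff.1 hu).1 hw h
  have h2 := (hA.2 g hg f hf (Ne.symm hne)).1.ord_le (ld_eq_coe_iff.1 hw).1 hu h.symm
  obtain rfl : u = w := Der.ext h (le_antisymm h1 h2)
  exact lt_asymm ((hA.2 f hf g hg hne).2 u hw) ((hA.2 g hg f hf (Ne.symm hne)).2 u hu)

lemma partReduced_self (hR : IsRanking n) (f : DPoly k n) : PartReduced f f := fun u hu _ hj hm =>
  absurd ((ld_eq_coe_iff.1 hu).2 _ hm) (not_le.2 (hR.lt_shift u hj))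

lemma Autoreduced.partReduced (hR : IsRanking n) {A : Finset (DPoly k n)} (hA : Autoreduced A)
    {f g : DPoly k n} (hf : f ∈ A) (hg : g ∈ A) : PartReduced f g := by
  by_cases h : f = g
  · subst h; exact partReduced_self hR f
  · exact (hA.2 f hf g hg h).1

lemma Autoreduced.mem_supported_compl (hR : IsRanking n) {D : Finset (DPoly k n)}
    (hD : Autoreduced D) {d : DPoly k n} {u : Der n} (hd : d ∈ D) (hu : ld d = u) {j : ℕ}
    (hj : 0 < j) {d' : DPoly k n} (hd' : d' ∈ D) :
    d' ∈ supported k ({u.shift j}ᶜ : Set (Der n)) := by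
  refine mem_supported.2 fun w hw => ?_
  rintro rfl
  exact hD.partReduced hR hd' hd u hu j hj hw

end autoreduced

/-! ### Elimination of a variable by a linear equation -/

section elimination

variable {k : Type*} [Field k] {n : ℕ}

lemma isUnit_of_isConst {f : DPoly k n} (h : IsConst f) (h0 : f ≠ 0) : IsUnit f := by
  obtain ⟨c, rfl⟩ := h
  refine (IsUnit.mk0 c ?_).map C
  rintro rfl; simp at h0

/-- Eliminating a variable `v` in which one of the generators `p` is linear, while it does not occur
in the other generators. -/
lemma pow_mul_mem_span_of_elim {M : Set (DPoly k n)} {v : Der n} {p s r y : DPoly k n}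
    (hp : p = s * X v + r) (hs : s ∈ supported k ({v}ᶜ : Set (Der n))) (hs0 : s ≠ 0)
    (hr : r ∈ supported k ({v}ᶜ : Set (Der n))) (hM : ∀ m ∈ M, m ∈ supported k ({v}ᶜ : Set (Der n)))
    (hy : y ∈ supported k ({v}ᶜ : Set (Der n))) (hspan : y ∈ Ideal.span (insert p M)) :
    ∃ N : ℕ, s ^ N * y ∈ Ideal.span M := by
  set V := supported k ({v}ᶜ : Set (Der n)) with hV
  -- Modulo p, s X_v equals -r, so a power of s removes v from any polynomial.
  have hdiv : ∀ a : DPoly k n, ∃ N : ℕ, ∃ a₀ ∈ V, ∃ a', s ^ N * a = a₀ + a' * p := by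
    intro a
    refine supported_induction (S := Set.univ)
      (p := fun a => ∃ N : ℕ, ∃ a₀ ∈ V, ∃ a', s ^ N * a = a₀ + a' * p) ?_ ?_ ?_ ?_ (by simp)
    · intro c; exact ⟨0, C c, C_mem_subalgebra V c, 0, by simp⟩
    · intro w _
      by_cases h : w = v
      · subst h; exact ⟨1, -r, neg_mem hr, 1, by rw [hp]; ring⟩
      · exact ⟨0, X w, X_mem_supported.2 (by simpa using h), 0, by simp⟩
    · rintro f _ g _ ⟨N, a, ha, a', h⟩ ⟨M, b, hb, b', h'⟩
      refine ⟨N + M, s ^ M * a + s ^ N * b, add_mem (mul_mem (pow_mem hs _) ha)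
        (mul_mem (pow_mem hs _) hb), s ^ M * a' + s ^ N * b', ?_⟩
      linear_combination s ^ M * h + s ^ N * h'
    · rintro f _ g _ ⟨N, a, ha, a', h⟩ ⟨M, b, hb, b', h'⟩
      refine ⟨N + M, a * b, mul_mem ha hb, a' * b + a * b' + a' * b' * p, ?_⟩
      linear_combination (s ^ M * g) * h + (a + a' * p) * h'
  obtain ⟨a, q, hq, rfl⟩ := Ideal.mem_span_insert.1 hspan
  have hq' : ∃ N : ℕ, ∃ q' ∈ Ideal.span M, q' ∈ V ∧ ∃ a', s ^ N * q = q' + a' * p := by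
    refine Submodule.span_induction (p := fun q _ => ∃ N : ℕ, ∃ q' ∈ Ideal.span M, q' ∈ V ∧
      ∃ a', s ^ N * q = q' + a' * p) ?_ ?_ ?_ ?_ hq
    · intro m hm; exact ⟨0, m, Ideal.subset_span hm, hM m hm, 0, by simp⟩
    · exact ⟨0, 0, zero_mem _, zero_mem _, 0, by simp⟩
    · rintro f g _ _ ⟨N, a, haM, ha, a', h⟩ ⟨M, b, hbM, hb, b', h'⟩
      refine ⟨N + M, s ^ M * a + s ^ N * b, add_mem (Ideal.mul_mem_left _ _ haM)
        (Ideal.mul_mem_left _ _ hbM), add_mem (mul_mem (pow_mem hs _) ha)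
        (mul_mem (pow_mem hs _) hb), s ^ M * a' + s ^ N * b', ?_⟩
      linear_combination s ^ M * h + s ^ N * h'
    · rintro f g _ ⟨M, b, hbM, hb, b', h'⟩
      obtain ⟨N, a, ha, a', h⟩ := hdiv f
      refine ⟨N + M, a * b, Ideal.mul_mem_left _ _ hbM, mul_mem ha hb,
        a' * b + a * b' + a' * b' * p, ?_⟩
      rw [smul_eq_mul]
      linear_combination (s ^ M * g) * h + (a + a' * p) * h'
  obtain ⟨N, q', hq'M, hq'V, a', h⟩ := hq'
  have hA : s ^ N * (a * p + q) = q' + (s ^ N * a + a') * p := by linear_combination h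
  have hpdeg : p.degreeOf v ≠ 0 := by
    rw [Ne, degreeOf_eq_zero_iff', not_not]
    by_contra hvp
    have h0 := pderiv_eq_zero_of_notMem_vars hvp
    rw [hp, map_add, pderiv_mul, pderiv_eq_zero_of_mem_supported hs,
      pderiv_eq_zero_of_mem_supported hr] at h0
    simp at h0; exact hs0 h0
  -- In `hA` both the left side and q' are free of v, hence so is the multiple of p; as p has
  -- positive degree in v, its cofactor must vanish.
  have hzero : s ^ N * a + a' = 0 := by
    by_contra hne
    have hmem : (s ^ N * a + a') * p ∈ V := by
      rw [show (s ^ N * a + a') * p = s ^ N * (a * p + q) - q' by rw [hA]; ring]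
      exact sub_mem (mul_mem (pow_mem hs _) hy) hq'V
    have hp0 : p ≠ 0 := by rintro rfl; simp at hpdeg
    have h1 := degreeOf_mul_eq (n := v) hne hp0
    have h2 : ((s ^ N * a + a') * p).degreeOf v = 0 :=
      degreeOf_eq_zero_iff'.2 fun hv => by simpa using mem_supported.1 hmem hv
    omega
  exact ⟨N, by rw [hA, hzero, zero_mul, add_zero]; exact hq'M⟩

end elimination

/-! ### The Rosenfeld lemma -/

section rosenfeld

variable {k : Type*} [Field k] [Differential k] {n : ℕ} [LinearOrder (Der n)]

lemma delta_mem_Iio (hR : IsRanking n) {v : Der n} {f : DPoly k n}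
    (hf : f ∈ supported k (Set.Iio v)) : delta f ∈ supported k (Set.Iio (v.shift 1)) := by
  refine delta_mem (fun w hw => X_mem_supported.2 ?_) (fun w hw => X_mem_supported.2 ?_) hf
  · exact lt_of_lt_of_le hw (hR.le_shift v 1)
  · exact hR.shift_lt_shift hw 1

/-- A proper derivative is linear in its leader with the separant as coefficient; both the
elimination in the Rosenfeld lemma and the reduction by proper derivatives depend on this. -/
lemma iterate_delta_eq (hR : IsRanking n) {d : DPoly k n} {u : Der n} (hu : ld d = u) (j : ℕ) :
    ∃ r ∈ supported k (Set.Iio (u.shift (j + 1))),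
      delta^[j + 1] d = separant d * X (u.shift (j + 1)) + r := by
  have hlt : ∀ j, u < u.shift (j + 1) := fun j => hR.lt_shift u (Nat.succ_pos j)
  induction j with
  | zero =>
    refine ⟨delta d - pderiv u d * X (u.shift 1), ?_, ?_⟩
    · refine delta_sub_mem u (S := Set.Iic u) (fun w hw => X_mem_supported.2 ?_)
        (fun w hw hne => X_mem_supported.2 ?_) (mem_supported_Iic hu)
      · exact lt_of_le_of_lt hw (hlt 0)
      · exact hR.shift_lt_shift (lt_of_le_of_ne hw hne) 1
    · rw [separant_eq hu]; simp
  | succ j ih =>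
    obtain ⟨r, hr, h⟩ := ih
    have hs : separant d ∈ supported k (Set.Iio (u.shift (j + 1))) :=
      supported_mono (fun w hw => lt_of_le_of_lt hw (hlt j))
        (separant_mem_supported (mem_supported_Iic hu))
    have hsh : u.shift (j + 1 + 1) = (u.shift (j + 1)).shift 1 := (Der.shift_shift _ _ _).symm
    refine ⟨X (u.shift (j + 1)) * delta (separant d) + delta r, ?_, ?_⟩
    · rw [hsh]
      refine add_mem (mul_mem (X_mem_supported.2 ?_) (delta_mem_Iio hR hs)) (delta_mem_Iio hR hr)
      exact hR.lt_shift _ Nat.one_pos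
    · rw [Function.iterate_succ_apply', h, delta_add, delta_mul, delta_X, hsh]; ring

/-- The ideal generated by the elements of `D` and their derivatives with leader in `B`. -/
def prolongIdeal (D : Finset (DPoly k n)) (B : Set (Der n)) : Ideal (DPoly k n) :=
  Ideal.span {x | ∃ d ∈ D, ∃ j, x = delta^[j] d ∧ (j = 0 ∨ ∃ u : Der n, ld d = u ∧ u.shift j ∈ B)}

/-- The differential ideal `[D] : H_D^∞`. -/
def regIdeal (D : Finset (DPoly k n)) : Ideal (DPoly k n) :=
  sat (diffIdeal (D : Set (DPoly k n))) (initSep D)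

lemma regIdeal_isDiff (D : Finset (DPoly k n)) : IsDiffIdeal (regIdeal D) :=
  sat_isDiff (diffIdeal_isDiff _) _

lemma subset_regIdeal {D : Finset (DPoly k n)} {d : DPoly k n} (h : d ∈ D) : d ∈ regIdeal D :=
  le_sat _ _ (subset_diffIdeal _ h)

lemma regIdeal_mono {D D' : Finset (DPoly k n)} (h : D ⊆ D') : regIdeal D ≤ regIdeal D' :=
  sat_mono (diffIdeal_mono (Finset.coe_subset.2 h)) (Finset.coe_subset.2 (initSep_mono h))

lemma regIdeal_le {D : Finset (DPoly k n)} {I : Ideal (DPoly k n)} (hI : IsDiffIdeal I)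
    (hD : ∀ d ∈ D, d ∈ I) (hH : ∀ h ∈ initSep D, IsNzd I h) : regIdeal D ≤ I :=
  sat_le (diffIdeal_le hI hD) hH

lemma prolongIdeal_le_diffIdeal (D : Finset (DPoly k n)) (B : Set (Der n)) :
    prolongIdeal D B ≤ diffIdeal (D : Set (DPoly k n)) := by
  refine Ideal.span_le.2 ?_
  rintro _ ⟨d, hd, j, rfl, _⟩
  exact iterate_delta_mem (diffIdeal_isDiff _) (subset_diffIdeal _ hd) j

lemma sat_prolongIdeal_le (D : Finset (DPoly k n)) (B : Set (Der n)) :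
    sat (prolongIdeal D B) (initSep D) ≤ regIdeal D := sat_mono (prolongIdeal_le_diffIdeal D B) le_rfl

lemma prolongIdeal_mono (D : Finset (DPoly k n)) {B B' : Set (Der n)} (h : B ⊆ B') :
    prolongIdeal D B ≤ prolongIdeal D B' := by
  refine Ideal.span_mono ?_
  rintro x ⟨d, hd, j, hx, h0 | ⟨u, hu, hB⟩⟩
  · exact ⟨d, hd, j, hx, Or.inl h0⟩
  · exact ⟨d, hd, j, hx, Or.inr ⟨u, hu, h hB⟩⟩

lemma exists_finset_prolongIdeal {D : Finset (DPoly k n)} (hD : ∀ d ∈ D, ¬ IsConst d)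
    {x : DPoly k n} (hx : x ∈ diffIdeal (D : Set (DPoly k n))) :
    ∃ T : Finset (Der n), x ∈ prolongIdeal D T := by
  rw [diffIdeal_eq_span] at hx
  refine Submodule.span_induction (p := fun x _ => ∃ T : Finset (Der n), x ∈ prolongIdeal D T)
    ?_ ?_ ?_ ?_ hx
  · rintro _ ⟨d, hd, j, rfl⟩
    obtain ⟨u, hu⟩ := exists_ld (hD d hd)
    exact ⟨{u.shift j}, Ideal.subset_span ⟨d, hd, j, rfl, Or.inr ⟨u, hu, by simp⟩⟩⟩
  · exact ⟨∅, zero_mem _⟩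
  · rintro x y _ _ ⟨T, hT⟩ ⟨T', hT'⟩
    refine ⟨T ∪ T', add_mem (prolongIdeal_mono D ?_ hT) (prolongIdeal_mono D ?_ hT')⟩
    · simp
    · simp
  · rintro a x _ ⟨T, hT⟩
    exact ⟨T, Ideal.mul_mem_left _ _ hT⟩

/-- A version of the Rosenfeld lemma: the derivatives of `D` whose leaders do not occur are not
needed. -/
theorem mem_sat_prolongIdeal [CharZero k] (hR : IsRanking n) {D : Finset (DPoly k n)}
    (hD : Autoreduced D) {B : Set (Der n)} (hB : IsLowerSet B) {x : DPoly k n}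
    (hx : x ∈ regIdeal D)
    (hfree : ∀ d ∈ D, ∀ u : Der n, ld d = u → ∀ j, 0 < j → u.shift j ∉ B → u.shift j ∉ x.vars) :
    x ∈ sat (prolongIdeal D B) (initSep D) := by
  obtain ⟨s, hs, hsx⟩ := hx
  obtain ⟨T, hT⟩ := exists_finset_prolongIdeal hD.1 hsx
  replace hT : s * x ∈ prolongIdeal D (B ∪ T) := prolongIdeal_mono D Set.subset_union_right hT
  clear hsx
  induction T using Finset.induction_on_max generalizing s with
  | empty => exact ⟨s, hs, by simpa using hT⟩
  | insert v T hv ih =>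
    -- The largest element v of T needs work only if it lies outside B and is the leader of a proper
    -- derivative of D. That derivative is linear in v, and v occurs neither in x, nor in D, nor in
    -- the other generators, so it can be eliminated.
    by_cases hgen : v ∉ B ∧ ∃ d ∈ D, ∃ u : Der n, ld d = u ∧ ∃ j, v = u.shift (j + 1)
    · obtain ⟨hvB, d, hd, u, hu, j, rfl⟩ := hgen
      set v := u.shift (j + 1) with hvdef
      obtain ⟨r, hr, hdj⟩ := iterate_delta_eq hR hu j
      have hIio : (Set.Iio v : Set (Der n)) ⊆ {v}ᶜ := fun w hw => ne_of_lt hw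
      have hDv : ∀ d' ∈ D, d' ∈ supported k ({v}ᶜ : Set (Der n)) := fun d' hd' =>
        hD.mem_supported_compl hR hd hu (Nat.succ_pos j) hd'
      have hsv := closure_initSep_mem_supported hDv hs
      have hsep : separant d ∈ Submonoid.closure (initSep D : Set (DPoly k n)) :=
        Submonoid.subset_closure (separant_mem_initSep hd)
      set M : Set (DPoly k n) := {x | ∃ d ∈ D, ∃ j, x = delta^[j] d ∧
        (j = 0 ∨ ∃ u : Der n, ld d = u ∧ u.shift j ∈ B ∪ T)} with hMdef
      have hM : ∀ m ∈ M, m ∈ supported k ({v}ᶜ : Set (Der n)) := by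
        rintro _ ⟨d', hd', i, rfl, hi⟩
        rcases Nat.eq_zero_or_pos i with rfl | hi0
        · exact hDv d' hd'
        · obtain ⟨i, rfl⟩ : ∃ l, i = l + 1 := ⟨i - 1, by omega⟩
          obtain ⟨u', hu', hBT⟩ := hi.resolve_left (by omega)
          -- Elements of the lower set B lie below v because v is not in B; those of T do so by the
          -- maximality of v.
          have hlt : u'.shift (i + 1) < v := by
            rcases hBT with h | h
            · exact lt_of_not_ge fun hle => hvB (hB hle h)
            · exact hv _ h
          obtain ⟨r', hr', hd'j⟩ := iterate_delta_eq hR hu' i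
          rw [hd'j]
          refine add_mem (mul_mem (separant_mem_supported (hDv d' hd')) (X_mem_supported.2 ?_))
            (supported_mono (fun w hw => ?_) hr')
          · exact hlt.ne
          · exact (lt_trans hw hlt).ne
      have hxv : x ∈ supported k ({v}ᶜ : Set (Der n)) := by
        refine mem_supported.2 fun w hw => ?_
        rintro rfl
        exact hfree d hd u hu (j + 1) (Nat.succ_pos j) hvB hw
      have hspan : s * x ∈ Ideal.span (insert (delta^[j + 1] d) M) := by
        refine Ideal.span_mono ?_ hT
        rintro _ ⟨d', hd', i, rfl, hi⟩
        rcases hi with h0 | ⟨u', hu', hBT⟩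
        · exact Or.inr ⟨d', hd', i, rfl, Or.inl h0⟩
        · by_cases hv' : u'.shift i = v
          · have hvar : u'.var = u.var := by
              have := congrArg Der.var hv'
              simpa [hvdef] using this
            obtain rfl := hD.eq_of_var_eq hd' hd hu' hu hvar
            obtain rfl : u' = u := WithBot.coe_inj.1 (hu'.symm.trans hu)
            have : i = j + 1 := by
              have := congrArg Der.ord hv'
              simp [hvdef] at this; omega
            subst this
            exact Or.inl rfl
          · refine Or.inr ⟨d', hd', i, rfl, Or.inr ⟨u', hu', ?_⟩⟩
            rcases hBT with h | h
            · exact Or.inl h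
            · rw [Finset.coe_insert] at h
              exact Or.inr (h.resolve_left hv')
      obtain ⟨N, hN⟩ := pow_mul_mem_span_of_elim hdj (separant_mem_supported (hDv d hd))
        (separant_ne_zero (hD.1 d hd)) (supported_mono hIio hr) hM (mul_mem hsv hxv) hspan
      refine ih _ (mul_mem (pow_mem hsep N) hs) ?_
      rw [mul_assoc]; exact hN
    -- Here v contributes no generator outside B and can be dropped from T.
    · refine ih s hs (Ideal.span_mono ?_ hT)
      rintro _ ⟨d', hd', i, rfl, hi⟩
      refine ⟨d', hd', i, rfl, ?_⟩
      rcases Nat.eq_zero_or_pos i with rfl | hi0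
      · exact Or.inl rfl
      obtain ⟨u', hu', hBT⟩ := hi.resolve_left (by omega)
      refine Or.inr ⟨u', hu', ?_⟩
      rcases hBT with h | h
      · exact Or.inl h
      · rw [Finset.coe_insert] at h
        rcases h with h | h
        · by_contra hcon
          refine hgen ⟨fun hvB => hcon (Or.inl (h ▸ hvB)), d', hd', u', hu', i - 1, ?_⟩
          rw [← h, Nat.sub_add_cancel hi0]
        · exact Or.inr h

/-- The Rosenfeld lemma. -/
theorem mem_sat_span_of_partReduced [CharZero k] (hR : IsRanking n) {D : Finset (DPoly k n)}
    (hD : Autoreduced D) {x : DPoly k n} (hx : x ∈ regIdeal D)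
    (hpart : ∀ d ∈ D, PartReduced x d) :
    x ∈ sat (Ideal.span (D : Set (DPoly k n))) (initSep D) := by
  refine sat_mono (Ideal.span_mono ?_) le_rfl (mem_sat_prolongIdeal hR hD (B := ∅)
    (isLowerSet_empty) hx fun d hd u hu j hj _ => hpart d hd u hu j hj)
  rintro _ ⟨d, hd, j, rfl, rfl | ⟨u, _, h⟩⟩
  · exact hd
  · exact absurd h (Set.notMem_empty _)

/-- If the leading variable of `u` is not a leading variable of `D`, an element of `[D] : H_D^∞` with
variables at most `u` has its derivative and its coefficients with respect to `u` in this ideal. -/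
theorem pderiv_coeffOf_mem_regIdeal [CharZero k] (hR : IsRanking n) {D : Finset (DPoly k n)}
    (hD : Autoreduced D) {u : Der n}
    (hDu : ∀ d ∈ D, ∀ w : Der n, ld d = w → w < u ∧ w.var ≠ u.var) {x : DPoly k n}
    (hx : x ∈ regIdeal D) (hxu : x ∈ supported k (Set.Iic u)) :
    pderiv u x ∈ regIdeal D ∧ ∀ t, coeffOf u t x ∈ regIdeal D := by
  have hDfree : ∀ d ∈ D, d ∈ supported k ({u}ᶜ : Set (Der n)) := by
    intro d hd
    obtain ⟨w, hw⟩ := exists_ld (hD.1 d hd)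
    exact supported_mono (fun v hv => (lt_of_le_of_lt hv (hDu d hd w hw).1).ne)
      (mem_supported_Iic hw)
  obtain ⟨s, hs, hsx⟩ := mem_sat_prolongIdeal hR hD (B := Set.Iic u) (isLowerSet_Iic u) hx
    (fun d hd w hw j hj hnot hm => hnot (mem_supported.1 hxu hm))
  have hsfree := closure_initSep_mem_supported hDfree hs
  -- By the Rosenfeld lemma only derivatives of D with leaders at most u are needed. Their leaders
  -- differ from u, since the variable of u is not a leading one, so these generators are free of u
  -- and the ideal is stable under ∂/∂u and under taking coefficients.
  have key : ∀ y ∈ prolongIdeal D (Set.Iic u), pderiv u y ∈ prolongIdeal D (Set.Iic u) ∧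
      ∀ t, (theta u y).coeff t ∈ prolongIdeal D (Set.Iic u) := by
    intro y hy
    refine Submodule.span_induction (p := fun y _ => pderiv u y ∈ prolongIdeal D (Set.Iic u) ∧
      ∀ t, (theta u y).coeff t ∈ prolongIdeal D (Set.Iic u)) ?_ ?_ ?_ ?_ hy
    · rintro y hy'
      have hyfree : y ∈ supported k ({u}ᶜ : Set (Der n)) := by
        obtain ⟨d, hd, j, rfl, hj⟩ := hy'
        rcases Nat.eq_zero_or_pos j with rfl | hj0
        · exact hDfree d hd
        obtain ⟨w, hw, hle⟩ := hj.resolve_left (by omega)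
        obtain ⟨j, rfl⟩ : ∃ l, j = l + 1 := ⟨j - 1, by omega⟩
        obtain ⟨r, hr, hdj⟩ := iterate_delta_eq hR hw j
        have hlt : w.shift (j + 1) < u := lt_of_le_of_ne hle fun he =>
          (hDu d hd w hw).2 (by rw [← he]; rfl)
        rw [hdj]
        exact add_mem (mul_mem (separant_mem_supported (hDfree d hd)) (X_mem_supported.2 hlt.ne))
          (supported_mono (fun v hv => (lt_trans hv hlt).ne) hr)
      refine ⟨by rw [pderiv_eq_zero_of_mem_supported hyfree]; exact zero_mem _, fun t => ?_⟩
      rw [theta_of_mem hyfree, Polynomial.coeff_C]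
      split_ifs
      · exact Ideal.subset_span hy'
      · exact zero_mem _
    · simp
    · rintro y z _ _ ⟨h1, h2⟩ ⟨h3, h4⟩
      refine ⟨by rw [map_add]; exact add_mem h1 h3, fun t => ?_⟩
      rw [map_add, Polynomial.coeff_add]; exact add_mem (h2 t) (h4 t)
    · rintro a y hy ⟨h1, h2⟩
      rw [smul_eq_mul]
      refine ⟨?_, fun t => ?_⟩
      · rw [pderiv_mul]
        exact add_mem (Ideal.mul_mem_left _ _ hy) (Ideal.mul_mem_left _ _ h1)
      · rw [map_mul, Polynomial.coeff_mul]
        exact sum_mem fun i _ => Ideal.mul_mem_left _ _ (h2 _)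
  obtain ⟨h1, h2⟩ := key _ hsx
  refine ⟨sat_prolongIdeal_le D (Set.Iic u) ⟨s, hs, ?_⟩,
    fun t => sat_prolongIdeal_le D (Set.Iic u) ⟨s, hs, ?_⟩⟩
  · rw [pderiv_mul, pderiv_eq_zero_of_mem_supported hsfree, zero_mul, zero_add] at h1
    exact h1
  · have := h2 t
    rwa [map_mul, theta_of_mem hsfree, Polynomial.coeff_C_mul, coeff_theta] at this

end rosenfeld

/-! ### Pseudo-division -/

section pseudodivision

variable {k : Type*} [Field k] {n : ℕ}

lemma degreeOf_eq_zero_of_mem_supported {S : Set (Der n)} {f : DPoly k n} {w : Der n}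
    (hf : f ∈ supported k S) (hw : w ∉ S) : f.degreeOf w = 0 :=
  degreeOf_eq_zero_iff'.2 fun h => hw (mem_supported.1 hf h)

variable [LinearOrder (Der n)]

/-- Multiplying by i and subtracting a multiple of p cancels the top coefficient in v. The bound on
the degrees above v holds since i and p involve nothing above v; it keeps reductions already made at
higher derivatives intact. -/
lemma exists_pseudo_remainder {v : Der n} {p i r : DPoly k n} {e : ℕ}
    (hp : p = i * X v ^ e + r) (hi : i ∈ supported k (Set.Iio v))
    (hr : r ∈ supported k (Set.Iic v)) (hrd : r.degreeOf v < e) (f : DPoly k n) :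
    ∃ (N : ℕ) (q : DPoly k n), (i ^ N * f - q * p).degreeOf v < e ∧
      ∀ w, v < w → (i ^ N * f - q * p).degreeOf w ≤ f.degreeOf w := by
  induction ht : f.degreeOf v using Nat.strong_induction_on generalizing f with
  | _ t ih =>
  by_cases hlt : t < e
  · exact ⟨0, 0, by simpa [ht] using hlt, fun w _ => by simp⟩
  push Not at hlt
  have hv : v ∈ f.vars := degreeOf_pos_iff.1 (by omega)
  obtain ⟨f₁, hf, hf₁d, hf₁s⟩ := exists_eq_coeffOf_mul_add hv
  rw [ht] at hf hf₁d
  set c := coeffOf v t f with hc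
  have heq : i * f - c * X v ^ (t - e) * p = i * f₁ - c * X v ^ (t - e) * r := by
    have hpow : (X v : DPoly k n) ^ t = X v ^ (t - e) * X v ^ e := by
      rw [← pow_add, Nat.sub_add_cancel hlt]
    rw [hp]
    nth_rewrite 1 [hf]
    rw [hpow]; ring
  have hiv : i.degreeOf v = 0 := degreeOf_eq_zero_of_mem_supported hi (by simp)
  have hcv : c.degreeOf v = 0 :=
    degreeOf_eq_zero_of_mem_supported (coeffOf_mem_supported v t f) (by simp)
  have hXv : ((X v : DPoly k n) ^ (t - e)).degreeOf v ≤ t - e := by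
    refine (degreeOf_pow_le _ _ _).trans ?_
    simp
  have hdv : (i * f - c * X v ^ (t - e) * p).degreeOf v < t := by
    rw [heq]
    refine (degreeOf_sub_le _ _ _).trans_lt (max_lt ?_ ?_)
    · have := degreeOf_mul_le v i f₁; omega
    · have h1 := degreeOf_mul_le v (c * X v ^ (t - e)) r
      have h2 := degreeOf_mul_le v c (X v ^ (t - e))
      omega
  have hdw : ∀ w, v < w → (i * f - c * X v ^ (t - e) * p).degreeOf w ≤ f.degreeOf w := by
    intro w hw
    rw [heq]
    refine (degreeOf_sub_le _ _ _).trans (max_le ?_ ?_)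
    · have h1 := degreeOf_mul_le w i f₁
      have h2 : i.degreeOf w = 0 :=
        degreeOf_eq_zero_of_mem_supported hi (by simpa using hw.le)
      have h3 := degreeOf_le_of_support_subset hf₁s w
      omega
    · have h1 := degreeOf_mul_le w (c * X v ^ (t - e)) r
      have h2 := degreeOf_mul_le w c (X v ^ (t - e))
      have h3 : r.degreeOf w = 0 :=
        degreeOf_eq_zero_of_mem_supported hr (by simpa using hw)
      have h4 : ((X v : DPoly k n) ^ (t - e)).degreeOf w = 0 :=
        degreeOf_eq_zero_iff'.2 fun hm => hw.ne' (by simpa using vars_pow _ _ hm)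
      have h5 : c.degreeOf w ≤ f.degreeOf w := degreeOf_coeffOf_le v w t f
      omega
  obtain ⟨N, q, h1, h2⟩ := ih _ hdv _ rfl
  have hfin : i ^ (N + 1) * f - (i ^ N * (c * X v ^ (t - e)) + q) * p =
      i ^ N * (i * f - c * X v ^ (t - e) * p) - q * p := by ring
  refine ⟨N + 1, i ^ N * (c * X v ^ (t - e)) + q, by rwa [hfin], fun w hw => ?_⟩
  rw [hfin]
  exact (h2 w hw).trans (hdw w hw)

end pseudodivision

/-! ### Existence of differential remainders -/

section remainder

variable {k : Type*} [Field k] {n : ℕ} [LinearOrder (Der n)]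

/-- The polynomial `f` is reduced with respect to `D` as far as the derivative `w` is concerned. -/
def ReducedAt (D : Finset (DPoly k n)) (f : DPoly k n) (w : Der n) : Prop :=
  ∀ d ∈ D, ∀ u : Der n, ld d = u →
    (∀ j, 0 < j → w = u.shift j → w ∉ f.vars) ∧ (w = u → f.degreeOf w < d.degreeOf w)

lemma reduced_of_reducedAt {D : Finset (DPoly k n)} {f : DPoly k n} (h : ∀ w, ReducedAt D f w) :
    ∀ d ∈ D, Reduced f d := fun d hd =>
  ⟨fun u hu j hj => (h _ d hd u hu).1 j hj rfl, fun u hu => (h u d hd u hu).2 rfl⟩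

lemma ReducedAt.of_le {D : Finset (DPoly k n)} {f f' : DPoly k n} {w : Der n}
    (h : ReducedAt D f w) (hd : f'.degreeOf w ≤ f.degreeOf w) : ReducedAt D f' w := by
  intro d hd' u hu
  refine ⟨fun j hj hw => ?_, fun hw => hd.trans_lt ((h d hd' u hu).2 hw)⟩
  have := (h d hd' u hu).1 j hj hw
  rw [← degreeOf_eq_zero_iff'] at this ⊢
  omega

lemma reducedAt_of_notMem {D : Finset (DPoly k n)} {f : DPoly k n} {w : Der n}
    (h : w ∉ f.vars) : ReducedAt D f w := by
  refine fun d _ u hu => ⟨fun _ _ _ => h, ?_⟩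
  rintro rfl
  rw [degreeOf_eq_zero_iff'.2 h]
  exact degreeOf_pos_iff.2 (ld_eq_coe_iff.1 hu).1

variable [Differential k]

/-- Reduction at a single derivative `v`. -/
lemma exists_reduction_at [CharZero k] (hR : IsRanking n) {D : Finset (DPoly k n)}
    (hD : Autoreduced D) {v : Der n} {f : DPoly k n} (hv : ¬ ReducedAt D f v) :
    ∃ h ∈ Submonoid.closure (initSep D : Set (DPoly k n)), ∃ g : DPoly k n,
      h * f - g ∈ diffIdeal (D : Set (DPoly k n)) ∧ ReducedAt D g v ∧
      ∀ w, v ≤ w → g.degreeOf w ≤ f.degreeOf w := by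
  -- Treats both kinds of reduction at once: p is a proper derivative of d with e = 1 and i the
  -- separant, or p = d with e its degree and i the initial.
  have hmain : ∀ (p i r : DPoly k n) (e : ℕ), p = i * X v ^ e + r →
      i ∈ supported k (Set.Iio v) → r ∈ supported k (Set.Iic v) → r.degreeOf v < e →
      i ∈ initSep D → p ∈ diffIdeal (D : Set (DPoly k n)) → e ≤ f.degreeOf v →
      (∀ g : DPoly k n, g.degreeOf v < e → ReducedAt D g v) →
      ∃ h ∈ Submonoid.closure (initSep D : Set (DPoly k n)), ∃ g : DPoly k n,
        h * f - g ∈ diffIdeal (D : Set (DPoly k n)) ∧ ReducedAt D g v ∧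
        ∀ w, v ≤ w → g.degreeOf w ≤ f.degreeOf w := by
    intro p i r e hp hi hr hrd hiD hpD hef hred
    obtain ⟨N, q, h1, h2⟩ := exists_pseudo_remainder hp hi hr hrd f
    refine ⟨i ^ N, pow_mem (Submonoid.subset_closure hiD) N, i ^ N * f - q * p, ?_, hred _ h1, ?_⟩
    · rw [sub_sub_cancel]; exact Ideal.mul_mem_left _ _ hpD
    · intro w hw
      rcases hw.lt_or_eq with hlt | rfl
      · exact h2 w hlt
      · omega
  unfold ReducedAt at hv
  push Not at hv
  obtain ⟨d, hd, u, hu, hbad⟩ := hv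
  by_cases hp : ∃ j, 0 < j ∧ v = u.shift j ∧ v ∈ f.vars
  · obtain ⟨j, hj, rfl, hvf⟩ := hp
    obtain ⟨j, rfl⟩ : ∃ l, j = l + 1 := ⟨j - 1, by omega⟩
    obtain ⟨r, hr, hdj⟩ := iterate_delta_eq hR hu j
    refine hmain (delta^[j + 1] d) (separant d) r 1 (by rw [pow_one]; exact hdj) ?_
      (supported_mono (fun w hw => le_of_lt hw) hr) ?_ (separant_mem_initSep hd) ?_
      (degreeOf_pos_iff.2 hvf) ?_
    · exact supported_mono (fun w hw => lt_of_le_of_lt hw (hR.lt_shift u hj))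
        (separant_mem_supported (mem_supported_Iic hu))
    · rw [degreeOf_eq_zero_of_mem_supported hr (by simp)]; exact one_pos
    · exact iterate_delta_mem (diffIdeal_isDiff _) (subset_diffIdeal _ hd) _
    · intro g hg
      exact reducedAt_of_notMem (degreeOf_eq_zero_iff'.1 (by omega))
  · push Not at hp
    obtain ⟨rfl, hdeg⟩ := hbad hp
    have hvd := (ld_eq_coe_iff.1 hu).1
    obtain ⟨r, hdr, hrd, hrs⟩ := exists_eq_coeffOf_mul_add hvd
    refine hmain d (initial d) r _ (by rw [initial_eq hu]; exact hdr)
      (initial_mem_Iio hu) ?_ hrd (initial_mem_initSep hd) (subset_diffIdeal _ hd) hdeg ?_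
    · exact mem_supported.2 fun w hw =>
        (ld_eq_coe_iff.1 hu).2 w (vars_subset_of_support_subset hrs hw)
    · intro g hg d' hd' u' hu'
      have hkey : v.var = u'.var → d' = d := fun hvar =>
        hD.eq_of_var_eq hd' hd hu' hu hvar.symm
      constructor
      · rintro j hj rfl
        obtain rfl := hkey rfl
        have := WithBot.coe_inj.1 (hu'.symm.trans hu)
        exact absurd this (hR.lt_shift u' hj).ne
      · rintro rfl
        obtain rfl := hkey rfl
        exact hg

/-- Existence of differential remainders; the rank does not increase. -/
theorem exists_diffRem [CharZero k] (hR : IsRanking n) {D : Finset (DPoly k n)}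
    (hD : Autoreduced D) (f : DPoly k n) : ∃ g, IsDiffRem D f g ∧ rk g ≤ rk f := by
  -- The degree clause is what later bounds the rank: at and above the highest derivative where f
  -- fails to be reduced, no degree grows.
  let P : DPoly k n → Prop := fun f =>
    ∃ h ∈ Submonoid.closure (initSep D : Set (DPoly k n)), ∃ g : DPoly k n,
      h * f - g ∈ diffIdeal (D : Set (DPoly k n)) ∧ (∀ w, ReducedAt D g w) ∧
      ∀ w, (∀ w', w < w' → ReducedAt D f w') → g.degreeOf w ≤ f.degreeOf w
  -- One reduction at the highest bad derivative v leaves only bad derivatives below v, so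
  -- well-founded induction on v applies.
  have step : ∀ f, (∀ v f', ¬ ReducedAt D f v → (∀ w, v ≤ w → ReducedAt D f' w) → P f') → P f := by
    intro f ih
    by_cases hall : ∀ w, ReducedAt D f w
    · exact ⟨1, one_mem _, f, by simp, hall, fun _ _ => le_rfl⟩
    let bad := f.vars.filter fun w => ¬ ReducedAt D f w
    have hbad : bad.Nonempty := by
      push Not at hall
      obtain ⟨w, hw⟩ := hall
      exact ⟨w, Finset.mem_filter.2 ⟨by_contra fun h => hw (reducedAt_of_notMem h), hw⟩⟩
    obtain ⟨v, hvb, hmax⟩ := Finset.exists_max_image bad id hbad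
    have hv := (Finset.mem_filter.1 hvb).2
    have hgood : ∀ w, v < w → ReducedAt D f w := by
      intro w hw
      by_contra hnot
      exact absurd (hmax w (Finset.mem_filter.2
        ⟨by_contra fun h => hnot (reducedAt_of_notMem h), hnot⟩)) (not_le.2 hw)
    obtain ⟨h, hh, f', hf', hred, hdeg⟩ := exists_reduction_at hR hD hv
    have hgood' : ∀ w, v ≤ w → ReducedAt D f' w := by
      intro w hw
      rcases hw.lt_or_eq with hlt | rfl
      · exact (hgood w hlt).of_le (hdeg w hw)
      · exact hred
    obtain ⟨h', hh', g, hg, hgr, hgd⟩ := ih v f' hv hgood'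
    refine ⟨h' * h, mul_mem hh' hh, g, ?_, hgr, fun w hw => ?_⟩
    · rw [show h' * h * f - g = h' * (h * f - f') + (h' * f' - g) by ring]
      exact add_mem (Ideal.mul_mem_left _ _ hf') hg
    · have hvw : v ≤ w := not_lt.1 fun hlt => hv (hw v hlt)
      exact (hgd w fun w' hw' => hgood' w' (hvw.trans hw'.le)).trans (hdeg w hvw)
  have aux : ∀ v f, (∀ w, v ≤ w → ReducedAt D f w) → P f := by
    have := hR.wellFoundedLT
    intro v
    induction v using WellFoundedLT.induction with
    | _ v ih =>
    intro f hf
    exact step f fun v' f' hv' hf' => ih v' (not_le.1 fun hle => hv' (hf v' hle)) f' hf'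
  obtain ⟨h, hh, g, hg, hred, hdeg⟩ := step f fun v f' _ hf' => aux v f' hf'
  refine ⟨g, ⟨reduced_of_reducedAt hred, h, hh, le_sat _ _ hg⟩, ?_⟩
  have hzero : ∀ w, (∀ w', w ≤ w' → w' ∉ f.vars) → w ∉ g.vars := by
    intro w hw
    have := hdeg w fun w' hw' => reducedAt_of_notMem (hw w' hw'.le)
    rw [degreeOf_eq_zero_iff'.2 (hw w le_rfl)] at this
    exact degreeOf_eq_zero_iff'.1 (by omega)
  by_cases hc : IsConst f
  · have hvars := isConst_iff_vars.1 hc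
    have : IsConst g := isConst_iff_vars.2 <| Finset.eq_empty_of_forall_notMem fun w =>
      hzero w fun w' _ => by rw [hvars]; simp
    rw [rk_eq_bot_iff.2 this]; exact bot_le
  obtain ⟨u, hu⟩ := exists_ld hc
  have hle := (ld_eq_coe_iff.1 hu).2
  refine rk_le_of hu (mem_supported.2 fun w hw => ?_) (hdeg u fun w' hw' => ?_)
  · by_contra hnot
    refine hzero w (fun w' hw' hm => ?_) hw
    exact hnot (hw'.trans (hle w' hm))
  · exact reducedAt_of_notMem fun hm => absurd (hle w' hm) (not_le.2 hw')

end remainder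

/-! ### Lazard's lemma -/

/-- For a prime power q^(e+1) the derivative retains the factor q^e, and x supplies the missing q.
Coprime factors are combined by the Leibniz rule. -/
lemma dvd_derivative_mul_of_dvd_pow {K : Type*} [Field K] {p x : Polynomial K} {m : ℕ}
    (h : p ∣ x ^ m) : p ∣ Polynomial.derivative p * x := by
  induction p using UniqueFactorizationMonoid.induction_on_coprime with
  | h0 =>
    simp
  | h1 hu => exact hu.dvd
  | hpr e hq =>
    rename_i q
    cases e with
    | zero => simp
    | succ e =>
      have hqx : q ∣ x := hq.dvd_of_dvd_pow ((dvd_pow_self q (Nat.succ_ne_zero e)).trans h)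
      rw [Polynomial.derivative_pow_succ, pow_succ, mul_assoc, mul_assoc]
      refine Dvd.dvd.mul_left ?_ _
      exact mul_dvd_mul_left _ (hqx.mul_left _)
  | hcp hco ha hb =>
    rename_i a b
    rw [Polynomial.derivative_mul, add_mul]
    refine dvd_add ?_ ?_
    · rw [mul_right_comm]
      exact mul_dvd_mul_right (ha ((dvd_mul_right a b).trans h)) b
    · rw [mul_assoc]
      exact mul_dvd_mul_left a (hb ((dvd_mul_left b a).trans h))

section lazard

variable {k : Type*} [Field k] {n : ℕ} [LinearOrder (Der n)]

lemma exists_of_mem_closure_initSep_insert {s : Finset (DPoly k n)} {d h : DPoly k n}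
    (hh : h ∈ Submonoid.closure (initSep (insert d s) : Set (DPoly k n))) :
    ∃ h₀ ∈ Submonoid.closure (initSep s : Set (DPoly k n)), ∃ a b : ℕ,
      h = h₀ * initial d ^ a * separant d ^ b := by
  induction hh using Submonoid.closure_induction with
  | mem x hx =>
    obtain ⟨d', hd', hxd⟩ := mem_initSep.1 hx
    rcases Finset.mem_insert.1 hd' with rfl | hd'
    · rcases hxd with rfl | rfl
      · exact ⟨1, one_mem _, 1, 0, by ring⟩
      · exact ⟨1, one_mem _, 0, 1, by ring⟩
    · exact ⟨x, Submonoid.subset_closure (mem_initSep.2 ⟨d', hd', hxd⟩), 0, 0, by ring⟩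
  | one => exact ⟨1, one_mem _, 0, 0, by ring⟩
  | mul x y _ _ hx hy =>
    obtain ⟨h, hh, a, b, rfl⟩ := hx
    obtain ⟨h', hh', a', b', rfl⟩ := hy
    exact ⟨h * h', mul_mem hh hh', a + a', b + b', by ring⟩

/-- Over the field K, d divides a power of z, hence divides d' z, which is the separant times z, and
so divides ρ. The image of d keeps its degree because its initial does not vanish, so ρ has too
small a degree to be a nonzero multiple. -/
lemma map_theta_eq_zero {K : Type*} [Field K] (ψ : DPoly k n →+* K) {s : Finset (DPoly k n)}
    {d z ρ c Q : DPoly k n} {u : Der n} {M : ℕ} (hu : ld d = u) (hi : ψ (initial d) ≠ 0)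
    (hs : ∀ f ∈ s, f ∈ supported k ({u}ᶜ : Set (Der n))) (hψs : ∀ f ∈ s, ψ f = 0)
    (hz : z ^ M ∈ Ideal.span (insert d s : Finset (DPoly k n)))
    (hρ : ρ = c * (separant d * z) - Q * d) (hdeg : ρ.degreeOf u < d.degreeOf u) :
    (theta u ρ).map ψ = 0 := by
  obtain ⟨φ, hφ⟩ : ∃ φ : DPoly k n →+* Polynomial K, ∀ y, φ y = (theta u y).map ψ :=
    ⟨(Polynomial.mapRingHom ψ).comp (theta u).toRingHom, fun _ => rfl⟩
  have hφs : ∀ f ∈ s, φ f = 0 := by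
    intro f hf
    rw [hφ, theta_of_mem (hs f hf), Polynomial.map_C, hψs f hf, map_zero]
  have hdvd : φ d ∣ φ z ^ M := by
    rw [← map_pow]
    rw [Finset.coe_insert] at hz
    obtain ⟨q, y, hy, hqy⟩ := Ideal.mem_span_insert.1 hz
    have hle : Ideal.span (s : Set (DPoly k n)) ≤ RingHom.ker φ := Ideal.span_le.2 hφs
    have hy0 : φ y = 0 := hle hy
    rw [hqy, map_add, map_mul, hy0, add_zero]
    exact dvd_mul_left _ _
  have hder : Polynomial.derivative (φ d) = φ (separant d) := by
    rw [hφ, hφ, Polynomial.derivative_map, derivative_theta, separant_eq hu]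
  have hdvd2 : φ d ∣ φ (separant d) * φ z := hder ▸ dvd_derivative_mul_of_dvd_pow hdvd
  have hdvd3 : φ d ∣ φ ρ := by
    rw [hρ, map_sub, map_mul, map_mul, map_mul]
    exact dvd_sub (hdvd2.mul_left _) (dvd_mul_left _ _)
  have hlead : (φ d).coeff (d.degreeOf u) ≠ 0 := by
    rw [hφ, Polynomial.coeff_map, coeff_theta, ← initial_eq hu]
    exact hi
  rw [← hφ]
  refine Polynomial.eq_zero_of_dvd_of_natDegree_lt hdvd3 ?_
  refine lt_of_le_of_lt ?_ (lt_of_lt_of_le hdeg (Polynomial.le_natDegree_of_ne_zero hlead))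
  rw [hφ, ← natDegree_theta u ρ]
  exact Polynomial.natDegree_map_le

/-- The pseudo-remainder by d of the separant times z is tested modulo all primes containing the
radical ideal J of the lower equations, where the problem is one of univariate polynomials over a
field. -/
lemma sat_span_insert_isRadical {s : Finset (DPoly k n)} {d : DPoly k n} {u : Der n}
    (hu : ld d = u) (hs : ∀ f ∈ s, f ∈ supported k ({u}ᶜ : Set (Der n)))
    (hJ : (sat (Ideal.span (s : Set (DPoly k n))) (initSep s)).IsRadical) :
    (sat (Ideal.span (insert d s : Finset (DPoly k n)))
      (initSep (insert d s) : Set (DPoly k n))).IsRadical := by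
  set J := sat (Ideal.span (s : Set (DPoly k n))) (initSep s) with hJdef
  rintro x ⟨m, h, hh, hx⟩
  obtain ⟨h₀, hh₀, a, b, rfl⟩ := exists_of_mem_closure_initSep_insert hh
  set i := initial d with hi
  set σ := separant d with hσ
  -- z carries along every factor of the saturating product, so that a plain power of z lies in the
  -- ideal generated by d and s.
  set z := i * σ * h₀ * x with hz
  have hzM : z ^ (m + a + b + 1) ∈ Ideal.span (insert d s : Finset (DPoly k n)) := by
    have := Ideal.mul_mem_left _
      (i ^ (m + b + 1) * σ ^ (m + a + 1) * h₀ ^ (m + a + b) * x ^ (a + b + 1)) hx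
    rwa [show i ^ (m + b + 1) * σ ^ (m + a + 1) * h₀ ^ (m + a + b) * x ^ (a + b + 1) *
      (h₀ * i ^ a * σ ^ b * x ^ m) = z ^ (m + a + b + 1) by rw [hz]; ring] at this
  have hvd := (ld_eq_coe_iff.1 hu).1
  obtain ⟨r, hdr, hrd, hrs⟩ := exists_eq_coeffOf_mul_add hvd
  rw [← initial_eq hu] at hdr
  obtain ⟨N, Q, hρd, -⟩ := exists_pseudo_remainder hdr (initial_mem_Iio hu)
    (mem_supported.2 fun w hw =>
        (ld_eq_coe_iff.1 hu).2 w (vars_subset_of_support_subset hrs hw)) hrd (σ * z)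
  rw [← hi] at hρd
  set ρ := i ^ N * (σ * z) - Q * d with hρ
  -- The extra factor i disposes of the primes that contain the initial of d; for the others the
  -- division argument applies.
  have hcoef : ∀ t, i * (theta u ρ).coeff t ∈ J := by
    intro t
    rw [← hJ.radical, Ideal.radical_eq_sInf, Ideal.mem_sInf]
    rintro P ⟨hJP, hP⟩
    by_cases hiP : i ∈ P
    · exact P.mul_mem_right _ hiP
    refine P.mul_mem_left _ ?_
    let ψ : DPoly k n →+* FractionRing (DPoly k n ⧸ P) :=
      (algebraMap (DPoly k n ⧸ P) (FractionRing (DPoly k n ⧸ P))).comp (Ideal.Quotient.mk P)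
    have hψ : ∀ y, ψ y = 0 ↔ y ∈ P := by
      intro y
      rw [← Ideal.Quotient.eq_zero_iff_mem]
      exact FaithfulSMul.algebraMap_eq_zero_iff (DPoly k n ⧸ P) (FractionRing (DPoly k n ⧸ P))
    have hzero := map_theta_eq_zero ψ hu (fun h0 => hiP ((hψ _).1 h0)) hs
      (fun f hf => (hψ f).2 (hJP (le_sat _ _ (Ideal.subset_span hf)))) hzM hρ hρd
    rw [← hψ, ← Polynomial.coeff_map, hzero, Polynomial.coeff_zero]
  have hiρ : i * ρ ∈ J := by
    rw [← eval_theta u ρ, Polynomial.eval_eq_sum_range, Finset.mul_sum]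
    refine sum_mem fun t _ => ?_
    rw [← mul_assoc]
    exact J.mul_mem_right _ (hcoef t)
  obtain ⟨h₁, hh₁, hρs⟩ := hiρ
  have hsub : Ideal.span (s : Set (DPoly k n)) ≤ Ideal.span (insert d s : Finset (DPoly k n)) :=
    Ideal.span_mono (by simp)
  have hcl : ∀ y ∈ Submonoid.closure (initSep s : Set (DPoly k n)),
      y ∈ Submonoid.closure (initSep (insert d s) : Set (DPoly k n)) := fun y hy =>
    Submonoid.closure_mono (Finset.coe_subset.2 (initSep_mono (Finset.subset_insert d s))) hy
  have hicl : i ∈ Submonoid.closure (initSep (insert d s) : Set (DPoly k n)) :=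
    Submonoid.subset_closure (initial_mem_initSep (Finset.mem_insert_self d s))
  have hσcl : σ ∈ Submonoid.closure (initSep (insert d s) : Set (DPoly k n)) :=
    Submonoid.subset_closure (separant_mem_initSep (Finset.mem_insert_self d s))
  refine ⟨h₁ * i ^ (N + 1) * σ * (i * σ * h₀), ?_, ?_⟩
  · exact mul_mem (mul_mem (mul_mem (hcl _ hh₁) (pow_mem hicl _)) hσcl)
      (mul_mem (mul_mem hicl hσcl) (hcl _ hh₀))
  · have hd : d ∈ Ideal.span (insert d s : Finset (DPoly k n)) := Ideal.subset_span (by simp)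
    have := add_mem (hsub hρs) (Ideal.mul_mem_left _ (h₁ * i * Q) hd)
    rwa [show h₁ * (i * ρ) + h₁ * i * Q * d = h₁ * i ^ (N + 1) * σ * (i * σ * h₀) * x by
      rw [hρ, hz]; ring] at this

lemma Autoreduced.subset {A B : Finset (DPoly k n)} (hB : Autoreduced B) (h : A ⊆ B) :
    Autoreduced A := ⟨fun f hf => hB.1 f (h hf), fun f hf g hg => hB.2 f (h hf) g (h hg)⟩

lemma sat_span_isRadical {D : Finset (DPoly k n)} (hD : Autoreduced D) :
    (sat (Ideal.span (D : Set (DPoly k n))) (initSep D)).IsRadical := by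
  induction D using Finset.induction_on_max_value (ld (k := k) (n := n)) with
  | empty =>
    refine sat_isRadical ?_ _
    simpa using Ideal.isRadical_bot
  | insert d s hds hmax ih =>
    obtain ⟨u, hu⟩ := exists_ld (hD.1 d (Finset.mem_insert_self d s))
    refine sat_span_insert_isRadical hu (fun f hf => ?_) (ih (hD.subset (Finset.subset_insert d s)))
    obtain ⟨w, hw⟩ := exists_ld (hD.1 f (Finset.mem_insert_of_mem hf))
    have hle : w ≤ u := by
      have := hmax f hf
      rwa [hu, hw, WithBot.coe_le_coe] at this
    have hne : w ≠ u := by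
      rintro rfl
      exact hds (hD.eq_of_var_eq (Finset.mem_insert_self d s) (Finset.mem_insert_of_mem hf)
        hu hw rfl ▸ hf)
    exact supported_mono (fun v hv => (lt_of_le_of_lt hv (lt_of_le_of_ne hle hne)).ne)
      (mem_supported_Iic hw)

/-- Lazard's lemma for `[D] : H_D^∞`. -/
theorem regIdeal_isRadical [Differential k] [CharZero k] (hR : IsRanking n)
    {D : Finset (DPoly k n)} (hD : Autoreduced D) : (regIdeal D).IsRadical := by
  rintro x ⟨m, hm⟩
  obtain ⟨g, ⟨hgred, h, hh, hg⟩, -⟩ := exists_diffRem hR hD x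
  have hg : h * x - g ∈ regIdeal D := hg
  -- Powers of g stay partially reduced, so the Rosenfeld lemma turns the question about g into the
  -- algebraic statement `sat_span_isRadical`.
  have hgm : g ^ m ∈ regIdeal D := by
    refine mem_of_congr' (a := (h * x) ^ m) ?_ ?_
    · exact Ideal.mem_of_dvd _ (sub_dvd_pow_sub_pow _ _ m) hg
    · rw [mul_pow]; exact Ideal.mul_mem_left _ _ hm
  have h1 := mem_sat_span_of_partReduced hR hD hgm fun d hd =>
    (hgred d hd).1.of_vars_subset (vars_pow g m)
  have h2 : g ∈ regIdeal D :=
    sat_mono (Ideal.span_le.2 (subset_diffIdeal _)) le_rfl (sat_span_isRadical hD ⟨m, h1⟩)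
  exact isNzd_sat_of_mem_closure hh x (mem_of_congr hg h2)

end lazard

/-! ### Congruence to fractions with controlled variables -/

section fractions

variable {k : Type*} [Field k] {n : ℕ}

/-- The polynomials that are congruent modulo `I` to a fraction of elements of `P` whose denominator
is not a zero divisor modulo `I`. -/
def fracAlg (P : Subalgebra k (DPoly k n)) (I : Ideal (DPoly k n)) :
    Subalgebra k (DPoly k n) where
  carrier := {x | ∃ s ∈ P, IsNzd I s ∧ ∃ p ∈ P, s * x - p ∈ I}
  mul_mem' := by
    rintro x y ⟨s, hs, hs', p, hp, h⟩ ⟨t, ht, ht', q, hq, h'⟩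
    refine ⟨s * t, mul_mem hs ht, hs'.mul ht', p * q, mul_mem hp hq, ?_⟩
    rw [show s * t * (x * y) - p * q = t * y * (s * x - p) + p * (t * y - q) by ring]
    exact add_mem (Ideal.mul_mem_left _ _ h) (Ideal.mul_mem_left _ _ h')
  add_mem' := by
    rintro x y ⟨s, hs, hs', p, hp, h⟩ ⟨t, ht, ht', q, hq, h'⟩
    refine ⟨s * t, mul_mem hs ht, hs'.mul ht', t * p + s * q,
      add_mem (mul_mem ht hp) (mul_mem hs hq), ?_⟩
    rw [show s * t * (x + y) - (t * p + s * q) = t * (s * x - p) + s * (t * y - q) by ring]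
    exact add_mem (Ideal.mul_mem_left _ _ h) (Ideal.mul_mem_left _ _ h')
  algebraMap_mem' c := ⟨1, one_mem _, IsNzd.one I, _, P.algebraMap_mem c, by simp⟩

lemma le_fracAlg (P : Subalgebra k (DPoly k n)) (I : Ideal (DPoly k n)) : P ≤ fracAlg P I :=
  fun p hp => ⟨1, one_mem _, IsNzd.one I, p, hp, by simp⟩

lemma fracAlg_mono {P Q : Subalgebra k (DPoly k n)} (h : P ≤ Q) (I : Ideal (DPoly k n)) :
    fracAlg P I ≤ fracAlg Q I :=
  fun _ ⟨s, hs, hs', p, hp, hx⟩ => ⟨s, h hs, hs', p, h hp, hx⟩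

lemma mem_fracAlg_of_mem_ideal (P : Subalgebra k (DPoly k n)) {I : Ideal (DPoly k n)}
    {x : DPoly k n} (hx : x ∈ I) : x ∈ fracAlg P I :=
  ⟨1, one_mem _, IsNzd.one I, 0, zero_mem _, by simpa using hx⟩

lemma mem_fracAlg_of_mul_mem {P : Subalgebra k (DPoly k n)} {I : Ideal (DPoly k n)}
    {q x : DPoly k n} (hq : q ∈ P) (hq' : IsNzd I q) (h : q * x ∈ fracAlg P I) :
    x ∈ fracAlg P I := by
  obtain ⟨s, hs, hs', p, hp, hx⟩ := h
  exact ⟨s * q, mul_mem hs hq, hs'.mul hq', p, hp, by rwa [mul_assoc]⟩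

/-- Clearing denominators in the coefficients of a polynomial in `u`. -/
lemma exists_clear_denominators {I : Ideal (DPoly k n)} {u : Der n} {S₀ S : Set (Der n)}
    (hu : u ∉ S₀)
    (hS : ∀ w ∈ S, w ≠ u → (X w : DPoly k n) ∈ fracAlg (supported k S₀) I) {c : DPoly k n}
    (hc : c ∈ supported k S) :
    ∃ s ∈ supported k S₀, IsNzd I s ∧ ∃ p ∈ supported k (insert u S₀),
      s * c - p ∈ I ∧ s * pderiv u c - pderiv u p ∈ I := by
  have hfree : ∀ s ∈ supported k S₀, pderiv u s = 0 := fun s hs =>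
    pderiv_eq_zero_of_notMem_vars fun h => hu (mem_supported.1 hs h)
  have hle : supported k S₀ ≤ supported k (insert u S₀) := supported_mono (Set.subset_insert u S₀)
  -- Congruence modulo I need not survive ∂/∂u, so the congruence of the partial derivatives is
  -- carried through the induction as a second statement.
  refine supported_induction (p := fun c => ∃ s ∈ supported k S₀, IsNzd I s ∧
    ∃ p ∈ supported k (insert u S₀), s * c - p ∈ I ∧ s * pderiv u c - pderiv u p ∈ I)
    ?_ ?_ ?_ ?_ hc
  · intro a
    exact ⟨1, one_mem _, IsNzd.one I, C a, C_mem_subalgebra _ a, by simp, by simp⟩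
  · intro w hw
    by_cases h : w = u
    · subst h
      exact ⟨1, one_mem _, IsNzd.one I, X w, X_mem_supported.2 (by simp), by simp, by simp⟩
    · obtain ⟨s, hs, hs', p, hp, hx⟩ := hS w hw h
      refine ⟨s, hs, hs', p, hle hp, hx, ?_⟩
      rw [hfree p hp, pderiv_X_of_ne h]; simp
  · rintro f _ g _ ⟨s, hs, hs', p, hp, h1, h2⟩ ⟨t, ht, ht', q, hq, h3, h4⟩
    refine ⟨s * t, mul_mem hs ht, hs'.mul ht', t * p + s * q,
      add_mem (mul_mem (hle ht) hp) (mul_mem (hle hs) hq), ?_, ?_⟩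
    · rw [show s * t * (f + g) - (t * p + s * q) = t * (s * f - p) + s * (t * g - q) by ring]
      exact add_mem (Ideal.mul_mem_left _ _ h1) (Ideal.mul_mem_left _ _ h3)
    · rw [map_add, map_add, pderiv_mul, pderiv_mul, hfree s hs, hfree t ht,
        show s * t * (pderiv u f + pderiv u g) -
          (0 * p + t * pderiv u p + (0 * q + s * pderiv u q)) =
          t * (s * pderiv u f - pderiv u p) + s * (t * pderiv u g - pderiv u q) by ring]
      exact add_mem (Ideal.mul_mem_left _ _ h2) (Ideal.mul_mem_left _ _ h4)
  · rintro f _ g _ ⟨s, hs, hs', p, hp, h1, h2⟩ ⟨t, ht, ht', q, hq, h3, h4⟩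
    refine ⟨s * t, mul_mem hs ht, hs'.mul ht', p * q, mul_mem hp hq, ?_, ?_⟩
    · rw [show s * t * (f * g) - p * q = t * g * (s * f - p) + p * (t * g - q) by ring]
      exact add_mem (Ideal.mul_mem_left _ _ h1) (Ideal.mul_mem_left _ _ h3)
    · rw [pderiv_mul, pderiv_mul,
        show s * t * (pderiv u f * g + f * pderiv u g) - (pderiv u p * q + p * pderiv u q) =
          t * g * (s * pderiv u f - pderiv u p) + pderiv u p * (t * g - q) +
          (t * pderiv u g * (s * f - p) + p * (t * pderiv u g - pderiv u q)) by ring]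
      exact add_mem (add_mem (Ideal.mul_mem_left _ _ h2) (Ideal.mul_mem_left _ _ h3))
        (add_mem (Ideal.mul_mem_left _ _ h1) (Ideal.mul_mem_left _ _ h4))

end fractions

/-! ### Orders of fractions and truncation of remainders -/

section orders

variable {k : Type*} [Field k] [Differential k] {n : ℕ}

/-- The derivatives of order at most `e y` for `y ∈ V` and at most `m z + N` for `z ∉ V`. -/
def orderSet (V : Finset (Fin n)) (e m : Fin n → ℕ) (N : ℕ) : Set (Der n) :=
  {w | (w.var ∈ V → w.ord ≤ e w.var) ∧ (w.var ∉ V → w.ord ≤ m w.var + N)}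

lemma orderSet_mono (V : Finset (Fin n)) (e m : Fin n → ℕ) {N N' : ℕ} (h : N ≤ N') :
    orderSet V e m N ⊆ orderSet V e m N' :=
  fun _ hw => ⟨hw.1, fun hv => (hw.2 hv).trans (Nat.add_le_add_left h _)⟩

variable [LinearOrder (Der n)]

/-- The number of derivatives `y^(j)` with `y ∈ V` and `e y < j ≤ m y` that are at most `v`. -/
def derCount (V : Finset (Fin n)) (e m : Fin n → ℕ) (v : Der n) : ℕ :=
  ∑ y ∈ V, ((Finset.Ioc (e y) (m y)).filter fun j => (⟨y, j⟩ : Der n) ≤ v).card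

lemma derCount_mono (V : Finset (Fin n)) (e m : Fin n → ℕ) {v w : Der n} (h : v ≤ w) :
    derCount V e m v ≤ derCount V e m w :=
  Finset.sum_le_sum fun _ _ => Finset.card_le_card
    (Finset.monotone_filter_right _ fun _ _ hj => hj.trans h)

lemma derCount_le (V : Finset (Fin n)) (e m : Fin n → ℕ) (v : Der n) :
    derCount V e m v ≤ ∑ y ∈ V, (m y - e y) :=
  Finset.sum_le_sum fun _ _ => (Finset.card_filter_le _ _).trans (Nat.card_Ioc _ _).le

lemma derCount_succ_le (hR : IsRanking n) {V : Finset (Fin n)} {e m : Fin n → ℕ} {v : Der n}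
    (hv : v.var ∈ V) (h1 : e v.var ≤ v.ord) (h2 : v.ord + 1 ≤ m v.var) :
    derCount V e m v + 1 ≤ derCount V e m (v.shift 1) := by
  refine Finset.sum_lt_sum (fun y _ => Finset.card_le_card
    (Finset.monotone_filter_right _ fun _ _ hj => hj.trans (hR.le_shift v 1))) ⟨v.var, hv, ?_⟩
  refine Finset.card_lt_card ((Finset.ssubset_iff_of_subset
    (Finset.monotone_filter_right _ fun _ _ hj => hj.trans (hR.le_shift v 1))).2
    ⟨v.ord + 1, ?_, ?_⟩)
  · exact Finset.mem_filter.2 ⟨Finset.mem_Ioc.2 ⟨by omega, h2⟩, le_of_eq rfl⟩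
  · intro hmem
    exact absurd (Finset.mem_filter.1 hmem).2 (not_le.2 (hR.lt_shift v Nat.one_pos))

lemma exists_pred {V : Finset (Fin n)} {e m : Fin n → ℕ} (hR : IsRanking n) {v : Der n}
    (hv : v.var ∈ V) (h1 : e v.var < v.ord) (h2 : v.ord ≤ m v.var) :
    ∃ w : Der n, w.shift 1 = v ∧ w < v ∧ w.var ∈ V ∧ e w.var ≤ w.ord ∧ w.ord ≤ m w.var ∧
      derCount V e m w + 1 ≤ derCount V e m v := by
  have hs : (⟨v.var, v.ord - 1⟩ : Der n).shift 1 = v := by ext <;> simp; omega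
  refine ⟨⟨v.var, v.ord - 1⟩, hs, ?_, hv, ?_, ?_, ?_⟩
  · conv_rhs => rw [← hs]
    exact hR.lt_shift _ Nat.one_pos
  · show e v.var ≤ v.ord - 1; omega
  · show v.ord - 1 ≤ m v.var; omega
  · conv_rhs => rw [← hs]
    refine derCount_succ_le hR hv ?_ ?_
    · show e v.var ≤ v.ord - 1; omega
    · show v.ord - 1 + 1 ≤ m v.var; omega

/-- The equations `c y` express the derivatives of `y^(e y)`, `y ∈ V`, as fractions in derivatives of
bounded orders. -/
lemma X_shift_mem_fracAlg (hR : IsRanking n) {V : Finset (Fin n)} {e m : Fin n → ℕ}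
    (hem : ∀ y ∈ V, e y ≤ m y) {B : Set (Der n)} (hB : IsLowerSet B)
    {I : Ideal (DPoly k n)} (hI : IsDiffIdeal I) {c : Fin n → DPoly k n}
    (hc : ∀ y ∈ V, (⟨y, e y⟩ : Der n) ∈ B → c y ∈ I ∧
      c y ∈ supported k (Set.Iic (⟨y, e y⟩ : Der n) ∩ {w | w.ord ≤ m w.var}) ∧
      IsNzd I (pderiv (⟨y, e y⟩ : Der n) (c y)))
    (v : Der n) (hvB : v ∈ B) (hvV : v.var ∈ V) (hve : e v.var ≤ v.ord) (hvm : v.ord ≤ m v.var) :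
    (X (v.shift 1) : DPoly k n) ∈ fracAlg
      (supported k (Set.Iic (v.shift 1) ∩ orderSet V e m (derCount V e m v + 1))) I := by
  have := hR.wellFoundedLT
  induction v using WellFoundedLT.induction with
  | _ v ih =>
  set S := Set.Iic v ∩ orderSet V e m (derCount V e m v) with hS
  set S' := Set.Iic (v.shift 1) ∩ orderSet V e m (derCount V e m v + 1) with hS'
  have hSS' : S ⊆ S' := Set.inter_subset_inter (Set.Iic_subset_Iic.2 (hR.le_shift v 1))
    (orderSet_mono V e m (Nat.le_succ _))
  have hST : ∀ w ∈ S, (X w : DPoly k n) ∈ fracAlg (supported k S') I := fun w hw =>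
    le_fracAlg _ _ (X_mem_supported.2 (hSS' hw))
  have hshift : ∀ w ∈ S, w ≠ v → (X (w.shift 1) : DPoly k n) ∈ fracAlg (supported k S') I := by
    intro w hw hne
    have hlt : w < v := lt_of_le_of_ne hw.1 hne
    by_cases hwV : w.var ∈ V
    · rcases (hw.2.1 hwV).lt_or_eq with hwe | hwe
      · refine le_fracAlg _ _ (X_mem_supported.2 ⟨hR.shift_le_shift _ _ 1 hw.1, fun _ => hwe,
          fun h => absurd hwV h⟩)
      · refine fracAlg_mono (supported_mono ?_) I
          (ih w hlt (hB hlt.le hvB) hwV hwe.ge (hwe.le.trans (hem _ hwV)))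
        exact Set.inter_subset_inter (Set.Iic_subset_Iic.2 (hR.shift_le_shift _ _ 1 hw.1))
          (orderSet_mono V e m (Nat.succ_le_succ (derCount_mono V e m hlt.le)))
    · refine le_fracAlg _ _ (X_mem_supported.2 ⟨hR.shift_le_shift _ _ 1 hw.1,
        fun h => absurd h hwV, fun _ => ?_⟩)
      have := hw.2.2 hwV
      simp only [Der.shift_ord, Der.shift_var]; omega
  rcases hve.lt_or_eq with hve | hve
  -- Above order e: the predecessor w of v yields s X_v ≡ p, which is differentiated. This raises
  -- the other orders by one, matched by the increase of `derCount` from w to v.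
  · obtain ⟨w, rfl, hwv, hwV, hwe, hwm, hcnt⟩ := exists_pred hR hvV hve hvm
    obtain ⟨s, hs, hs', p, hp, hx⟩ := fracAlg_mono (supported_mono
      (Set.inter_subset_inter_right _ (orderSet_mono V e m hcnt))) I
      (ih w hwv (hB hwv.le hvB) hwV hwe hwm)
    rw [← hS] at hs hp
    have hvS : w.shift 1 ∉ S := fun h => absurd (h.2.1 hvV) (not_le.2 hve)
    have hshift' : ∀ x ∈ S, (X (x.shift 1) : DPoly k n) ∈ fracAlg (supported k S') I :=
      fun x hx => hshift x hx fun h => hvS (h ▸ hx)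
    have hXv : (X (w.shift 1) : DPoly k n) ∈ fracAlg (supported k S') I :=
      fracAlg_mono (supported_mono hSS') I ⟨s, hs, hs', p, hp, hx⟩
    have hδ := hI _ hx
    rw [delta_sub, delta_mul, delta_X] at hδ
    refine mem_fracAlg_of_mul_mem (supported_mono hSS' hs) hs' ?_
    have h1 := add_mem (mem_fracAlg_of_mem_ideal (supported k S') hδ)
      (sub_mem (delta_mem hST hshift' hp) (mul_mem hXv (delta_mem hST hshift' hs)))
    rwa [show s * X ((w.shift 1).shift 1) + X (w.shift 1) * delta s - delta p +
      (delta p - X (w.shift 1) * delta s) = s * X ((w.shift 1).shift 1) by ring] at h1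
  -- At order e: once the lower derivatives in c y are replaced by fractions and denominators are
  -- cleared, one has p ∈ I with ∂p/∂v a non-zero-divisor, and δp is linear in the next derivative
  -- with this coefficient.
  · have hv : (⟨v.var, e v.var⟩ : Der n) = v := by ext <;> simp [hve]
    obtain ⟨hcI, hcs, hcn⟩ := hc v.var hvV (hv ▸ hvB)
    rw [hv] at hcs hcn
    -- The replacing fractions use derivatives strictly below v, so that the denominators are
    -- constants for ∂/∂v.
    have hfrac : ∀ w ∈ Set.Iic v ∩ {w | w.ord ≤ m w.var}, w ≠ v → (X w : DPoly k n) ∈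
        fracAlg (supported k (Set.Iio v ∩ orderSet V e m (derCount V e m v))) I := by
      rintro w ⟨hwv, hwm⟩ hne
      have hlt : w < v := lt_of_le_of_ne hwv hne
      have hwm : w.ord ≤ m w.var := hwm
      by_cases hwV : w.var ∈ V
      · rcases le_or_gt w.ord (e w.var) with hwe | hwe
        · exact le_fracAlg _ _ (X_mem_supported.2 ⟨hlt, fun _ => hwe, fun h => absurd hwV h⟩)
        · obtain ⟨x, rfl, hxw, hxV, hxe, hxm, hcnt⟩ := exists_pred hR hwV hwe hwm
          refine fracAlg_mono (supported_mono ?_) I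
            (ih x (hxw.trans hlt) (hB (hxw.trans hlt).le hvB) hxV hxe hxm)
          exact Set.inter_subset_inter (Set.Iic_subset_Iio.2 hlt)
            (orderSet_mono V e m (hcnt.trans (derCount_mono V e m hlt.le)))
      · exact le_fracAlg _ _ (X_mem_supported.2 ⟨hlt, fun h => absurd h hwV,
          fun _ => hwm.trans (Nat.le_add_right _ _)⟩)
    obtain ⟨s, hs, hs', p, hp, h1, h2⟩ := exists_clear_denominators
      (fun h => lt_irrefl v h.1) hfrac hcs
    have hpS : p ∈ supported k S := by
      have hvS : v ∈ S := ⟨le_refl v, fun _ => hve.ge, fun h => absurd hvV h⟩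
      refine supported_mono (Set.insert_subset hvS ?_) hp
      exact Set.inter_subset_inter_left _ Set.Iio_subset_Iic_self
    have hpI : p ∈ I := mem_of_congr' h1 (Ideal.mul_mem_left _ _ hcI)
    refine mem_fracAlg_of_mul_mem (supported_mono hSS' (pderiv_mem_supported v hpS))
      (IsNzd.of_left h2 hs' hcn) ?_
    have h3 := sub_mem (mem_fracAlg_of_mem_ideal (supported k S') (hI _ hpI))
      (delta_sub_mem v hST hshift hpS)
    rwa [sub_sub_cancel] at h3

/-- Only the variables of f beyond the orders e have to be replaced. The lower set B marks where
equations are available: inside the for-loop only those with leader below the current one are. -/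
lemma mem_fracAlg_orderSet (hR : IsRanking n) {V : Finset (Fin n)} {e m : Fin n → ℕ}
    (hem : ∀ y ∈ V, e y ≤ m y) {B : Set (Der n)} (hB : IsLowerSet B)
    {I : Ideal (DPoly k n)} (hI : IsDiffIdeal I) {c : Fin n → DPoly k n}
    (hc : ∀ y ∈ V, (⟨y, e y⟩ : Der n) ∈ B → c y ∈ I ∧
      c y ∈ supported k (Set.Iic (⟨y, e y⟩ : Der n) ∩ {w | w.ord ≤ m w.var}) ∧
      IsNzd I (pderiv (⟨y, e y⟩ : Der n) (c y)))
    {f : DPoly k n} (hf : f ∈ supported k {w : Der n | w.ord ≤ m w.var})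
    (hfB : ∀ w ∈ f.vars, w.var ∈ V → w.ord ≤ e w.var ∨ w ∈ B) :
    f ∈ fracAlg (supported k (orderSet V e m (∑ y ∈ V, (m y - e y)))) I := by
  refine supported_le_subalgebra (S := (f.vars : Set (Der n))) (fun w hw => ?_)
    (mem_supported_vars f)
  have hwm : w.ord ≤ m w.var := mem_supported.1 hf hw
  by_cases hwV : w.var ∈ V
  · by_cases hwe : w.ord ≤ e w.var
    · exact le_fracAlg _ _ (X_mem_supported.2 ⟨fun _ => hwe, fun h => absurd hwV h⟩)
    · have hwB := (hfB w hw hwV).resolve_left hwe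
      obtain ⟨x, rfl, hxw, hxV, hxe, hxm, hcnt⟩ := exists_pred hR hwV (not_le.1 hwe) hwm
      refine fracAlg_mono (supported_mono ?_) I
        (X_shift_mem_fracAlg hR hem hB hI hc x (hB hxw.le hwB) hxV hxe hxm)
      exact Set.inter_subset_right.trans (orderSet_mono V e m (hcnt.trans (derCount_le V e m _)))
  · exact le_fracAlg _ _ (X_mem_supported.2 ⟨fun h => absurd h hwV,
      fun _ => hwm.trans (Nat.le_add_right _ _)⟩)

/-- The truncation of a differential remainder is a differential remainder. -/
theorem IsDiffRem.truncate [CharZero k] (hR : IsRanking n) {D : Finset (DPoly k n)}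
    (hD : Autoreduced D) {b : Fin n → ℕ} (hDb : ∀ d ∈ D, d ∈ supported k (boundedDers b))
    {S : Set (Der n)} (hSb : S ⊆ boundedDers b)
    (hSD : ∀ d ∈ D, ∀ u : Der n, ld d = u → ∀ j, 0 < j → u.shift j ∉ S)
    {f g : DPoly k n} (hf : f ∈ fracAlg (supported k S) (regIdeal D)) (hg : IsDiffRem D f g) :
    IsDiffRem D f (DiffAlg.truncate b g) := by
  obtain ⟨hred, h, hh, hfg⟩ := hg
  have hfg : h * f - g ∈ regIdeal D := hfg
  refine ⟨fun d hd => (hred d hd).truncate b, h, hh, ?_⟩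
  obtain ⟨s, hs, hs', p, hp, hsp⟩ := hf
  -- The relations s f ≡ p and h f ≡ g are combined so that f disappears; what remains is partially
  -- reduced.
  have hx : s * g - h * p ∈ regIdeal D := by
    rw [show s * g - h * p = h * (s * f - p) - s * (h * f - g) by ring]
    exact sub_mem (Ideal.mul_mem_left _ _ hsp) (Ideal.mul_mem_left _ _ hfg)
  have hpart : ∀ d ∈ D, PartReduced (s * g - h * p) d := by
    intro d hd u hu j hj hm
    have hSc : supported k S ≤ supported k ({u.shift j}ᶜ : Set (Der n)) :=
      supported_mono fun w hw h0 => hSD d hd u hu j hj (h0 ▸ hw)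
    have hmem : s * g - h * p ∈ supported k ({u.shift j}ᶜ : Set (Der n)) := by
      refine sub_mem (mul_mem (hSc hs) (mem_supported.2 fun w hw h0 => ?_)) (mul_mem ?_ (hSc hp))
      · exact (hred d hd).1 u hu j hj (h0 ▸ hw)
      · exact closure_initSep_mem_supported
          (fun d' hd' => hD.mem_supported_compl hR hd hu hj hd') hh
    exact mem_supported.1 hmem hm rfl
  obtain ⟨t, ht, htx⟩ := mem_sat_span_of_partReduced hR hD hx hpart
  have hbound : supported k S ≤ supported k (boundedDers b) := supported_mono hSb
  -- Truncation is an algebra homomorphism fixing D, so it maps the algebraic ideal (D) into itself;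
  -- it also fixes t, s, h and p, and only g is affected.
  have hτ : truncHom b (t * (s * g - h * p)) ∈ Ideal.span (D : Set (DPoly k n)) := by
    have hle : Ideal.span (D : Set (DPoly k n)) ≤
        (Ideal.span (D : Set (DPoly k n))).comap (truncHom b) := by
      refine Ideal.span_le.2 fun d hd => ?_
      show truncHom b d ∈ Ideal.span (D : Set (DPoly k n))
      rw [truncHom_of_mem (hDb d hd)]
      exact Ideal.subset_span hd
    exact hle htx
  rw [map_mul, map_sub, map_mul, map_mul, truncHom_of_mem (hbound hs), truncHom_of_mem (hbound hp),
    truncHom_of_mem (closure_initSep_mem_supported hDb ht),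
    truncHom_of_mem (closure_initSep_mem_supported hDb hh), ← truncate_eq_truncHom] at hτ
  have hy : s * DiffAlg.truncate b g - h * p ∈ regIdeal D :=
    ⟨t, ht, Ideal.span_le.2 (subset_diffIdeal _) hτ⟩
  refine hs' _ ?_
  rw [show s * (h * f - DiffAlg.truncate b g) = h * (s * f - p) -
    (s * DiffAlg.truncate b g - h * p) by ring]
  exact sub_mem (Ideal.mul_mem_left _ _ hsp) hy

end orders

/-! ### Maximal orders and triangular sets -/

section bounds

variable {k : Type*} [Field k] {n : ℕ}

lemma le_maxOrd {F : Finset (DPoly k n)} {f : DPoly k n} {w : Der n} (hf : f ∈ F)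
    (hw : w ∈ f.vars) : w.ord ≤ maxOrd w.var F := by
  have hw' : w ∈ f.vars.filter fun u => u.var = w.var := Finset.mem_filter.2 ⟨hw, rfl⟩
  exact Finset.le_sup_of_le (b := f) hf (Finset.le_sup (f := Der.ord) hw')

lemma maxOrd_le {F : Finset (DPoly k n)} {y : Fin n} {N : ℕ}
    (h : ∀ f ∈ F, ∀ w ∈ f.vars, w.var = y → w.ord ≤ N) : maxOrd y F ≤ N :=
  Finset.sup_le fun f hf => Finset.sup_le fun w hw =>
    h f hf w (Finset.mem_filter.1 hw).1 (Finset.mem_filter.1 hw).2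

lemma coeffOf_mul_sub {u : Der n} {h c d : DPoly k n}
    (hh : h ∈ supported k ({u}ᶜ : Set (Der n))) (t : ℕ) :
    coeffOf u t (h * c - d) = h * coeffOf u t c - coeffOf u t d := by
  rw [← coeff_theta, map_sub, map_mul, theta_of_mem hh, Polynomial.coeff_sub,
    Polynomial.coeff_C_mul, coeff_theta, coeff_theta]

variable [LinearOrder (Der n)]

lemma mem_ldSet {A : Finset (DPoly k n)} {u : Der n} : u ∈ ldSet A ↔ ∃ f ∈ A, ld f = u := by
  simp only [ldSet, Finset.mem_biUnion, Finset.mem_filter]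
  exact ⟨fun ⟨f, hf, _, h⟩ => ⟨f, hf, h⟩, fun ⟨f, hf, h⟩ => ⟨f, hf, (ld_eq_coe_iff.1 h).1, h⟩⟩

lemma mem_lvSet {A : Finset (DPoly k n)} {y : Fin n} :
    y ∈ lvSet A ↔ ∃ f ∈ A, ∃ u : Der n, ld f = u ∧ u.var = y := by
  simp only [lvSet, Finset.mem_image, mem_ldSet]
  exact ⟨fun ⟨u, ⟨f, hf, h⟩, hy⟩ => ⟨f, hf, u, h, hy⟩, fun ⟨f, hf, u, h, hy⟩ => ⟨u, ⟨f, hf, h⟩, hy⟩⟩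

/-- A set of non-constant polynomials with distinct leading variables. -/
structure Triangular (A : Finset (DPoly k n)) : Prop where
  not_isConst : ∀ f ∈ A, ¬ IsConst f
  eq_of_lv_eq : ∀ f ∈ A, ∀ g ∈ A, lv f = lv g → f = g

lemma Triangular.ldOrd_eq {A : Finset (DPoly k n)} (hA : Triangular A) {f : DPoly k n} {u : Der n}
    (hf : f ∈ A) (hu : ld f = u) : ldOrd u.var A = u.ord := by
  refine le_antisymm (Finset.sup_le fun w hw => ?_) (Finset.le_sup (f := Der.ord)
    (Finset.mem_filter.2 ⟨mem_ldSet.2 ⟨f, hf, hu⟩, rfl⟩))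
  obtain ⟨hw, hv⟩ := Finset.mem_filter.1 hw
  obtain ⟨g, hg, hgw⟩ := mem_ldSet.1 hw
  obtain rfl := hA.eq_of_lv_eq g hg f hf (by rw [lv_eq hgw, lv_eq hu, hv])
  rw [WithBot.coe_inj.1 (hgw.symm.trans hu)]

lemma Triangular.leader_eq {A : Finset (DPoly k n)} (hA : Triangular A) {f : DPoly k n} {u : Der n}
    (hf : f ∈ A) (hu : ld f = u) : (⟨u.var, ldOrd u.var A⟩ : Der n) = u := by
  rw [hA.ldOrd_eq hf hu]

lemma Triangular.exists_mem {A : Finset (DPoly k n)} (hA : Triangular A) {y : Fin n}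
    (hy : y ∈ lvSet A) : ∃ f ∈ A, ld f = (⟨y, ldOrd y A⟩ : Der n) := by
  obtain ⟨f, hf, u, hu, rfl⟩ := mem_lvSet.1 hy
  exact ⟨f, hf, by rw [hA.leader_eq hf hu, hu]⟩

lemma Triangular.ldOrd_le {A G : Finset (DPoly k n)} (hA : Triangular A) (hAG : A ⊆ G)
    {y : Fin n} (hy : y ∈ lvSet A) : ldOrd y A ≤ maxOrd y G := by
  obtain ⟨f, hf, hu⟩ := hA.exists_mem hy
  exact le_maxOrd (hAG hf) (ld_eq_coe_iff.1 hu).1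

lemma Autoreduced.triangular {A : Finset (DPoly k n)} (hA : Autoreduced A) : Triangular A := by
  refine ⟨hA.1, fun f hf g hg h => ?_⟩
  obtain ⟨u, hu⟩ := exists_ld (hA.1 f hf)
  obtain ⟨w, hw⟩ := exists_ld (hA.1 g hg)
  rw [lv_eq hu, lv_eq hw, WithBot.coe_inj] at h
  exact hA.eq_of_var_eq hf hg hu hw h

lemma orderSet_subset_boundedDers {A G : Finset (DPoly k n)} (hA : Triangular A) (hAG : A ⊆ G) :
    orderSet (lvSet A) (fun y => ldOrd y A) (fun y => maxOrd y G)
      (∑ y ∈ lvSet A, (maxOrd y G - ldOrd y A)) ⊆ boundedDers (orderBound A G) := by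
  intro w hw
  show w.ord ≤ orderBound A G w.var
  rw [orderBound]
  split_ifs with h
  · exact (hw.1 h).trans (hA.ldOrd_le hAG h)
  · exact hw.2 h

/-- The elements of a triangular set below `c` in rank have lower leaders in other variables. -/
lemma Triangular.lt_of_rk_lt {A : Finset (DPoly k n)} (hA : Triangular A) {p c : DPoly k n}
    {u w : Der n} (hp : p ∈ A) (hc : c ∈ A) (hu : ld c = u) (hw : ld p = w) (h : rk p < rk c) :
    w < u ∧ w.var ≠ u.var := by
  have hvar : w.var ≠ u.var := by
    intro hv
    obtain rfl := hA.eq_of_lv_eq p hp c hc (by rw [lv_eq hu, lv_eq hw, hv])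
    exact lt_irrefl _ h
  have hle : w ≤ u := (mem_supported_Iic_of_rk_le hu h.le).1 |>
    fun hm => mem_supported.1 hm (ld_eq_coe_iff.1 hw).1
  exact ⟨lt_of_le_of_ne hle fun he => hvar (by rw [he]), hvar⟩

/-- `A` vanishes modulo `I`, and the initials and separants of `A` are not zero divisors. -/
def RegularMod (I : Ideal (DPoly k n)) (A : Finset (DPoly k n)) : Prop :=
  ∀ c ∈ A, c ∈ I ∧ IsNzd I (initial c) ∧ IsNzd I (separant c)

lemma RegularMod.isNzd {I : Ideal (DPoly k n)} {A : Finset (DPoly k n)} (h : RegularMod I A)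
    {x : DPoly k n} (hx : x ∈ initSep A) : IsNzd I x := by
  obtain ⟨d, hd, rfl | rfl⟩ := mem_initSep.1 hx
  · exact (h d hd).2.1
  · exact (h d hd).2.2

end bounds

/-! ### The invariant of the for-loop -/

section loop

variable {k : Type*} [Field k] [Differential k] {n : ℕ} [LinearOrder (Der n)]

lemma RegularMod.regIdeal_le {I : Ideal (DPoly k n)} (hI : IsDiffIdeal I)
    {A : Finset (DPoly k n)} (h : RegularMod I A) : regIdeal A ≤ I :=
  DiffAlg.regIdeal_le hI (fun d hd => (h d hd).1) fun _ hx => h.isNzd hx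

/-- The invariant of the **for**-loop: `D` is the result for the elements of `P`. -/
structure LoopInv (b : Fin n → ℕ) (P D : Finset (DPoly k n)) : Prop where
  autoreduced : Autoreduced D
  bounded : ∀ d ∈ D, d ∈ supported k (boundedDers b)
  forth : ∀ c ∈ P, ∃ d ∈ D, rk d = rk c ∧ c ∈ regIdeal D ∧
    ∃ h ∈ Submonoid.closure (initSep D : Set (DPoly k n)),
      h * initial c - initial d ∈ regIdeal D ∧ h * separant c - separant d ∈ regIdeal D
  back : ∀ d ∈ D, ∃ c ∈ P, rk d = rk c
  regularMod : ∀ I : Ideal (DPoly k n), IsDiffIdeal I → RegularMod I P → RegularMod I D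

lemma LoopInv.empty (b : Fin n → ℕ) : LoopInv b (∅ : Finset (DPoly k n)) ∅ :=
  ⟨⟨by simp, by simp⟩, by simp, by simp, by simp, fun _ _ _ => by simp [RegularMod]⟩

/-- The initials and separants of D are non-zero-divisors by saturation, and those of P divide them
up to congruence. -/
lemma LoopInv.regularMod_regIdeal {b : Fin n → ℕ} {P D : Finset (DPoly k n)}
    (h : LoopInv b P D) : RegularMod (regIdeal D) P := by
  intro c hc
  obtain ⟨d, hd, -, hcD, x, hx, h1, h2⟩ := h.forth c hc
  exact ⟨hcD, IsNzd.of_right h1 (isNzd_sat (initial_mem_initSep hd)),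
    IsNzd.of_right h2 (isNzd_sat (separant_mem_initSep hd))⟩

lemma LoopInv.exists_ld {b : Fin n → ℕ} {P D : Finset (DPoly k n)} (h : LoopInv b P D)
    {d : DPoly k n} {u : Der n} (hd : d ∈ D) (hu : ld d = u) :
    ∃ c ∈ P, ld c = u ∧ rk d = rk c := by
  obtain ⟨c, hc, hr⟩ := h.back d hd
  exact ⟨c, hc, (ld_eq_of_rk_eq hu hr.symm).1, hr⟩

/-- Truncation of remainders of polynomials with the orders of `G`. -/
lemma LoopInv.isDiffRem_truncate [CharZero k] (hR : IsRanking n) {A G P D : Finset (DPoly k n)}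
    (hA : Triangular A) (hAG : A ⊆ G) (hPA : P ⊆ A) (h : LoopInv (orderBound A G) P D)
    {B : Set (Der n)} (hB : IsLowerSet B) (hBP : ∀ c ∈ A, ∀ u : Der n, ld c = u → u ∈ B → c ∈ P)
    {f g : DPoly k n} (hf : ∀ w ∈ f.vars, w.ord ≤ maxOrd w.var G)
    (hfB : ∀ w ∈ f.vars, w.var ∈ lvSet A → w.ord ≤ ldOrd w.var A ∨ w ∈ B)
    (hg : IsDiffRem D f g) : IsDiffRem D f (truncate (orderBound A G) g) := by
  have hex : ∀ y, ∃ c : DPoly k n, y ∈ lvSet A → c ∈ A ∧ ld c = (⟨y, ldOrd y A⟩ : Der n) := by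
    intro y
    by_cases hy : y ∈ lvSet A
    · obtain ⟨c, hc⟩ := hA.exists_mem hy
      exact ⟨c, fun _ => hc⟩
    · exact ⟨0, fun h => absurd h hy⟩
  choose c hc using hex
  refine IsDiffRem.truncate hR h.autoreduced h.bounded (orderSet_subset_boundedDers hA hAG) ?_
    (mem_fracAlg_orderSet hR (fun y hy => hA.ldOrd_le hAG hy) hB (regIdeal_isDiff D) (c := c) ?_
      (mem_supported.2 fun w hw => hf w hw) hfB) hg
  -- In the order set a leading variable is bounded by the order of its leader, which leaves no room
  -- for proper derivatives of leaders.
  · intro d hd u hu j hj hmem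
    obtain ⟨a, ha, hau, -⟩ := h.exists_ld hd hu
    have h1 := hmem.1 (mem_lvSet.2 ⟨a, hPA ha, u, hau, rfl⟩)
    have h2 := hA.ldOrd_eq (hPA ha) hau
    simp only [Der.shift_ord, Der.shift_var] at h1
    omega
  · intro y hy hyB
    obtain ⟨hcA, hcu⟩ := hc y hy
    have hreg := h.regularMod_regIdeal (c y) (hBP _ hcA _ hcu hyB)
    refine ⟨hreg.1, mem_supported.2 fun w hw => ⟨(ld_eq_coe_iff.1 hcu).2 w hw, ?_⟩, ?_⟩
    · exact le_maxOrd (hAG hcA) hw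
    · rw [← separant_eq hcu]; exact hreg.2.2

/-- Comparison of a polynomial with its remainder of rank at most its own. -/
lemma LoopInv.congr [CharZero k] (hR : IsRanking n) {b : Fin n → ℕ} {P D : Finset (DPoly k n)}
    (h : LoopInv b P D) {c d : DPoly k n} {u : Der n} (hu : ld c = u)
    (hP : ∀ p ∈ P, ∀ w : Der n, ld p = w → w < u ∧ w.var ≠ u.var)
    (hd : IsDiffRem D c d) (hle : rk d ≤ rk c) :
    ∃ x ∈ Submonoid.closure (initSep D : Set (DPoly k n)), x * c - d ∈ regIdeal D ∧
      x * pderiv u c - pderiv u d ∈ regIdeal D ∧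
      x * initial c - coeffOf u (c.degreeOf u) d ∈ regIdeal D := by
  obtain ⟨-, x, hx, hxc⟩ := hd
  have hDu : ∀ d ∈ D, ∀ w : Der n, ld d = w → w < u ∧ w.var ≠ u.var := by
    intro d hd w hw
    obtain ⟨p, hp, hpw, -⟩ := h.exists_ld hd hw
    exact hP p hp w hpw
  have hDIio : ∀ d ∈ D, d ∈ supported k (Set.Iio u) := by
    intro d hd
    obtain ⟨w, hw⟩ := DiffAlg.exists_ld (h.autoreduced.1 d hd)
    exact supported_mono (Set.Iic_subset_Iio.2 (hDu d hd w hw).1) (mem_supported_Iic hw)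
  have hxu := closure_initSep_mem_supported hDIio hx
  have hxfree : x ∈ supported k ({u}ᶜ : Set (Der n)) :=
    supported_mono (fun w hw => ne_of_lt hw) hxu
  have hmem : x * c - d ∈ supported k (Set.Iic u) :=
    sub_mem (mul_mem (supported_mono Set.Iio_subset_Iic_self hxu) (mem_supported_Iic hu))
      (mem_supported_Iic_of_rk_le hu hle).1
  -- The multiplier x is free of u, so it comes out of the derivative and of the coefficients of x c
  -- - d with respect to u.
  obtain ⟨h1, h2⟩ := pderiv_coeffOf_mem_regIdeal hR h.autoreduced hDu hxc hmem
  refine ⟨x, hx, hxc, ?_, ?_⟩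
  · rwa [map_sub, pderiv_mul, pderiv_eq_zero_of_mem_supported hxfree, zero_mul, zero_add] at h1
  · have := h2 (c.degreeOf u)
    rwa [coeffOf_mul_sub hxfree, ← initial_eq hu] at this

/-- With equal ranks, `LoopInv.congr` relates initial to initial and separant to separant, and
regularity passes both ways. The set stays autoreduced because d is reduced with respect to D and
its leader lies above all derivatives in D. -/
lemma LoopInv.cons [CharZero k] (hR : IsRanking n) {b : Fin n → ℕ} {P D : Finset (DPoly k n)}
    (h : LoopInv b P D) {c d : DPoly k n} {u : Der n} (hu : ld c = u)
    (hP : ∀ p ∈ P, ∀ w : Der n, ld p = w → w < u ∧ w.var ≠ u.var)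
    (hd : IsDiffRem D c d) (hrk : rk d = rk c) (hdb : d ∈ supported k (boundedDers b)) :
    LoopInv b (insert c P) (insert d D) := by
  obtain ⟨x, hx, h1, h2, h3⟩ := h.congr hR hu hP hd hrk.le
  obtain ⟨hdu, hdeg⟩ := ld_eq_of_rk_eq hu hrk
  rw [← separant_eq hu, ← separant_eq hdu] at h2
  rw [← hdeg, ← initial_eq hdu] at h3
  have hsub : D ⊆ insert d D := Finset.subset_insert d D
  have hmono := regIdeal_mono hsub
  have hcl : ∀ y ∈ Submonoid.closure (initSep D : Set (DPoly k n)),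
      y ∈ Submonoid.closure (initSep (insert d D) : Set (DPoly k n)) := fun y hy =>
    Submonoid.closure_mono (Finset.coe_subset.2 (initSep_mono hsub)) hy
  refine ⟨⟨?_, ?_⟩, ?_, ?_, ?_, ?_⟩
  · intro f hf
    rcases Finset.mem_insert.1 hf with rfl | hf
    · exact not_isConst_of_ld hdu
    · exact h.autoreduced.1 f hf
  · intro f hf g hg hne
    rcases Finset.mem_insert.1 hf with rfl | hfD <;> rcases Finset.mem_insert.1 hg with rfl | hgD
    · exact absurd rfl hne
    · exact hd.1 g hgD
    · obtain ⟨w, hw⟩ := DiffAlg.exists_ld (h.autoreduced.1 f hfD)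
      obtain ⟨p, hp, hpw, -⟩ := h.exists_ld hfD hw
      have hlt := (hP p hp w hpw).1
      refine ⟨fun v hv j hj hm => ?_, fun v hv => ?_⟩
      · obtain rfl := WithBot.coe_inj.1 (hv.symm.trans hdu)
        exact absurd ((ld_eq_coe_iff.1 hw).2 _ hm) (not_le.2 (hlt.trans (hR.lt_shift v hj)))
      · obtain rfl := WithBot.coe_inj.1 (hv.symm.trans hdu)
        rw [degreeOf_eq_zero_iff'.2 fun hm =>
          absurd ((ld_eq_coe_iff.1 hw).2 _ hm) (not_le.2 hlt)]
        exact degreeOf_pos_iff.2 (ld_eq_coe_iff.1 hv).1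
    · exact h.autoreduced.2 f hfD g hgD hne
  · intro f hf
    rcases Finset.mem_insert.1 hf with rfl | hf
    · exact hdb
    · exact h.bounded f hf
  · intro f hf
    rcases Finset.mem_insert.1 hf with rfl | hf
    · refine ⟨d, Finset.mem_insert_self d D, hrk, ?_, x, hcl x hx, hmono h3, hmono h2⟩
      exact isNzd_sat_of_mem_closure (hcl x hx) _ (mem_of_congr (hmono h1)
        (subset_regIdeal (Finset.mem_insert_self d D)))
    · obtain ⟨a, ha, hr, hfD, y, hy, h4, h5⟩ := h.forth f hf
      exact ⟨a, hsub ha, hr, hmono hfD, y, hcl y hy, hmono h4, hmono h5⟩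
  · intro f hf
    rcases Finset.mem_insert.1 hf with rfl | hf
    · exact ⟨c, Finset.mem_insert_self c P, hrk⟩
    · obtain ⟨a, ha, hr⟩ := h.back f hf
      exact ⟨a, Finset.mem_insert_of_mem ha, hr⟩
  · intro I hI hreg
    have hregD := h.regularMod I hI fun p hp => hreg p (Finset.mem_insert_of_mem hp)
    have hle := hregD.regIdeal_le hI
    have hxn : IsNzd I x := IsNzd.of_mem_closure (fun s hs => hregD.isNzd hs) hx
    obtain ⟨hcI, hci, hcs⟩ := hreg c (Finset.mem_insert_self c P)
    intro f hf
    rcases Finset.mem_insert.1 hf with rfl | hf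
    · exact ⟨mem_of_congr' (hle h1) (Ideal.mul_mem_left _ _ hcI),
        IsNzd.of_left (hle h3) hxn hci, IsNzd.of_left (hle h2) hxn hcs⟩
    · exact hregD f hf

/-- After a drop of rank the coefficient of d matching the initial of c is 0, so x times this
initial lies in I. Both factors are non-zero-divisors, hence 1 ∈ I; this justifies abandoning the
loop. -/
lemma LoopInv.eq_top [CharZero k] (hR : IsRanking n) {b : Fin n → ℕ} {P D : Finset (DPoly k n)}
    (h : LoopInv b P D) {c d : DPoly k n} {u : Der n} (hu : ld c = u)
    (hP : ∀ p ∈ P, ∀ w : Der n, ld p = w → w < u ∧ w.var ≠ u.var)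
    (hd : IsDiffRem D c d) (hlt : rk d < rk c) {I : Ideal (DPoly k n)} (hI : IsDiffIdeal I)
    (hreg : RegularMod I (insert c P)) : I = ⊤ := by
  obtain ⟨x, hx, -, -, h3⟩ := h.congr hR hu hP hd hlt.le
  have hregD := h.regularMod I hI fun p hp => hreg p (Finset.mem_insert_of_mem hp)
  have hxn : IsNzd I x := IsNzd.of_mem_closure (fun s hs => hregD.isNzd hs) hx
  obtain ⟨hdIic, hdeg⟩ := mem_supported_Iic_of_rk_le hu hlt.le
  have hpos := degreeOf_pos_iff.2 (ld_eq_coe_iff.1 hu).1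
  have hdeg' : d.degreeOf u < c.degreeOf u := by
    refine lt_of_le_of_ne hdeg fun heq => ?_
    have hdu : ld d = u := ld_eq_coe_iff.2
      ⟨degreeOf_pos_iff.1 (by omega), fun w hw => mem_supported.1 hdIic hw⟩
    exact hlt.ne (by rw [rk_eq hdu, rk_eq hu, heq])
  rw [coeffOf_eq_zero_of_lt hdeg', sub_zero] at h3
  have h4 := hxn _ (hregD.regIdeal_le hI h3)
  refine (Ideal.eq_top_iff_one I).2 ((hreg c (Finset.mem_insert_self c P)).2.1 1 ?_)
  rwa [mul_one]

end loop

/-! ### Execution of the for-loop -/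

section forLoop

variable {k : Type*} [Field k] [Differential k] {n : ℕ} [LinearOrder (Der n)]

/-- The situation of the **for**-loop when the elements of `P` have been treated and those of the
list `L` are left. -/
structure LoopState (A G P D : Finset (DPoly k n)) (L : List (DPoly k n)) : Prop where
  inv : LoopInv (orderBound A G) P D
  union : P ∪ L.toFinset = A
  sorted : L.Pairwise fun p q => rk p < rk q
  lt : ∀ p ∈ P, ∀ q ∈ L, rk p < rk q

lemma LoopState.lt_leader {A G P D : Finset (DPoly k n)} {C : DPoly k n} {L : List (DPoly k n)}
    (hA : Triangular A) (h : LoopState A G P D (C :: L)) {u : Der n} (hu : ld C = u) :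
    ∀ p ∈ P, ∀ w : Der n, ld p = w → w < u ∧ w.var ≠ u.var := fun p hp w hw =>
  hA.lt_of_rk_lt (by rw [← h.union]; exact Finset.mem_union_left _ hp)
    (by rw [← h.union]; simp) hu hw (h.lt p hp C (by simp))

lemma LoopState.head_mem {A G P D : Finset (DPoly k n)} {C : DPoly k n} {L : List (DPoly k n)}
    (h : LoopState A G P D (C :: L)) : C ∈ A := by rw [← h.union]; simp

variable [CharZero k]

/-- The lower set is taken as the derivatives below the leader u of C. Elements of A with leaders
there were treated before C, by the sorting, and the only other derivative C can contain is u
itself, whose order is not excessive. -/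
lemma LoopState.isDiffRem_truncate (hR : IsRanking n) {A G P D : Finset (DPoly k n)}
    {C E : DPoly k n} {L : List (DPoly k n)} (hA : Triangular A) (hAG : A ⊆ G)
    (h : LoopState A G P D (C :: L)) (hE : IsDiffRem D C E) :
    IsDiffRem D C (truncate (orderBound A G) E) := by
  have hCA := h.head_mem
  obtain ⟨u, hu⟩ := exists_ld (hA.not_isConst C hCA)
  refine h.inv.isDiffRem_truncate hR hA hAG (by rw [← h.union]; exact Finset.subset_union_left)
    (isLowerSet_Iio u) ?_ (fun w hw => le_maxOrd (hAG hCA) hw) ?_ hE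
  · intro c hc w hw hlt
    have hc' := hc
    rw [← h.union, Finset.mem_union, List.mem_toFinset, List.mem_cons] at hc
    rcases hc with hc | rfl | hc
    · exact hc
    · obtain rfl := WithBot.coe_inj.1 (hw.symm.trans hu)
      exact absurd hlt (lt_irrefl _)
    · have hrk := (List.pairwise_cons.1 h.sorted).1 c hc
      exact absurd (hA.lt_of_rk_lt hCA hc' hw hu hrk).1 (not_lt.2 (le_of_lt hlt))
  · intro w hw _
    rcases ((ld_eq_coe_iff.1 hu).2 w hw).lt_or_eq with hlt | rfl
    · exact Or.inr hlt
    · exact Or.inl (hA.ldOrd_eq hCA hu).ge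

lemma LoopState.next (hR : IsRanking n) {A G P D : Finset (DPoly k n)}
    {C E : DPoly k n} {L : List (DPoly k n)} (hA : Triangular A) (hAG : A ⊆ G)
    (h : LoopState A G P D (C :: L)) (hE : IsDiffRem D C E)
    (hrk : rk (truncate (orderBound A G) E) = rk C) :
    LoopState A G (insert C P) (insert (truncate (orderBound A G) E) D) L := by
  obtain ⟨u, hu⟩ := exists_ld (hA.not_isConst C h.head_mem)
  refine ⟨h.inv.cons hR hu (h.lt_leader hA hu) (h.isDiffRem_truncate hR hA hAG hE) hrk
    (truncate_mem_bounded _ _), ?_, (List.pairwise_cons.1 h.sorted).2, ?_⟩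
  · rw [← h.union]; ext x; simp
  · intro p hp q hq
    rcases Finset.mem_insert.1 hp with rfl | hp
    · exact (List.pairwise_cons.1 h.sorted).1 q hq
    · exact h.lt p hp q (List.mem_cons_of_mem _ hq)

theorem ForLoop.spec (hR : IsRanking n) {A G D : Finset (DPoly k n)} {L : List (DPoly k n)}
    {r : Option (Finset (DPoly k n))} (hA : Triangular A) (hAG : A ⊆ G)
    (hloop : ForLoop (orderBound A G) D L r) :
    ∀ P, LoopState A G P D L →
      (∀ D', r = some D' → LoopInv (orderBound A G) A D') ∧
      (r = none → ∀ I : Ideal (DPoly k n), IsDiffIdeal I → RegularMod I A → I = ⊤) := by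
  induction hloop with
  | done D =>
    intro P h
    refine ⟨fun D' hD' => ?_, fun hn => by simp at hn⟩
    obtain rfl := Option.some.inj hD'
    have hP : P = A := by simpa using h.union
    rw [← hP]; rw [← hP] at h; exact h.inv
  | next D C E L r hrem hle hrk _ ih =>
    intro P h
    exact ih _ (h.next hR hA hAG hrem hrk)
  | fail D C E L hrem hle hrk =>
    intro P h
    refine ⟨fun D' hD' => by simp at hD', fun _ I hI hreg => ?_⟩
    obtain ⟨u, hu⟩ := exists_ld (hA.not_isConst C h.head_mem)
    refine h.inv.eq_top hR hu (h.lt_leader hA hu) (h.isDiffRem_truncate hR hA hAG hrem)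
      (lt_of_le_of_ne ((rk_truncate_le _ _).trans hle) hrk) hI fun c hc => hreg c ?_
    rcases Finset.mem_insert.1 hc with rfl | hc
    · exact h.head_mem
    · rw [← h.union]; exact Finset.mem_union_left _ hc

theorem exists_forLoop (hR : IsRanking n) {A G D P : Finset (DPoly k n)} {L : List (DPoly k n)}
    (hA : Triangular A) (hAG : A ⊆ G) (h : LoopState A G P D L) :
    ∃ r, ForLoop (orderBound A G) D L r := by
  induction L generalizing P D with
  | nil => exact ⟨_, ForLoop.done D⟩
  | cons C L ih =>
    obtain ⟨E, hE, hle⟩ := exists_diffRem hR h.inv.autoreduced C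
    by_cases hrk : rk (truncate (orderBound A G) E) = rk C
    · obtain ⟨r, hr⟩ := ih (h.next hR hA hAG hE hrk)
      exact ⟨r, ForLoop.next D C E L r hE hle hrk hr⟩
    · exact ⟨none, ForLoop.fail D C E L hE hle hrk⟩

end forLoop

/-! ### Sorting a triangular set by rank -/

section sorting

variable {k : Type*} [Field k] {n : ℕ} [LinearOrder (Der n)]

lemma lv_eq_of_rk_eq {f g : DPoly k n} (hf : ¬ IsConst f) (h : rk g = rk f) : lv g = lv f := by
  obtain ⟨u, hu⟩ := exists_ld hf
  rw [lv_eq hu, lv_eq (ld_eq_of_rk_eq hu h).1]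

lemma Triangular.subset {A B : Finset (DPoly k n)} (hB : Triangular B) (h : A ⊆ B) :
    Triangular A := ⟨fun f hf => hB.1 f (h hf), fun f hf g hg => hB.2 f (h hf) g (h hg)⟩

lemma Triangular.exists_sorted {A : Finset (DPoly k n)} (hA : Triangular A) :
    ∃ L : List (DPoly k n), (L.Pairwise fun p q => rk p < rk q) ∧ L.toFinset = A := by
  induction A using Finset.induction_on_max_value (rk (k := k) (n := n)) with
  | empty => exact ⟨[], List.Pairwise.nil, by simp⟩
  | insert a s has hmax ih =>
    obtain ⟨L, hL, hs⟩ := ih (hA.subset (Finset.subset_insert a s))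
    refine ⟨L ++ [a], List.pairwise_append.2 ⟨hL, List.pairwise_singleton _ _, ?_⟩, ?_⟩
    · intro p hp q hq
      obtain rfl := List.mem_singleton.1 hq
      have hps : p ∈ s := by rw [← hs]; exact List.mem_toFinset.2 hp
      refine lt_of_le_of_ne (hmax p hps) fun he => has ?_
      have hqA := Finset.mem_insert_self q s
      rw [← hA.eq_of_lv_eq p (Finset.mem_insert_of_mem hps) q hqA
        (lv_eq_of_rk_eq (hA.not_isConst q hqA) he)]
      exact hps
    · rw [List.toFinset_append, hs]; ext x; simp

end sorting

/-! ### Invariance of the ideals under reduction -/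

section decomposition

variable {k : Type*} [Field k] [Differential k] {n : ℕ} [LinearOrder (Der n)]

/-- Replacing a system by remainders does not change the radical differential ideal. -/
theorem sat_rad_eq_of_remainders {b : Fin n → ℕ} {A D G H F' H' : Finset (DPoly k n)}
    (hD : LoopInv b A D) (hAH : initSep A ⊆ H) {rG rH : DPoly k n → DPoly k n}
    (hG : ∀ g ∈ G, IsDiffRem D g (rG g)) (hH : ∀ h ∈ H, IsDiffRem D h (rH h))
    (hF₁ : ∀ x ∈ F', ∃ g ∈ G, x = rG g) (hF₂ : ∀ g ∈ G, rG g = 0 ∨ rG g ∈ F')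
    (hH₁ : ∀ x ∈ H', (∃ h ∈ H, x = rH h) ∨ x ∈ initSep D) (hH₂ : ∀ h ∈ H, rH h ∈ H')
    (hH₃ : initSep D ⊆ H') :
    sat (radDiffIdeal (↑(G ∪ A) : Set (DPoly k n))) H =
      sat (radDiffIdeal (↑(F' ∪ D) : Set (DPoly k n))) H' := by
  set X := sat (radDiffIdeal (↑(G ∪ A) : Set (DPoly k n))) (H : Set (DPoly k n)) with hX
  set Y := sat (radDiffIdeal (↑(F' ∪ D) : Set (DPoly k n))) (H' : Set (DPoly k n)) with hY
  have hXd : IsDiffIdeal X := sat_isDiff (radDiffIdeal_isDiff _) _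
  have hXr : X.IsRadical := sat_isRadical (radDiffIdeal_isRadical _) _
  have hYd : IsDiffIdeal Y := sat_isDiff (radDiffIdeal_isDiff _) _
  have hYr : Y.IsRadical := sat_isRadical (radDiffIdeal_isRadical _) _
  have hXmem : ∀ x ∈ G ∪ A, x ∈ X := fun x hx => le_sat _ _ (subset_radDiffIdeal _ hx)
  have hYmem : ∀ x ∈ F' ∪ D, x ∈ Y := fun x hx => le_sat _ _ (subset_radDiffIdeal _ hx)
  have hXA : RegularMod X A := fun c hc => ⟨hXmem c (Finset.mem_union_right _ hc),
    isNzd_sat (hAH (initial_mem_initSep hc)), isNzd_sat (hAH (separant_mem_initSep hc))⟩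
  have hXD := hD.regularMod X hXd hXA
  have hYD : RegularMod Y D := fun c hc => ⟨hYmem c (Finset.mem_union_right _ hc),
    isNzd_sat (hH₃ (initial_mem_initSep hc)), isNzd_sat (hH₃ (separant_mem_initSep hc))⟩
  -- Both ideals contain `regIdeal D`, so each congruence between a polynomial and its remainder can
  -- be read in X and in Y.
  have hDX : regIdeal D ≤ X := hXD.regIdeal_le hXd
  have hDY : regIdeal D ≤ Y := hYD.regIdeal_le hYd
  refine le_antisymm (sat_le (radDiffIdeal_le hYd hYr fun x hx => ?_) fun h hh => ?_)
    (sat_le (radDiffIdeal_le hXd hXr fun x hx => ?_) fun h hh => ?_)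
  · rcases Finset.mem_union.1 hx with hx | hx
    · obtain ⟨-, h, hh, hc⟩ := hG x hx
      refine IsNzd.of_mem_closure (fun s hs => hYD.isNzd hs) hh x (mem_of_congr (hDY hc) ?_)
      rcases hF₂ x hx with h0 | hF
      · rw [h0]; exact zero_mem _
      · exact hYmem _ (Finset.mem_union_left _ hF)
    · exact hDY (hD.regularMod_regIdeal x hx).1
  · obtain ⟨-, s, hs, hc⟩ := hH h hh
    exact IsNzd.of_right (hDY hc) (isNzd_sat (hH₂ h hh))
  · rcases Finset.mem_union.1 hx with hx | hx
    · obtain ⟨g, hg, rfl⟩ := hF₁ x hx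
      obtain ⟨-, h, hh, hc⟩ := hG g hg
      exact mem_of_congr' (hDX hc)
        (Ideal.mul_mem_left _ _ (hXmem g (Finset.mem_union_left _ hg)))
    · exact (hXD x hx).1
  · rcases hH₁ h hh with ⟨η, hη, rfl⟩ | hh
    · obtain ⟨-, s, hs, hc⟩ := hH η hη
      exact IsNzd.of_left (hDX hc) (IsNzd.of_mem_closure (fun s hs => hXD.isNzd hs) hs)
        (isNzd_sat hη)
    · exact hXD.isNzd hh

/-- For a regular system, the saturated differential ideal is radical. -/
theorem sat_rad_eq_sat_diffIdeal [CharZero k] (hR : IsRanking n) {D H : Finset (DPoly k n)}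
    (hD : Autoreduced D) (hDH : initSep D ⊆ H) :
    sat (radDiffIdeal (D : Set (DPoly k n))) H = sat (diffIdeal (D : Set (DPoly k n))) H := by
  refine le_antisymm ?_ (sat_mono (diffIdeal_le (radDiffIdeal_isDiff _) (subset_radDiffIdeal _))
    le_rfl)
  -- Saturating first by H_D only produces `regIdeal D`, which is radical by Lazard's lemma.
  rw [← sat_sat (I := diffIdeal (D : Set (DPoly k n))) (Finset.coe_subset.2 hDH)]
  exact sat_mono (radDiffIdeal_le (regIdeal_isDiff D) (regIdeal_isRadical hR hD)
    fun d hd => subset_regIdeal hd) le_rfl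

end decomposition

/-! ### The system produced by one reduction -/

section collect

variable {k : Type*} [Field k] [Differential k] {n : ℕ} [LinearOrder (Der n)]

lemma LoopInv.exists_of_mem {b : Fin n → ℕ} {A D : Finset (DPoly k n)} (h : LoopInv b A D)
    {c : DPoly k n} {u : Der n} (hc : c ∈ A) (hu : ld c = u) :
    ∃ d ∈ D, ld d = u ∧ d.degreeOf u = c.degreeOf u := by
  obtain ⟨d, hd, hr, -⟩ := h.forth c hc
  exact ⟨d, hd, ld_eq_of_rk_eq hu hr⟩

lemma LoopInv.lvSet_eq {b : Fin n → ℕ} {A D : Finset (DPoly k n)} (h : LoopInv b A D) :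
    lvSet D = lvSet A := by
  ext y
  rw [mem_lvSet, mem_lvSet]
  constructor
  · rintro ⟨d, hd, u, hu, hy⟩
    obtain ⟨c, hc, hcu, -⟩ := h.exists_ld hd hu
    exact ⟨c, hc, u, hcu, hy⟩
  · rintro ⟨c, hc, u, hu, hy⟩
    obtain ⟨d, hd, hdu, -⟩ := h.exists_of_mem hc hu
    exact ⟨d, hd, u, hdu, hy⟩

/-- The properties of the sets `D`, `F'`, `H'` computed from `A`, `G`, `H` and `f` by the reduction
step. -/
structure ReducedSystem (A G H : Finset (DPoly k n)) (f : DPoly k n)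
    (D F' H' : Finset (DPoly k n)) : Prop where
  inv : LoopInv (orderBound A (G ∪ A ∪ H)) A D
  reduced : ∀ x ∈ F', ∀ d ∈ D, Reduced x d
  partReduced : ∀ x ∈ F' ∪ D ∪ H', ∀ d ∈ D, PartReduced x d
  bounded : ∀ x ∈ F' ∪ D ∪ H', x ∈ supported k (boundedDers (orderBound A (G ∪ A ∪ H)))
  initSep_subset : initSep D ⊆ H'
  ideal_eq : sat (radDiffIdeal (↑(G ∪ A) : Set (DPoly k n))) (↑(H ∪ initSep {f})) =
    sat (radDiffIdeal (↑(F' ∪ D) : Set (DPoly k n))) H'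

/-- All of A has been treated, so the truncation result applies without restriction on leaders. The
elements of H_D are within the bounds already and are unchanged by truncation. -/
lemma reducedSystem_of_remainders [CharZero k] (hR : IsRanking n) {A G H D F' H' : Finset (DPoly k n)}
    {f : DPoly k n} (hA : Triangular A) (hfA : f ∈ A) (hAH : initSep A ⊆ H ∪ initSep {f})
    (hD : LoopInv (orderBound A (G ∪ A ∪ H)) A D) {remG remH : DPoly k n → DPoly k n}
    (hG : ∀ g ∈ G, IsDiffRem D g (remG g))
    (hH : ∀ h ∈ H ∪ initSep {f}, IsDiffRem D h (remH h))
    (hF' : F' = ((G.image remG).image (truncate (orderBound A (G ∪ A ∪ H)))).erase 0)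
    (hH' : H' = ((H ∪ initSep {f}).image remH ∪ initSep D).image
      (truncate (orderBound A (G ∪ A ∪ H)))) :
    ReducedSystem A G H f D F' H' := by
  set b := orderBound A (G ∪ A ∪ H) with hb
  have hAG : A ⊆ G ∪ A ∪ H := fun x hx => by simp [hx]
  have htrunc : ∀ g r, (∀ w ∈ g.vars, w.ord ≤ maxOrd w.var (G ∪ A ∪ H)) → IsDiffRem D g r →
      IsDiffRem D g (truncate b r) := fun g r hg hr =>
    hD.isDiffRem_truncate hR hA hAG (Finset.Subset.refl A) (isLowerSet_univ)
      (fun c hc _ _ _ => hc) hg (fun w _ _ => Or.inr trivial) hr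
  have hfs : ∀ g ∈ initSep {f}, g ∈ supported k (f.vars : Set (Der n)) := fun g hg =>
    initSep_mem_supported (fun d hd => by
      rw [Finset.mem_singleton.1 hd]; exact mem_supported_vars f) hg
  have hG' : ∀ g ∈ G, IsDiffRem D g (truncate b (remG g)) := fun g hg =>
    htrunc g _ (fun w hw => le_maxOrd (by simp [hg]) hw) (hG g hg)
  have hHt : ∀ h ∈ H ∪ initSep {f}, IsDiffRem D h (truncate b (remH h)) := by
    intro h hh
    refine htrunc h _ (fun w hw => ?_) (hH h hh)
    rcases Finset.mem_union.1 hh with hh | hh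
    · exact le_maxOrd (by simp [hh]) hw
    · exact le_maxOrd (hAG hfA) (mem_supported.1 (hfs h hh) hw)
  have hfix : ∀ x ∈ initSep D, truncate b x = x := fun x hx => by
    rw [truncate_eq_truncHom]; exact truncHom_of_mem (initSep_mem_supported hD.bounded hx)
  have hF₁ : ∀ x ∈ F', ∃ g ∈ G, x = truncate b (remG g) := by
    intro x hx
    rw [hF', Finset.mem_erase, Finset.image_image, Finset.mem_image] at hx
    obtain ⟨-, g, hg, rfl⟩ := hx
    exact ⟨g, hg, rfl⟩
  have hF₂ : ∀ g ∈ G, truncate b (remG g) = 0 ∨ truncate b (remG g) ∈ F' := by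
    intro g hg
    by_cases h0 : truncate b (remG g) = 0
    · exact Or.inl h0
    · refine Or.inr ?_
      rw [hF', Finset.mem_erase]
      exact ⟨h0, Finset.mem_image_of_mem _ (Finset.mem_image_of_mem _ hg)⟩
  have hH₁ : ∀ x ∈ H', (∃ h ∈ H ∪ initSep {f}, x = truncate b (remH h)) ∨ x ∈ initSep D := by
    intro x hx
    rw [hH', Finset.mem_image] at hx
    obtain ⟨y, hy, rfl⟩ := hx
    rcases Finset.mem_union.1 hy with hy | hy
    · obtain ⟨h, hh, rfl⟩ := Finset.mem_image.1 hy
      exact Or.inl ⟨h, hh, rfl⟩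
    · rw [hfix y hy]; exact Or.inr hy
  have hH₂ : ∀ h ∈ H ∪ initSep {f}, truncate b (remH h) ∈ H' := by
    intro h hh
    rw [hH']
    exact Finset.mem_image_of_mem _ (Finset.mem_union_left _ (Finset.mem_image_of_mem _ hh))
  have hH₃ : initSep D ⊆ H' := by
    intro x hx
    rw [hH', ← hfix x hx]
    exact Finset.mem_image_of_mem _ (Finset.mem_union_right _ hx)
  have hcases : ∀ x ∈ F' ∪ D ∪ H', (∃ y, x = truncate b y ∧ ∀ d ∈ D, Reduced x d) ∨ x ∈ D ∨
      x ∈ initSep D := by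
    intro x hx
    rcases Finset.mem_union.1 hx with hx | hx
    · rcases Finset.mem_union.1 hx with hx | hx
      · obtain ⟨g, hg, rfl⟩ := hF₁ x hx
        exact Or.inl ⟨_, rfl, (hG' g hg).1⟩
      · exact Or.inr (Or.inl hx)
    · rcases hH₁ x hx with ⟨h, hh, rfl⟩ | hx
      · exact Or.inl ⟨_, rfl, (hHt h hh).1⟩
      · exact Or.inr (Or.inr hx)
  refine ⟨hD, ?_, ?_, ?_, hH₃, ?_⟩
  · intro x hx
    obtain ⟨g, hg, rfl⟩ := hF₁ x hx
    exact (hG' g hg).1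
  · intro x hx d hd
    rcases hcases x hx with ⟨-, -, hred⟩ | hx | hx
    · exact (hred d hd).1
    · exact hD.autoreduced.partReduced hR hx hd
    · intro u hu j hj hm
      exact mem_supported.1 (initSep_mem_supported
        (fun d' hd' => hD.autoreduced.mem_supported_compl hR hd hu hj hd') hx) hm rfl
  · intro x hx
    rcases hcases x hx with ⟨y, rfl, -⟩ | hx | hx
    · exact truncate_mem_bounded b y
    · exact hD.bounded x hx
    · exact initSep_mem_supported hD.bounded hx
  · exact sat_rad_eq_of_remainders hD hAH (rG := fun g => truncate b (remG g))
      (rH := fun h => truncate b (remH h)) hG' hHt hF₁ hF₂ hH₁ hH₂ hH₃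

end collect

/-! ### The reduction step of the while-loop -/

section body

variable {k : Type*} [Field k] {n : ℕ} [LinearOrder (Der n)]

/-- The invariant of the triples treated by the algorithm. -/
structure TripleInv (t : Triple k n) : Prop where
  nonempty : t.F.Nonempty
  not_isConst : ∀ f ∈ t.F, ¬ IsConst f
  autoreduced : Autoreduced t.C
  reduced : ∀ f ∈ t.F, ∀ c ∈ t.C, Reduced f c
  partReduced : ∀ h ∈ t.H, ∀ c ∈ t.C, PartReduced h c
  initSep_subset : initSep t.C ⊆ t.H

/-- The set of equations to be reduced. -/
def bodyG (t : Triple k n) (f : DPoly k n) : Finset (DPoly k n) := (t.F ∪ conflict t.C f) \ {f}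

/-- The triangular set to be autoreduced. -/
def bodyC (t : Triple k n) (f : DPoly k n) : Finset (DPoly k n) := (t.C \ conflict t.C f) ∪ {f}

lemma mem_bodyC {t : Triple k n} {f x : DPoly k n} :
    x ∈ bodyC t f ↔ (x ∈ t.C ∧ lv x ≠ lv f) ∨ x = f := by
  simp only [bodyC, conflict, Finset.mem_union, Finset.mem_sdiff, Finset.mem_filter,
    Finset.mem_singleton]
  tauto

lemma mem_bodyG {t : Triple k n} {f x : DPoly k n} :
    x ∈ bodyG t f ↔ (x ∈ t.F ∨ x ∈ t.C ∧ lv x = lv f) ∧ x ≠ f := by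
  simp only [bodyG, conflict, Finset.mem_union, Finset.mem_sdiff, Finset.mem_filter,
    Finset.mem_singleton]

lemma self_mem_bodyC (t : Triple k n) (f : DPoly k n) : f ∈ bodyC t f := mem_bodyC.2 (Or.inr rfl)

lemma bodyG_union_bodyC {t : Triple k n} {f : DPoly k n} (hf : f ∈ t.F) :
    bodyG t f ∪ bodyC t f = t.F ∪ t.C := by
  ext x
  rw [Finset.mem_union, Finset.mem_union, mem_bodyG, mem_bodyC]
  by_cases hx : x = f
  · subst hx; simp [hf]
  · simp only [hx, ne_eq, not_false_eq_true, and_true, or_false]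
    tauto

lemma TripleInv.triangular_bodyC {t : Triple k n} (ht : TripleInv t) {f : DPoly k n}
    (hf : f ∈ t.F) : Triangular (bodyC t f) := by
  have hC := ht.autoreduced.triangular
  refine ⟨fun x hx => ?_, fun x hx y hy hxy => ?_⟩
  · rcases mem_bodyC.1 hx with hx | rfl
    · exact hC.not_isConst x hx.1
    · exact ht.not_isConst x hf
  · rcases mem_bodyC.1 hx with hx | rfl <;> rcases mem_bodyC.1 hy with hy | rfl
    · exact hC.eq_of_lv_eq x hx.1 y hy.1 hxy
    · exact absurd hxy hx.2
    · exact absurd hxy.symm hy.2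
    · rfl

lemma TripleInv.initSep_bodyC {t : Triple k n} (ht : TripleInv t) (f : DPoly k n) :
    initSep (bodyC t f) ⊆ t.H ∪ initSep {f} := by
  intro x hx
  obtain ⟨d, hd, hxd⟩ := mem_initSep.1 hx
  rcases mem_bodyC.1 hd with hd | rfl
  · exact Finset.mem_union_left _ (ht.initSep_subset (mem_initSep.2 ⟨d, hd.1, hxd⟩))
  · exact Finset.mem_union_right _ (mem_initSep.2 ⟨d, Finset.mem_singleton_self d, hxd⟩)

variable [Differential k] [CharZero k]

/-- The possible results of the reduction step in the body of the **while**-loop. -/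
inductive ReduceResult (t : Triple k n) (f : DPoly k n) :
    Finset (Triple k n) → Finset (Finset (DPoly k n) × Finset (DPoly k n)) → Prop
  | discard (h : sat (radDiffIdeal (↑(t.F ∪ t.C) : Set (DPoly k n))) (↑(t.H ∪ initSep {f})) = ⊤) :
      ReduceResult t f ∅ ∅
  | proceed (D F' H' : Finset (DPoly k n))
      (h : ReducedSystem (bodyC t f) (bodyG t f) t.H f D F' H')
      (hF : ∀ g ∈ F', ¬ IsConst g) (hne : F'.Nonempty) : ReduceResult t f {⟨F', D, H'⟩} ∅
  | output (D H' : Finset (DPoly k n))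
      (h : ReducedSystem (bodyC t f) (bodyG t f) t.H f D ∅ H') : ReduceResult t f ∅ {(D, H')}

/-- A discarded branch contributes the whole ring: through a drop of rank, a nonzero constant among
the equations, or 0 among the inequations. Leaving it out does not alter the intersection. -/
theorem Body.reduceResult (hR : IsRanking n) {t : Triple k n} (ht : TripleInv t) {f : DPoly k n}
    (hf : f ∈ t.F) {U' : Finset (Triple k n)}
    {T' : Finset (Finset (DPoly k n) × Finset (DPoly k n))} (hb : Body t f U' T') :
    ∃ U₁, ReduceResult t f U₁ T' ∧ U' = U₁ ∪ split t f := by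
  obtain ⟨L, r, U₁, hsort, hL, hloop, hcol, hU⟩ := hb
  refine ⟨U₁, ?_, hU⟩
  have hA := ht.triangular_bodyC hf
  have hAG : bodyC t f ⊆ bodyG t f ∪ bodyC t f ∪ t.H := fun x hx => by simp [hx]
  have hstate : LoopState (bodyC t f) (bodyG t f ∪ bodyC t f ∪ t.H) ∅ ∅ L :=
    ⟨LoopInv.empty _, by rw [hL]; simp [bodyC], hsort, by simp⟩
  obtain ⟨hsome, hnone⟩ := ForLoop.spec hR hA hAG hloop ∅ hstate
  cases hcol with
  | discard =>
    refine ReduceResult.discard (hnone rfl _ (sat_isDiff (radDiffIdeal_isDiff _) _) fun c hc => ?_)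
    have hAH := ht.initSep_bodyC f
    refine ⟨le_sat _ _ (subset_radDiffIdeal _ ?_), isNzd_sat (hAH (initial_mem_initSep hc)),
      isNzd_sat (hAH (separant_mem_initSep hc))⟩
    rw [← bodyG_union_bodyC hf]
    exact Finset.mem_union_right _ hc
  | reduce D remG remH hG hH F' H' hF' hH' =>
    have hD := hsome D rfl
    have hsys : ReducedSystem (bodyC t f) (bodyG t f) t.H f D F' H' :=
      reducedSystem_of_remainders hR hA (self_mem_bodyC t f) (ht.initSep_bodyC f) hD hG hH hF' hH'
    have htop : (∃ g ∈ F', IsConst g) ∨ 0 ∈ H' → sat (radDiffIdeal (↑(t.F ∪ t.C) : Set (DPoly k n)))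
        (↑(t.H ∪ initSep {f})) = ⊤ := by
      intro h
      rw [← bodyG_union_bodyC hf, hsys.ideal_eq]
      rcases h with ⟨g, hg, hc⟩ | h0
      · refine Ideal.eq_top_of_isUnit_mem _ (le_sat _ _ (subset_radDiffIdeal _ ?_))
          (isUnit_of_isConst hc ?_)
        · exact Finset.mem_union_left _ hg
        · rw [hF'] at hg; exact (Finset.mem_erase.1 hg).1
      · exact (Ideal.eq_top_iff_one _).2 (isNzd_sat h0 1 (by simp))
    by_cases hok : (∀ g ∈ F', ¬ IsConst g) ∧ 0 ∉ H'
    · by_cases hemp : F' = ∅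
      · rw [if_neg (by tauto), if_pos ⟨hok.1, hok.2, hemp⟩]
        subst hemp
        exact ReduceResult.output D H' hsys
      · rw [if_pos ⟨hok.1, hok.2, hemp⟩, if_neg (by tauto)]
        exact ReduceResult.proceed D F' H' hsys hok.1 (Finset.nonempty_iff_ne_empty.2 hemp)
    · rw [if_neg (by tauto), if_neg (by tauto)]
      refine ReduceResult.discard (htop ?_)
      by_contra hcon
      push Not at hcon
      exact hok hcon

/-- The body of the **while**-loop can always be carried out. -/
theorem exists_body (hR : IsRanking n) {t : Triple k n} (ht : TripleInv t) {f : DPoly k n}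
    (hf : f ∈ t.F) : ∃ U' T', Body t f U' T' := by
  have hA := ht.triangular_bodyC hf
  have hAG : bodyC t f ⊆ bodyG t f ∪ bodyC t f ∪ t.H := fun x hx => by simp [hx]
  obtain ⟨L, hsort, hL⟩ := hA.exists_sorted
  have hstate : LoopState (bodyC t f) (bodyG t f ∪ bodyC t f ∪ t.H) ∅ ∅ L :=
    ⟨LoopInv.empty _, by rw [hL]; simp, hsort, by simp⟩
  obtain ⟨r, hr⟩ := exists_forLoop hR hA hAG hstate
  have hsome := (ForLoop.spec hR hA hAG hr ∅ hstate).1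
  cases r with
  | none => exact ⟨_, _, L, none, _, hsort, hL, hr, Collect.discard, rfl⟩
  | some D =>
    choose rem hrem _ using fun g => exists_diffRem hR (hsome D rfl).autoreduced g
    exact ⟨_, _, L, some D, _, hsort, hL, hr, Collect.reduce D rem rem (fun g _ => hrem g)
      (fun h _ => hrem h) _ _ rfl rfl, rfl⟩

end body

/-! ### Splitting by the initial and the separant -/

section split

variable {k : Type*} [Field k] {n : ℕ} [LinearOrder (Der n)]

/-- If f has degree d + 1 in its leader, the separant has the coefficient (d + 1) i_f at degree d,
so being constant forces d = 0. This is why the branch of the initial may be skipped along with that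
of the separant. -/
lemma isConst_initial_of_isConst_separant [CharZero k] {f : DPoly k n} (hf : ¬ IsConst f)
    (h : IsConst (separant f)) : IsConst (initial f) := by
  obtain ⟨u, hu⟩ := exists_ld hf
  obtain ⟨c, hc⟩ := h
  have hpos := degreeOf_pos_iff.2 (ld_eq_coe_iff.1 hu).1
  obtain ⟨d, hd⟩ : ∃ d, f.degreeOf u = d + 1 := ⟨f.degreeOf u - 1, by omega⟩
  have h1 : (theta u (separant f)).coeff d = initial f * ((d : DPoly k n) + 1) := by
    rw [separant_eq hu, ← derivative_theta, Polynomial.coeff_derivative, coeff_theta, ← hd,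
      initial_eq hu]
  rw [hc, theta_of_mem (C_mem_subalgebra _ c), Polynomial.coeff_C] at h1
  split_ifs at h1 with h0
  · subst h0
    exact ⟨c, by simpa using h1.symm⟩
  · exact absurd h1.symm (mul_ne_zero (initial_ne_zero hf) (Nat.cast_add_one_ne_zero d))

lemma mem_split {t t' : Triple k n} {f : DPoly k n} (h : t' ∈ split t f) :
    ∃ x, (x = initial f ∨ x = separant f) ∧ ¬ IsConst x ∧ t' = ⟨insert x t.F, t.C, t.H⟩ := by
  unfold split at h
  split_ifs at h with h1 h2
  · simp at h
  · rcases Finset.mem_insert.1 h with rfl | h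
    · exact ⟨_, Or.inr rfl, h1, rfl⟩
    · simp at h
  · rcases Finset.mem_insert.1 h with rfl | h
    · exact ⟨_, Or.inr rfl, h1, rfl⟩
    · exact ⟨_, Or.inl rfl, h2, Finset.mem_singleton.1 h⟩

lemma mem_split_of_not_isConst [CharZero k] {t : Triple k n} {f x : DPoly k n}
    (hf : ¬ IsConst f) (hx : x = initial f ∨ x = separant f) (hc : ¬ IsConst x) :
    (⟨insert x t.F, t.C, t.H⟩ : Triple k n) ∈ split t f := by
  have hs : ¬ IsConst (separant f) := by
    rcases hx with rfl | rfl
    · exact fun h => hc (isConst_initial_of_isConst_separant hf h)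
    · exact hc
  unfold split
  rw [if_neg hs]
  rcases hx with rfl | rfl
  · rw [if_neg hc]; simp
  · simp

lemma TripleInv.of_split {t t' : Triple k n} (ht : TripleInv t) {f : DPoly k n} (hf : f ∈ t.F)
    (h : t' ∈ split t f) : TripleInv t' := by
  have hfc := ht.not_isConst f hf
  obtain ⟨x, hx, hc, rfl⟩ := mem_split h
  refine ⟨Finset.insert_nonempty _ _, fun g hg => ?_, ht.autoreduced, fun g hg c hcC => ?_,
    ht.partReduced, ht.initSep_subset⟩
  · rcases Finset.mem_insert.1 hg with rfl | hg
    · exact hc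
    · exact ht.not_isConst g hg
  · rcases Finset.mem_insert.1 hg with rfl | hg
    · rcases hx with rfl | rfl
      · exact (ht.reduced f hf c hcC).initial hfc
      · exact (ht.reduced f hf c hcC).separant hfc
    · exact ht.reduced g hg c hcC

variable [Differential k]

/-- The ideal described by a triple. -/
def tripleIdeal (t : Triple k n) : Ideal (DPoly k n) :=
  sat (radDiffIdeal (↑(t.F ∪ t.C) : Set (DPoly k n))) t.H

/-- `sat_rad_split` with E consisting of i_f and s_f; those which are constant are units, being
nonzero, and need no branch. -/
lemma tripleIdeal_eq_split [CharZero k] {t : Triple k n} {f : DPoly k n} (hf : ¬ IsConst f) :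
    tripleIdeal t =
      sat (radDiffIdeal (↑(t.F ∪ t.C) : Set (DPoly k n))) (↑(t.H ∪ initSep {f})) ⊓
        ⨅ t' ∈ split t f, tripleIdeal t' := by
  refine le_antisymm (le_inf (sat_mono le_rfl (by simp)) (le_iInf₂ fun t' ht' => ?_)) ?_
  · obtain ⟨x, -, -, rfl⟩ := mem_split ht'
    refine sat_mono (radDiffIdeal_mono ?_) le_rfl
    exact Finset.coe_subset.2 (Finset.union_subset_union_left (Finset.subset_insert _ _))
  · rintro y ⟨hy, hy'⟩
    rw [Finset.coe_union t.H] at hy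
    refine sat_rad_split hy fun e he => ?_
    obtain ⟨d, hd, hed⟩ := mem_initSep.1 (Finset.mem_coe.1 he)
    obtain rfl := Finset.mem_singleton.1 hd
    by_cases hc : IsConst e
    · refine Or.inl (isUnit_of_isConst hc ?_)
      rcases hed with rfl | rfl
      · exact initial_ne_zero hf
      · exact separant_ne_zero hf
    · refine Or.inr ?_
      have hle : (⨅ t' ∈ split t d, tripleIdeal t') ≤ tripleIdeal ⟨insert e t.F, t.C, t.H⟩ :=
        iInf₂_le _ (mem_split_of_not_isConst hf hed hc)
      refine sat_mono (radDiffIdeal_mono ?_) le_rfl (hle hy')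
      rw [Finset.insert_union, Finset.coe_insert]

lemma ReducedSystem.tripleInv {A G H D F' H' : Finset (DPoly k n)} {f : DPoly k n}
    (h : ReducedSystem A G H f D F' H') (hF : ∀ g ∈ F', ¬ IsConst g) (hne : F'.Nonempty) :
    TripleInv (⟨F', D, H'⟩ : Triple k n) :=
  ⟨hne, hF, h.inv.autoreduced, h.reduced,
    fun x hx => h.partReduced x (Finset.mem_union_right _ hx), h.initSep_subset⟩

lemma ReducedSystem.regularSystem {A G H D F' H' : Finset (DPoly k n)} {f : DPoly k n}
    (h : ReducedSystem A G H f D F' H') : RegularSystem D H' :=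
  ⟨h.inv.autoreduced, fun x hx => h.partReduced x (Finset.mem_union_right _ hx), h.initSep_subset⟩

lemma ReduceResult.ideal_eq [CharZero k] (hR : IsRanking n) {t : Triple k n} {f : DPoly k n} (hf : f ∈ t.F)
    {U₁ : Finset (Triple k n)} {T' : Finset (Finset (DPoly k n) × Finset (DPoly k n))}
    (h : ReduceResult t f U₁ T') :
    sat (radDiffIdeal (↑(t.F ∪ t.C) : Set (DPoly k n))) (↑(t.H ∪ initSep {f})) =
      (⨅ p ∈ T', sat (diffIdeal (p.1 : Set (DPoly k n))) p.2) ⊓ ⨅ t' ∈ U₁, tripleIdeal t' := by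
  cases h with
  | discard h => rw [h]; simp
  | proceed D F' H' h hF hne =>
    rw [← bodyG_union_bodyC hf, h.ideal_eq]
    simp [tripleIdeal]
  | output D H' h =>
    rw [← bodyG_union_bodyC hf, h.ideal_eq, Finset.empty_union,
      sat_rad_eq_sat_diffIdeal hR h.inv.autoreduced h.initSep_subset]
    simp

end split

/-! ### The well-founded order on triples -/

section measure

variable {k : Type*} [Field k] {n : ℕ} [LinearOrder (Der n)]

/-- The order and the degree of the leader of `c`. -/
def leaderKey (c : DPoly k n) : WithTop (ℕ ×ₗ ℕ) :=
  WithBot.recBotCoe ⊤ (fun u : Der n => ((toLex (u.ord, c.degreeOf u) : ℕ ×ₗ ℕ) :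
    WithTop (ℕ ×ₗ ℕ))) (ld c)

lemma leaderKey_eq {c : DPoly k n} {u : Der n} (h : ld c = u) :
    leaderKey c = ((toLex (u.ord, c.degreeOf u) : ℕ ×ₗ ℕ) : WithTop (ℕ ×ₗ ℕ)) := by
  rw [leaderKey, h]; rfl

/-- The order and the degree of the leader of the element of `C` with leading variable `y`. -/
def keyAt (C : Finset (DPoly k n)) (y : Fin n) : WithTop (ℕ ×ₗ ℕ) :=
  (C.filter fun c => lv c = (y : WithBot (Fin n))).inf leaderKey

/-- The least rank of the elements of `F`. -/
def minRk (F : Finset (DPoly k n)) : WithTop (WithBot (Der n ×ₗ ℕ)) :=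
  F.inf fun f => (rk f : WithTop (WithBot (Der n ×ₗ ℕ)))

/-- The order on triples that decreases in the algorithm. -/
def TripleLT (t t' : Triple k n) : Prop :=
  Prod.Lex (· < ·) (· < ·) (keyAt t.C, minRk t.F) (keyAt t'.C, minRk t'.F)

lemma tripleLT_wellFounded (hR : IsRanking n) : WellFounded (TripleLT (k := k) (n := n)) := by
  have := hR.wellFoundedLT
  have h1 : WellFounded ((· < ·) : (Fin n → WithTop (ℕ ×ₗ ℕ)) → _ → Prop) := wellFounded_lt
  have h2 : WellFounded ((· < ·) : WithTop (WithBot (Der n ×ₗ ℕ)) → _ → Prop) := wellFounded_lt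
  exact InvImage.wf (fun t : Triple k n => (keyAt t.C, minRk t.F)) (WellFounded.prod_lex h1 h2)

lemma tripleLT_of_mem_split {t t' : Triple k n} {f : DPoly k n}
    (hfc : ¬ IsConst f) (hmin : ∀ g ∈ t.F, rk f ≤ rk g) (h : t' ∈ split t f) :
    TripleLT t' t := by
  obtain ⟨x, hx, hc, rfl⟩ := mem_split h
  refine Prod.Lex.right _ ?_
  have hlt : rk x < rk f := by
    rcases hx with rfl | rfl
    · exact rk_initial_lt hfc
    · exact rk_separant_lt hfc
  have h1 : minRk (insert x t.F) ≤ (rk x : WithTop (WithBot (Der n ×ₗ ℕ))) :=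
    Finset.inf_le (Finset.mem_insert_self x t.F)
  have h2 : (rk f : WithTop (WithBot (Der n ×ₗ ℕ))) ≤ minRk t.F :=
    Finset.le_inf fun g hg => WithTop.coe_le_coe.2 (hmin g hg)
  exact lt_of_le_of_lt h1 (lt_of_lt_of_le (WithTop.coe_lt_coe.2 hlt) h2)

/-- As f is reduced with respect to C, its leader has smaller order, or equal order and smaller
degree, than that of the element it displaces. If there is none, the key falls from ⊤ to a finite
value. At the other variables no key grows. -/
lemma tripleLT_of_reducedSystem [Differential k] {t : Triple k n} (ht : TripleInv t)
    {f : DPoly k n} (hf : f ∈ t.F) {D F' H' : Finset (DPoly k n)}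
    (h : ReducedSystem (bodyC t f) (bodyG t f) t.H f D F' H') :
    TripleLT (⟨F', D, H'⟩ : Triple k n) t := by
  refine Prod.Lex.left _ _ ?_
  obtain ⟨u, hu⟩ := exists_ld (ht.not_isConst f hf)
  have hle : ∀ c ∈ bodyC t f, ∀ w : Der n, ld c = w → keyAt D w.var ≤ leaderKey c := by
    intro c hc w hw
    obtain ⟨d, hd, hdw, hdeg⟩ := h.inv.exists_of_mem hc hw
    have h1 : keyAt D w.var ≤ leaderKey d :=
      Finset.inf_le (Finset.mem_filter.2 ⟨hd, lv_eq hdw⟩)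
    rwa [leaderKey_eq hdw, hdeg, ← leaderKey_eq hw] at h1
  have hlt : keyAt D u.var < keyAt t.C u.var := by
    refine lt_of_le_of_lt (hle f (self_mem_bodyC t f) u hu) ?_
    rw [leaderKey_eq hu]
    refine (Finset.lt_inf_iff (WithTop.coe_lt_top _)).2 fun c hc => ?_
    obtain ⟨hcC, hcv⟩ := Finset.mem_filter.1 hc
    obtain ⟨w, hw⟩ := exists_ld (ht.autoreduced.1 c hcC)
    rw [lv_eq hw, WithBot.coe_inj] at hcv
    have hred := ht.reduced f hf c hcC
    rw [leaderKey_eq hw, WithTop.coe_lt_coe, Prod.Lex.toLex_lt_toLex]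
    rcases (hred.1.ord_le (ld_eq_coe_iff.1 hu).1 hw hcv.symm).lt_or_eq with hlt | heq
    · exact Or.inl hlt
    · obtain rfl : u = w := Der.ext hcv.symm heq
      exact Or.inr ⟨rfl, hred.2 u hw⟩
  refine Pi.lt_def.2 ⟨fun y => ?_, u.var, hlt⟩
  by_cases hy : y = u.var
  · rw [hy]; exact hlt.le
  · refine Finset.le_inf fun c hc => ?_
    obtain ⟨hcC, hcv⟩ := Finset.mem_filter.1 hc
    obtain ⟨w, hw⟩ := exists_ld (ht.autoreduced.1 c hcC)
    rw [lv_eq hw, WithBot.coe_inj] at hcv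
    subst hcv
    refine hle c (mem_bodyC.2 (Or.inl ⟨hcC, ?_⟩)) w hw
    rw [lv_eq hw, lv_eq hu, Ne, WithBot.coe_inj]
    exact hy

end measure

/-! ### Weighted orders and the factorial bound -/

section weights

variable {k : Type*} [Field k] {n : ℕ}

/-- The weighted total order, in which the variables of `V` count `max 1 (n - |V|)` times. -/
def weight (V : Finset (Fin n)) (S : Finset (DPoly k n)) : ℕ :=
  ∑ y : Fin n, (if y ∈ V then max 1 (n - V.card) else 1) * maxOrd y S

/-- The growth factor after `r` leading variables have been found. -/
def growth (n r : ℕ) : ℕ := ∏ i ∈ Finset.range r, max 1 (n - 1 - i)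

lemma growth_le (n r : ℕ) : growth n r ≤ (n - 1).factorial := by
  -- The strengthened inequality makes the induction work and covers r ≥ n - 1, where the further
  -- factors are 1.
  have h : growth n r * (n - 1 - r).factorial ≤ (n - 1).factorial := by
    induction r with
    | zero => simp [growth]
    | succ r ih =>
      refine le_trans ?_ ih
      rw [growth, Finset.prod_range_succ, mul_assoc]
      refine Nat.mul_le_mul_left _ ?_
      rcases Nat.eq_zero_or_pos (n - 1 - r) with h0 | h0
      · rw [h0, show n - 1 - (r + 1) = 0 by omega]; simp
      · obtain ⟨l, hl⟩ : ∃ l, n - 1 - r = l + 1 := ⟨n - 1 - r - 1, by omega⟩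
        rw [hl, show n - 1 - (r + 1) = l by omega, Nat.factorial_succ]
        simp
  exact (Nat.le_mul_of_pos_right _ (Nat.factorial_pos _)).trans h

lemma totalOrd_le_weight (V : Finset (Fin n)) (S : Finset (DPoly k n)) :
    totalOrd S ≤ weight V S := by
  refine Finset.sum_le_sum fun y _ => Nat.le_mul_of_pos_left _ ?_
  split_ifs <;> simp

lemma weight_mono {S S' : Finset (DPoly k n)} (V : Finset (Fin n))
    (h : ∀ y, maxOrd y S ≤ maxOrd y S') : weight V S ≤ weight V S' :=
  Finset.sum_le_sum fun y _ => Nat.mul_le_mul_left _ (h y)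

lemma weight_empty (S : Finset (DPoly k n)) : weight ∅ S = totalOrd S := by
  simp [weight, totalOrd]

/-- The new multiplicity max 1 (n - 1 - |V|) is at most this number times the old multiplicity,
which is at least 1, for every variable. -/
lemma weight_insert_le {V : Finset (Fin n)} {y : Fin n} (hy : y ∉ V) (S : Finset (DPoly k n)) :
    weight (insert y V) S ≤ max 1 (n - 1 - V.card) * weight V S := by
  rw [weight, weight, Finset.mul_sum, Finset.card_insert_of_notMem hy,
    show n - (V.card + 1) = n - 1 - V.card by omega]
  refine Finset.sum_le_sum fun z _ => ?_
  rw [← mul_assoc]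
  refine Nat.mul_le_mul_right _ ?_
  by_cases hz : z ∈ V
  · rw [if_pos (Finset.mem_insert_of_mem hz), if_pos hz]
    exact Nat.le_mul_of_pos_right _ (by simp)
  · rw [if_neg hz, mul_one]
    split_ifs
    · exact le_rfl
    · simp

/-- The weight does not increase when the orders of the variables in `V` drop to `e` and those of the
other variables grow by the drop in `y₀`. -/
lemma weight_le_weight {V : Finset (Fin n)} {y₀ : Fin n} (hy₀ : y₀ ∈ V)
    {S S' : Finset (DPoly k n)} {e₀ : ℕ} (he₀ : e₀ ≤ maxOrd y₀ S)
    (h₀ : maxOrd y₀ S' ≤ e₀) (hV : ∀ y ∈ V, y ≠ y₀ → maxOrd y S' ≤ maxOrd y S)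
    (hz : ∀ z, z ∉ V → maxOrd z S' ≤ maxOrd z S + (maxOrd y₀ S - e₀)) :
    weight V S' ≤ weight V S := by
  have hsplit : ∀ S : Finset (DPoly k n), weight V S =
      max 1 (n - V.card) * maxOrd y₀ S + (∑ y ∈ V.erase y₀, max 1 (n - V.card) * maxOrd y S +
        ∑ z ∈ Vᶜ, maxOrd z S) := by
    intro S
    rw [weight, ← Finset.sum_add_sum_compl V, ← Finset.add_sum_erase V _ hy₀, if_pos hy₀, add_assoc]
    congr 2
    · refine Finset.sum_congr rfl fun y hy => ?_
      rw [if_pos (Finset.mem_of_mem_erase hy)]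
    · refine Finset.sum_congr rfl fun y hy => ?_
      rw [if_neg (Finset.mem_compl.1 hy), one_mul]
  rw [hsplit, hsplit]
  have h1 : ∑ y ∈ V.erase y₀, max 1 (n - V.card) * maxOrd y S' ≤
      ∑ y ∈ V.erase y₀, max 1 (n - V.card) * maxOrd y S :=
    Finset.sum_le_sum fun y hy => Nat.mul_le_mul_left _
      (hV y (Finset.mem_of_mem_erase hy) (Finset.ne_of_mem_erase hy))
  have h2 : ∑ z ∈ Vᶜ, maxOrd z S' ≤
      ∑ z ∈ Vᶜ, maxOrd z S + (n - V.card) * (maxOrd y₀ S - e₀) := by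
    refine (Finset.sum_le_sum fun z hz' => hz z (Finset.mem_compl.1 hz')).trans ?_
    rw [Finset.sum_add_distrib, Finset.sum_const, Finset.card_compl, Fintype.card_fin, smul_eq_mul]
  have h3 : (n - V.card) * (maxOrd y₀ S - e₀) ≤ max 1 (n - V.card) * (maxOrd y₀ S - e₀) :=
    Nat.mul_le_mul_right _ (le_max_right _ _)
  -- The weighted drop in y₀ pays for the growth of all n - |V| variables outside V.
  have h4 : max 1 (n - V.card) * maxOrd y₀ S' + max 1 (n - V.card) * (maxOrd y₀ S - e₀) ≤
      max 1 (n - V.card) * maxOrd y₀ S := by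
    rw [← mul_add]
    exact Nat.mul_le_mul_left _ (by omega)
  omega

variable [LinearOrder (Der n)]

lemma lvSet_bodyC {t : Triple k n} {f : DPoly k n} {u : Der n}
    (hu : ld f = u) : lvSet (bodyC t f) = insert u.var (lvSet t.C) := by
  ext y
  rw [Finset.mem_insert, mem_lvSet, mem_lvSet]
  constructor
  · rintro ⟨c, hc, w, hw, rfl⟩
    rcases mem_bodyC.1 hc with hc | rfl
    · exact Or.inr ⟨c, hc.1, w, hw, rfl⟩
    · rw [WithBot.coe_inj.1 (hw.symm.trans hu)]; exact Or.inl rfl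
  · rintro (rfl | ⟨c, hc, w, hw, rfl⟩)
    · exact ⟨f, self_mem_bodyC t f, u, hu, rfl⟩
    · by_cases hv : w.var = u.var
      · exact ⟨f, self_mem_bodyC t f, u, hu, hv.symm⟩
      · exact ⟨c, mem_bodyC.2 (Or.inl ⟨hc, by rw [lv_eq hw, lv_eq hu, Ne, WithBot.coe_inj]; exact hv⟩),
          w, hw, rfl⟩

lemma TripleInv.maxOrd_le {t : Triple k n} (hR : IsRanking n) (ht : TripleInv t) {c : DPoly k n}
    {w : Der n} (hc : c ∈ t.C) (hw : ld c = w) :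
    maxOrd w.var (t.F ∪ t.C ∪ t.H) ≤ w.ord := by
  refine DiffAlg.maxOrd_le fun x hx v hv hvar => ?_
  have hpart : PartReduced x c := by
    rcases Finset.mem_union.1 hx with hx | hx
    · rcases Finset.mem_union.1 hx with hx | hx
      · exact (ht.reduced x hx c hc).1
      · exact ht.autoreduced.partReduced hR hx hc
    · exact ht.partReduced x hx c hc
  exact hpart.ord_le hv hw hvar

/-- With V already enlarged by the leading variable of f, reduction does not increase the weight;
the enlargement itself costs at most the next factor of `growth`. -/
lemma ReducedSystem.weight_le [Differential k] (hR : IsRanking n) {t : Triple k n}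
    (ht : TripleInv t) {f : DPoly k n} (hf : f ∈ t.F) {D F' H' : Finset (DPoly k n)}
    (h : ReducedSystem (bodyC t f) (bodyG t f) t.H f D F' H') {M : ℕ}
    (hM : weight (lvSet t.C) (t.F ∪ t.C ∪ t.H) ≤ growth n (lvSet t.C).card * M) :
    weight (lvSet D) (F' ∪ D ∪ H') ≤ growth n (lvSet D).card * M := by
  obtain ⟨u, hu⟩ := exists_ld (ht.not_isConst f hf)
  have hA := ht.triangular_bodyC hf
  have hGb : bodyG t f ∪ bodyC t f ∪ t.H = t.F ∪ t.C ∪ t.H := by rw [bodyG_union_bodyC hf]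
  have hAG : bodyC t f ⊆ t.F ∪ t.C ∪ t.H := by
    rw [← hGb]; exact fun x hx => by simp [hx]
  have hV := lvSet_bodyC (t := t) hu
  have hlv : lvSet D = lvSet (bodyC t f) := h.inv.lvSet_eq
  set S := t.F ∪ t.C ∪ t.H with hS
  have he₀ := hA.ldOrd_eq (self_mem_bodyC t f) hu
  have hlvle : ∀ y ∈ lvSet (bodyC t f), maxOrd y (F' ∪ D ∪ H') ≤ ldOrd y (bodyC t f) := by
    intro y hy
    obtain ⟨c, hc, hcu⟩ := hA.exists_mem hy
    obtain ⟨d, hd, hdu, -⟩ := h.inv.exists_of_mem hc hcu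
    refine DiffAlg.maxOrd_le fun x hx w hw hwy => ?_
    exact (h.partReduced x hx d hd).ord_le hw hdu hwy
  -- For the other leading variables the orders in the triple do not exceed that of the leader
  -- (`TripleInv.maxOrd_le`), so their terms vanish.
  have hsum : ∑ y ∈ lvSet (bodyC t f), (maxOrd y S - ldOrd y (bodyC t f)) =
      maxOrd u.var S - u.ord := by
    rw [Finset.sum_eq_single u.var, he₀]
    · intro y hy hne
      rw [hV] at hy
      obtain ⟨c, hc, w, hw, rfl⟩ := mem_lvSet.1 ((Finset.mem_insert.1 hy).resolve_left hne)
      have hcA : c ∈ bodyC t f := mem_bodyC.2 (Or.inl ⟨hc, by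
        rw [lv_eq hw, lv_eq hu, Ne, WithBot.coe_inj]; exact hne⟩)
      rw [hA.ldOrd_eq hcA hw]
      exact Nat.sub_eq_zero_of_le (ht.maxOrd_le hR hc hw)
    · intro hnot
      exact absurd (by rw [hV]; exact Finset.mem_insert_self _ _) hnot
  have hstep : weight (lvSet (bodyC t f)) (F' ∪ D ∪ H') ≤ weight (lvSet (bodyC t f)) S := by
    have huV : u.var ∈ lvSet (bodyC t f) := by rw [hV]; exact Finset.mem_insert_self _ _
    refine weight_le_weight huV (e₀ := u.ord) ?_ ?_ (fun y hy _ => ?_) fun z hz => ?_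
    · rw [← he₀]; exact hA.ldOrd_le hAG huV
    · rw [← he₀]; exact hlvle _ huV
    · exact (hlvle y hy).trans (hA.ldOrd_le hAG hy)
    · refine DiffAlg.maxOrd_le fun x hx w hw hwz => ?_
      have hb : w.ord ≤ orderBound (bodyC t f) (bodyG t f ∪ bodyC t f ∪ t.H) w.var :=
        mem_supported.1 (h.bounded x hx) hw
      rwa [hGb, hwz, orderBound, if_neg hz, hsum] at hb
  rw [hlv]
  refine hstep.trans ?_
  rw [hV]
  by_cases hmem : u.var ∈ lvSet t.C
  · rwa [Finset.insert_eq_of_mem hmem]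
  · refine (weight_insert_le hmem S).trans ?_
    rw [Finset.card_insert_of_notMem hmem, growth, Finset.prod_range_succ, ← growth,
      mul_comm (growth n _), mul_assoc]
    exact Nat.mul_le_mul_left _ hM

lemma weight_split_le {t t' : Triple k n} {f : DPoly k n} (hf : f ∈ t.F) (h : t' ∈ split t f) :
    t'.C = t.C ∧ weight (lvSet t.C) (t'.F ∪ t'.C ∪ t'.H) ≤ weight (lvSet t.C) (t.F ∪ t.C ∪ t.H) := by
  obtain ⟨x, hx, -, rfl⟩ := mem_split h
  refine ⟨rfl, weight_mono _ fun y => DiffAlg.maxOrd_le fun g hg w hw hwy => ?_⟩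
  subst hwy
  have hxs : x ∈ supported k (f.vars : Set (Der n)) := by
    rcases hx with rfl | rfl
    · exact initial_mem_supported (mem_supported_vars f)
    · exact separant_mem_supported (mem_supported_vars f)
  simp only [Finset.mem_union, Finset.mem_insert] at hg
  rcases hg with ((rfl | hg) | hg) | hg
  · exact le_maxOrd (by simp [hf]) (mem_supported.1 hxs hw)
  · exact le_maxOrd (by simp [hg]) hw
  · exact le_maxOrd (by simp [hg]) hw
  · exact le_maxOrd (by simp [hg]) hw

end weights

/-! ### Runs of the algorithm -/

section run

variable {k : Type*} [Field k] {n : ℕ}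

lemma totalOrd_le_of_weight_le {V : Finset (Fin n)} {S : Finset (DPoly k n)} {M : ℕ}
    (h : weight V S ≤ growth n V.card * M) : totalOrd S ≤ (n - 1).factorial * M :=
  (totalOrd_le_weight V S).trans (h.trans (Nat.mul_le_mul_right _ (growth_le n _)))

variable [LinearOrder (Der n)]

/-- The invariant of a triple together with the bound on its weighted total order. -/
structure BoundedTriple (M : ℕ) (t : Triple k n) : Prop where
  inv : TripleInv t
  weight_le : weight (lvSet t.C) (t.F ∪ t.C ∪ t.H) ≤ growth n (lvSet t.C).card * M

lemma mem_split_spec {M : ℕ} {t t' : Triple k n} (ht : BoundedTriple M t) {f : DPoly k n}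
    (hf : f ∈ t.F) (hmin : ∀ g ∈ t.F, rk f ≤ rk g) (h : t' ∈ split t f) :
    BoundedTriple M t' ∧ TripleLT t' t := by
  obtain ⟨hC, hw⟩ := weight_split_le hf h
  refine ⟨⟨ht.inv.of_split hf h, ?_⟩, tripleLT_of_mem_split (ht.inv.not_isConst f hf) hmin h⟩
  rw [hC] at hw ⊢
  exact hw.trans ht.weight_le

variable [Differential k]

lemma ReduceResult.mem_left (hR : IsRanking n) {M : ℕ} {t t' : Triple k n}
    (ht : BoundedTriple M t) {f : DPoly k n} (hf : f ∈ t.F) {U₁ : Finset (Triple k n)}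
    {T' : Finset (Finset (DPoly k n) × Finset (DPoly k n))} (h : ReduceResult t f U₁ T')
    (ht' : t' ∈ U₁) : BoundedTriple M t' ∧ TripleLT t' t := by
  cases h with
  | discard h => simp at ht'
  | proceed D F' H' h hF hne =>
    obtain rfl := Finset.mem_singleton.1 ht'
    exact ⟨⟨h.tripleInv hF hne, h.weight_le hR ht.inv hf ht.weight_le⟩,
      tripleLT_of_reducedSystem ht.inv hf h⟩
  | output D H' h => simp at ht'

lemma ReduceResult.mem_right (hR : IsRanking n) {M : ℕ} {t : Triple k n}
    (ht : BoundedTriple M t) {f : DPoly k n} (hf : f ∈ t.F) {U₁ : Finset (Triple k n)}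
    {T' : Finset (Finset (DPoly k n) × Finset (DPoly k n))} (h : ReduceResult t f U₁ T')
    {p : Finset (DPoly k n) × Finset (DPoly k n)} (hp : p ∈ T') :
    RegularSystem p.1 p.2 ∧ totalOrd (p.1 ∪ p.2) ≤ (n - 1).factorial * M := by
  cases h with
  | discard h => simp at hp
  | proceed D F' H' h hF hne => simp at hp
  | output D H' h =>
    obtain rfl := Finset.mem_singleton.1 hp
    refine ⟨h.regularSystem, ?_⟩
    have hw := h.weight_le hR ht.inv hf ht.weight_le
    rw [Finset.empty_union] at hw
    exact totalOrd_le_of_weight_le hw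

/-- The invariant of the **while**-loop. -/
structure StateInv (I : Ideal (DPoly k n)) (M : ℕ) (s : State k n) : Prop where
  triples : ∀ t ∈ s.U, BoundedTriple M t
  systems : ∀ p ∈ s.T,
    RegularSystem p.1 p.2 ∧ totalOrd (p.1 ∪ p.2) ≤ (n - 1).factorial * M
  ideal_eq : I =
    (⨅ p ∈ s.T, sat (diffIdeal (p.1 : Set (DPoly k n))) p.2) ⊓ ⨅ t ∈ s.U, tripleIdeal t

lemma stateInv_start {F₀ H₀ : Finset (DPoly k n)} (hne : F₀.Nonempty)
    (hF₀ : ∀ f ∈ F₀, ¬ IsConst f) :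
    StateInv (sat (radDiffIdeal (F₀ : Set (DPoly k n))) H₀) (totalOrd (F₀ ∪ H₀)) (start F₀ H₀) := by
  refine ⟨fun t ht => ?_, by simp [start], by simp [start, tripleIdeal]⟩
  obtain rfl := Finset.mem_singleton.1 ht
  refine ⟨⟨hne, hF₀, ⟨by simp, by simp⟩, by simp, by simp, by simp [initSep]⟩, ?_⟩
  have : lvSet (∅ : Finset (DPoly k n)) = ∅ := by simp [lvSet, ldSet]
  simp [this, weight_empty, growth]

variable [CharZero k]

/-- The effect of the body of the **while**-loop. -/
lemma Body.spec (hR : IsRanking n) {M : ℕ} {t : Triple k n} (ht : BoundedTriple M t)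
    {f : DPoly k n} (hf : f ∈ t.F) (hmin : ∀ g ∈ t.F, rk f ≤ rk g) {U' : Finset (Triple k n)}
    {T' : Finset (Finset (DPoly k n) × Finset (DPoly k n))} (hb : Body t f U' T') :
    (∀ t' ∈ U', BoundedTriple M t' ∧ TripleLT t' t) ∧
    (∀ p ∈ T', RegularSystem p.1 p.2 ∧ totalOrd (p.1 ∪ p.2) ≤ (n - 1).factorial * M) ∧
    tripleIdeal t =
      (⨅ p ∈ T', sat (diffIdeal (p.1 : Set (DPoly k n))) p.2) ⊓ ⨅ t' ∈ U', tripleIdeal t' := by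
  obtain ⟨U₁, hres, rfl⟩ := hb.reduceResult hR ht.inv hf
  refine ⟨fun t' ht' => ?_, fun p hp => hres.mem_right hR ht hf hp, ?_⟩
  · rcases Finset.mem_union.1 ht' with h | h
    · exact hres.mem_left hR ht hf h
    · exact mem_split_spec ht hf hmin h
  · rw [tripleIdeal_eq_split (ht.inv.not_isConst f hf), hres.ideal_eq hR hf, Finset.iInf_union,
      inf_assoc]

lemma StateInv.step (hR : IsRanking n) {I : Ideal (DPoly k n)} {M : ℕ} {s s' : State k n}
    (hs : StateInv I M s) (h : Step s s') : StateInv I M s' := by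
  obtain ⟨t, ht, f, hf, hmin, U', T', hb, rfl⟩ := h
  obtain ⟨hU, hT, hI⟩ := hb.spec hR (hs.triples t ht) hf hmin
  refine ⟨fun t' ht' => ?_, fun p hp => ?_, ?_⟩
  · rcases Finset.mem_union.1 ht' with h | h
    · exact hs.triples t' (Finset.mem_of_mem_erase h)
    · exact (hU t' h).1
  · rcases Finset.mem_union.1 hp with h | h
    · exact hs.systems p h
    · exact hT p h
  · have hsU : ⨅ t' ∈ s.U, tripleIdeal t' = tripleIdeal t ⊓ ⨅ t' ∈ s.U.erase t, tripleIdeal t' := by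
      conv_lhs => rw [← Finset.insert_erase ht]
      exact Finset.iInf_insert _ _ _
    rw [hs.ideal_eq, hsU, hI, Finset.iInf_union, Finset.iInf_union]
    ac_rfl

lemma StateInv.of_reachable (hR : IsRanking n) {F₀ H₀ : Finset (DPoly k n)} (hne : F₀.Nonempty)
    (hF₀ : ∀ f ∈ F₀, ¬ IsConst f) {s : State k n} (h : Reachable F₀ H₀ s) :
    StateInv (sat (radDiffIdeal (F₀ : Set (DPoly k n))) H₀) (totalOrd (F₀ ∪ H₀)) s := by
  induction h with
  | refl => exact stateInv_start hne hF₀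
  | tail _ hstep ih => exact ih.step hR hstep

/-- One triple is replaced by finitely many smaller ones, which is a descent in the multiset
extension of `TripleLT`. -/
lemma StateInv.cutExpand (hR : IsRanking n) {I : Ideal (DPoly k n)} {M : ℕ} {s s' : State k n}
    (hs : StateInv I M s) (h : Step s s') :
    Relation.CutExpand TripleLT s'.U.val s.U.val := by
  obtain ⟨t, ht, f, hf, hmin, U', T', hb, rfl⟩ := h
  obtain ⟨hU, -, -⟩ := hb.spec hR (hs.triples t ht) hf hmin
  -- U is a set, so triples of U' that are already present are not counted twice.
  refine ⟨(U' \ s.U.erase t).val, t, fun t' ht' => (hU t' (Finset.mem_sdiff.1 ht').1).2, ?_⟩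
  have h1 : (s.U.erase t ∪ U').val = (s.U.erase t).val + (U' \ s.U.erase t).val := by
    rw [← Finset.union_sdiff_self_eq_union, ← Finset.disjUnion_eq_union _ _ Finset.disjoint_sdiff,
      Finset.disjUnion_val]
  have h2 : s.U.val = (s.U.erase t).val + {t} := by
    rw [Finset.erase_val, add_comm, Multiset.singleton_add, Multiset.cons_erase ht]
  rw [h1, h2]
  abel

/-- There is no infinite run. -/
lemma not_exists_infinite_run (hR : IsRanking n) {F₀ H₀ : Finset (DPoly k n)} (hne : F₀.Nonempty)
    (hF₀ : ∀ f ∈ F₀, ¬ IsConst f) :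
    ¬ ∃ s : ℕ → State k n, s 0 = start F₀ H₀ ∧ ∀ i, Step (s i) (s (i + 1)) := by
  rintro ⟨s, h0, hstep⟩
  have hreach : ∀ i, Reachable F₀ H₀ (s i) := by
    intro i
    induction i with
    | zero => rw [h0]; exact Relation.ReflTransGen.refl
    | succ i ih => exact ih.tail (hstep i)
  obtain ⟨m, ⟨i, rfl⟩, hmin⟩ := (tripleLT_wellFounded (k := k) hR).cutExpand.has_min
    (Set.range fun i => (s i).U.val) (Set.range_nonempty _)
  exact hmin _ ⟨i + 1, rfl⟩ ((StateInv.of_reachable hR hne hF₀ (hreach i)).cutExpand hR (hstep i))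

lemma StateInv.exists_step (hR : IsRanking n) {I : Ideal (DPoly k n)} {M : ℕ} {s : State k n}
    (hs : StateInv I M s) (hne : s.U.Nonempty) : ∃ s', Step s s' := by
  obtain ⟨t, ht⟩ := hne
  have hinv := (hs.triples t ht).inv
  obtain ⟨f, hf, hmin⟩ := Finset.exists_min_image t.F rk hinv.nonempty
  obtain ⟨U', T', hb⟩ := exists_body hR hinv hf
  exact ⟨_, t, ht, f, hf, hmin, U', T', hb, rfl⟩

end run

end DiffAlg

end

/-! ### The proposition -/

theorem mainTheorem6 {k : Type*} [Field k] [CharZero k] [Differential k] {n : ℕ}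
    [LinearOrder (Der n)] (hR : IsRanking n) (F₀ H₀ : Finset (DPoly k n))
    (hne : F₀.Nonempty) (hF₀ : ∀ f ∈ F₀, ¬ IsConst f) :
    (¬ ∃ s : ℕ → State k n, s 0 = start F₀ H₀ ∧ ∀ i, Step (s i) (s (i + 1))) ∧
    (∀ s : State k n, Reachable F₀ H₀ s → s.U.Nonempty → ∃ s', Step s s') ∧
    (∀ s : State k n, Reachable F₀ H₀ s → ∀ t ∈ s.U,
      totalOrd (t.F ∪ t.C ∪ t.H) ≤ (n - 1).factorial * totalOrd (F₀ ∪ H₀)) ∧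
    (∀ s : State k n, Reachable F₀ H₀ s → s.U = ∅ →
      (∀ p ∈ s.T, RegularSystem p.1 p.2) ∧
      sat (radDiffIdeal (F₀ : Set (DPoly k n))) H₀ =
        ⨅ p ∈ s.T, sat (diffIdeal (p.1 : Set (DPoly k n))) p.2 ∧
      ∀ p ∈ s.T, totalOrd (p.1 ∪ p.2) ≤ (n - 1).factorial * totalOrd (F₀ ∪ H₀)) := by
  refine ⟨not_exists_infinite_run hR hne hF₀, fun s hs hU => ?_, fun s hs t ht => ?_,
    fun s hs hU => ?_⟩
  · exact (StateInv.of_reachable hR hne hF₀ hs).exists_step hR hU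
  · exact totalOrd_le_of_weight_le ((StateInv.of_reachable hR hne hF₀ hs).triples t ht).weight_le
  · have h := StateInv.of_reachable hR hne hF₀ hs
    refine ⟨fun p hp => (h.systems p hp).1, ?_, fun p hp => (h.systems p hp).2⟩
    simpa [hU] using h.ideal_eq
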